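/- **Setting.** Let $N\in\mathbb N$, let $\Omega_N=\{Z\in\mathbb C^{N\times N}: Z^*Z=ZZ^*\}$ be the set of normal matrices, let $dU$ be the Haar measure of total mass one on the unitary group $U(N)$, and write $\operatorname{diag}(d)$ for the diagonal matrix with entries $d=(d_1,\dots,d_N)\in\mathbb C^N$ and $\chi_1,\dots,\chi_N$ for the standard basis of $\mathbb C^N$. For $h>0$ let $\mu_h$ be the measure on $\Omega_N$ with $$\int_{\Omega_N} f\,d\mu_h=(\pi h)^{-N}\int_{U(N)}\int_{\mathbb C^N} f(U\operatorname{diag}(d)U^*)\,e^{-\|d\|^2/h}\,dd\,dU .$$ Let $\mathcal H_h$ be the closed linear span of the functions $Z\mapsto Z^k\chi_j$ ($k\ge0$, $1\le j\le N$) in $L^2(\Omega_N,\mu_h;\mathbb C^N)$, whose elements are identified with their continuous representatives, with inner product $\langle f,g\rangle=\int g^*f\,d\mu_h$; its reproducing kernel is $$K_h(X,Y)=\sum_{k=0}^\infty \frac{X^kY^{*k}}{k!\,h^k}.$$ Put $K_{X,\chi}=K_h(\cdot,X)\chi$ for $\chi\in\mathbb C^N$. For $\phi:\Omega_N\to\mathbb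 C^{N\times N}$ the Toeplitz operator is $T_\phi f(X)=\int_{\Omega_N} K_h(X,Y)\phi(Y)f(Y)\,d\mu_h(Y)$. The Berezin transform of an operator $T$ is the matrix function $\widetilde T(X)=K_h(X,X)^{-1/2}M(X)K_h(X,X)^{-1/2}$, where $M(X)$ is the matrix with $\chi'^*M(X)\chi=\langle TK_{X,\chi},K_{X,\chi'}\rangle$ for all $\chi,\chi'\in\mathbb C^N$. A function on $\Omega_N$ is called smooth if near each point of $\Omega_N$ it is the restriction of a $C^\infty$ function on an open subset of $\mathbb C^{N\times N}$. For a function $\phi$ on $\Omega_N$, $U\in U(N)$ and $d\in\mathbb C^N$ write $\phi(U;d)=\phi(U\operatorname{diag}(d)U^*)$, and let $\Delta_{(d)}=\sum_{i=1}^N\frac{\partial^2}{\partial d_i\partial\bar d_i}$. For $1\le m,q\le N$ and $r\ge0$ put $$(\mathcal M_{mq}^r\phi_{ij}\psi_{kl})(U,W;d,e)=\Big(\Delta_{(d)}+\Delta_{(e)}+\frac{\partial^2}{\partial\bar d_m\,\partial e_q}\Big)^r\big[\phi_{ij}(U;d)\,\psi_{kl}(W;e)\big].$$ As usual, $F(h)=O(h^\infty)$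 means $F(h)=O(h^R)$ as $h\searrow0$ for every $R\in\mathbb N$, and $F(h)\approx\sum_{r\ge0}\alpha_rh^r$ means $F(h)-\sum_{r<R}\alpha_rh^r=O(h^R)$ as $h\searrow0$ for every $R\in\mathbb N$. **Theorem.** Let $\phi,\psi:\Omega_N\to\mathbb C^{N\times N}$ be smooth, and suppose that the entries of $\phi$ are $\mu_{h_0}$-integrable for some $h_0>0$ and the entries of $\psi$ are $\mu_{h_1}$-integrable for some $h_1>0$ (this holds for instance if $\phi$ and $\psi$ are bounded or of polynomial growth). Let $X=\operatorname{diag}(c_1,\dots,c_N)$ with $c_1,\dots,c_N\in\mathbb C$. Then for all sufficiently small $h>0$ and all $\chi\in\mathbb C^N$ the functions $K_{X,\chi}$, $T_\psi K_{X,\chi}$ and $T_\phi T_\psi K_{X,\chi}$ belong to $\mathcal H_h$, the integrals defining the last two converging absolutely at every point of $\Omega_N$. Moreover, for all $1\le a,b\le N$, as $h\searrow0$: 1. if $c_a\ne c_b$, then $[\widetilde{T_\phi T_\psi}(X)]_{ab}=O(h^\infty)$; 2. if $c_a=c_b\ne0$, then $$[\widetilde{T_\phi T_\psi}(X)]_{ab}\approx\sum_{r=0}^\infty\frac{h^r}{r!}\sum_{i,j,k,l,m,p,q=1}^N\int_{U(N)}\int_{U(N)}u_{am}\bar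 u_{im}u_{jm}\bar u_{pm}\,w_{pq}\bar w_{kq}w_{lq}\bar w_{bq}\;(\mathcal M_{mq}^r\phi_{ij}\psi_{kl})(U,W;c_a\chi_m,c_a\chi_q)\,dW\,dU;$$ 3. if $c_a=c_b=0$, then $$[\widetilde{T_\phi T_\psi}(X)]_{ab}\approx\sum_{r=0}^\infty\frac{h^r}{r!}\sum_{i,j,k,l,m,p,q,L,M=1}^N\int_{U(N)}\int_{U(N)}u_{aL}\bar u_{iL}u_{jm}\bar u_{pm}\,w_{pq}\bar w_{kq}w_{lM}\bar w_{bM}\;(\mathcal M_{mq}^r\phi_{ij}\psi_{kl})(U,W;0,0)\,dW\,dU.$$ -/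

import Mathlib

open MeasureTheory Filter Topology Asymptotics
open scoped Matrix Matrix.Norms.Elementwise ContDiff ComplexConjugate

noncomputable section

namespace BerezinToeplitz

/-- Complex `N × N` matrices. -/
abbrev Mat (N : ℕ) : Type := Matrix (Fin N) (Fin N) ℂ

/-- The unitary group `U(N)`. -/
abbrev UN (N : ℕ) : Type := Matrix.unitaryGroup (Fin N) ℂ

/-! ### Borel structures and Haar measure -/

instance instMeasurableSpaceMat (N : ℕ) : MeasurableSpace (Mat N) := borel (Mat N)

instance instBorelSpaceMat (N : ℕ) : BorelSpace (Mat N) := ⟨rfl⟩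

instance instCompactSpaceUN (N : ℕ) : CompactSpace (UN N) := by
  apply isCompact_iff_compactSpace.mp
  have hcl : IsClosed ((Matrix.unitaryGroup (Fin N) ℂ : Set (Mat N))) := isClosed_unitary
  have hK : IsCompact (Set.pi Set.univ
      (fun _ : Fin N => Set.pi Set.univ (fun _ : Fin N => Metric.closedBall (0 : ℂ) 1))) :=
    isCompact_univ_pi fun _ => isCompact_univ_pi fun _ => isCompact_closedBall 0 1
  refine IsCompact.of_isClosed_subset (s := (Set.pi Set.univ
      (fun _ : Fin N => Set.pi Set.univ (fun _ : Fin N => Metric.closedBall (0 : ℂ) 1)) :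
      Set (Mat N))) hK hcl ?_
  intro U hU i _ j _
  simpa using entry_norm_bound_of_unitary hU i j

/-- The Haar measure `dU` on `U(N)`, normalized to have total mass one. -/
def haarUN (N : ℕ) : Measure (UN N) := Measure.haarMeasure ⊤

/-! ### Normal matrices and the Gaussian measures on them -/

/-- The set `Ω_N` of normal matrices. -/
def normalMatrices (N : ℕ) : Set (Mat N) := {Z | Zᴴ * Z = Z * Zᴴ}

/-- The normal matrix `U diag(d) U*` with eigenvalues `d` and eigenvectors the columns of `U`. -/
def spectralPoint {N : ℕ} (U : UN N) (d : Fin N → ℂ) : Mat N :=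
  (U : Mat N) * Matrix.diagonal d * (U : Mat N)ᴴ

/-- The Gaussian measure `(π h)^{-N} e^{-‖d‖²/h} dd` on `ℂ^N`. -/
def gaussian (N : ℕ) (h : ℝ) : Measure (Fin N → ℂ) :=
  volume.withDensity fun d =>
    ENNReal.ofReal (((Real.pi * h) ^ N)⁻¹ * Real.exp (-(∑ i, ‖d i‖ ^ 2) / h))

/-- The measure `μ_h` on the normal matrices (as a measure on all matrices that is carried by
`Ω_N`): the image of `dU × (π h)^{-N} e^{-‖d‖²/h} dd` under `(U, d) ↦ U diag(d) U*`. -/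
def normalMeasure (N : ℕ) (h : ℝ) : Measure (Mat N) :=
  ((haarUN N).prod (gaussian N h)).map fun p => spectralPoint p.1 p.2

/-- A matrix-valued function is smooth on `Ω_N` if near every point of `Ω_N` it is the restriction
to `Ω_N` of a `C^∞` function on an open set of matrices. Values outside `Ω_N` play no role. -/
def SmoothOnNormal {N : ℕ} (φ : Mat N → Mat N) : Prop :=
  ∀ Z ∈ normalMatrices N, ∃ V : Set (Mat N), IsOpen V ∧ Z ∈ V ∧
    ∃ g : Mat N → Mat N, ContDiffOn ℝ ∞ g V ∧ Set.EqOn φ g (V ∩ normalMatrices N)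

/-- A matrix-valued function `φ` has entries integrable against the Gaussian measure `μ_{h₀}` for
some `h₀ > 0`. -/
def GaussianIntegrable {N : ℕ} (φ : Mat N → Mat N) : Prop :=
  ∃ h₀ : ℝ, 0 < h₀ ∧ ∀ i j, Integrable (fun Y => φ Y i j) (normalMeasure N h₀)

/-! ### The reproducing kernel Hilbert space, Toeplitz operators and the Berezin transform -/

/-- The reproducing kernel `K_h(X, Y) = ∑ₖ Xᵏ Y*ᵏ / (k! hᵏ)`. -/
def kernel {N : ℕ} (h : ℝ) (X Y : Mat N) : Mat N :=
  ∑' k : ℕ, ((k.factorial : ℂ) * (h : ℂ) ^ k)⁻¹ • (X ^ k * Yᴴ ^ k)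

/-- The function `K_{Y,χ} = K_h(·, Y) χ`. -/
def kernelFun {N : ℕ} (h : ℝ) (Y : Mat N) (χ : Fin N → ℂ) : Mat N → (Fin N → ℂ) :=
  fun X => kernel h X Y *ᵥ χ

/-- The linear span of the functions `Z ↦ Zᵏ χ_j`. -/
def polySpan (N : ℕ) : Submodule ℂ (Mat N → (Fin N → ℂ)) :=
  Submodule.span ℂ
    (Set.range fun p : ℕ × Fin N => fun Z : Mat N => Z ^ p.1 *ᵥ Pi.single p.2 1)

/-- The inner product `⟨f, g⟩ = ∫ g* f dμ_h` of `ℂ^N`-valued functions. -/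
def innerL2 {N : ℕ} (h : ℝ) (f g : Mat N → (Fin N → ℂ)) : ℂ :=
  ∫ Y, star (g Y) ⬝ᵥ f Y ∂(normalMeasure N h)

/-- Membership in `H_h`, the closed span of the functions `Zᵏ χ_j` in `L²(Ω_N, μ_h; ℂ^N)`; as
usual for a reproducing kernel space its elements are represented by their continuous versions,
which are unique since `μ_h` charges every nonempty relatively open subset of `Ω_N`. -/
def MemH {N : ℕ} (h : ℝ) (f : Mat N → (Fin N → ℂ)) : Prop :=
  ContinuousOn f (normalMatrices N) ∧
  MemLp f 2 (normalMeasure N h) ∧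
  ∀ ε : ℝ, 0 < ε → ∃ p ∈ polySpan N,
    ∫⁻ Y, (∑ i, ‖f Y i - p Y i‖ₑ ^ 2) ∂(normalMeasure N h) ≤ ENNReal.ofReal ε

/-- The Toeplitz operator `T_φ f(X) = ∫ K_h(X, Y) φ(Y) f(Y) dμ_h(Y)`. -/
def toeplitz {N : ℕ} (h : ℝ) (φ : Mat N → Mat N) (f : Mat N → (Fin N → ℂ)) :
    Mat N → (Fin N → ℂ) :=
  fun X => ∫ Y, kernel h X Y *ᵥ (φ Y *ᵥ f Y) ∂(normalMeasure N h)

/-- `T_φ f` is well defined as an element of `H_h`: the element `f` is in `H_h`, the defining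
integrals converge absolutely at all points of `Ω_N`, and the resulting function is in `H_h`. -/
def ToeplitzDefined {N : ℕ} (h : ℝ) (φ : Mat N → Mat N) (f : Mat N → (Fin N → ℂ)) : Prop :=
  MemH h f ∧
  (∀ X ∈ normalMatrices N,
    Integrable (fun Y => kernel h X Y *ᵥ (φ Y *ᵥ f Y)) (normalMeasure N h)) ∧
  MemH h (toeplitz h φ f)

/-- The inverse square root `A^{-1/2}` of a positive definite matrix. -/
def invSqrt {N : ℕ} (A : Mat N) : Mat N := cfc (fun t : ℝ => (√t)⁻¹) A

/-- The matrix with `χ'* M χ = ⟨T K_{X,χ}, K_{X,χ'}⟩`. -/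
def preBerezin {N : ℕ} (h : ℝ) (T : (Mat N → (Fin N → ℂ)) → (Mat N → (Fin N → ℂ)))
    (X : Mat N) : Mat N :=
  Matrix.of fun a b =>
    innerL2 h (T (kernelFun h X (Pi.single b 1))) (kernelFun h X (Pi.single a 1))

/-- The Berezin transform `K(X,X)^{-1/2} M K(X,X)^{-1/2}` of an operator `T`, where `M` is the
matrix with `χ'* M χ = ⟨T K_{X,χ}, K_{X,χ'}⟩`. -/
def berezin {N : ℕ} (h : ℝ) (T : (Mat N → (Fin N → ℂ)) → (Mat N → (Fin N → ℂ)))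
    (X : Mat N) : Mat N :=
  invSqrt (kernel h X X) * preBerezin h T X * invSqrt (kernel h X X)

/-! ### Differential operators and coefficients of the expansion -/

/-- The Wirtinger derivative `∂F = ½ (F'(x) v - i F'(x) (i v))` along the complex direction `v`. -/
def dWirt {E : Type*} [NormedAddCommGroup E] [NormedSpace ℂ E] [NormedSpace ℝ E]
    (v : E) (F : E → ℂ) : E → ℂ :=
  fun x => (1 / 2) * (fderiv ℝ F x v - Complex.I * fderiv ℝ F x (Complex.I • v))

/-- The Wirtinger derivative `∂̄F = ½ (F'(x) v + i F'(x) (i v))` along the complex direction `v`. -/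
def dbarWirt {E : Type*} [NormedAddCommGroup E] [NormedSpace ℂ E] [NormedSpace ℝ E]
    (v : E) (F : E → ℂ) : E → ℂ :=
  fun x => (1 / 2) * (fderiv ℝ F x v + Complex.I * fderiv ℝ F x (Complex.I • v))

/-- Pairs `(d, e) ∈ ℂ^N × ℂ^N`. -/
abbrev Pairs (N : ℕ) : Type := (Fin N → ℂ) × (Fin N → ℂ)

/-- The coordinate direction of `d_m`. -/
def dirD {N : ℕ} (m : Fin N) : Pairs N := (Pi.single m 1, 0)

/-- The coordinate direction of `e_q`. -/
def dirE {N : ℕ} (q : Fin N) : Pairs N := (0, Pi.single q 1)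

/-- The operator `Δ_(d) + Δ_(e) + ∂²/∂d̄_m ∂e_q` on functions of `(d, e)`, where
`Δ_(d) = ∑ᵢ ∂²/∂dᵢ ∂d̄ᵢ` and likewise for `e`. -/
def mixedOp {N : ℕ} (m q : Fin N) (F : Pairs N → ℂ) : Pairs N → ℂ :=
  fun x => (∑ i, dWirt (dirD i) (dbarWirt (dirD i) F) x) +
    (∑ i, dWirt (dirE i) (dbarWirt (dirE i) F) x) +
    dbarWirt (dirD m) (dWirt (dirE q) F) x

/-- `(M_{mq}^r φ_{ij} ψ_{kl})(U, W; d, e)`. -/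
def opM {N : ℕ} (m q : Fin N) (r : ℕ) (φ ψ : Mat N → Mat N) (i j k l : Fin N) (U W : UN N) :
    Pairs N → ℂ :=
  (mixedOp m q)^[r] fun x => φ (spectralPoint U x.1) i j * ψ (spectralPoint W x.2) k l

/-- The coefficient at `h^r` for entries `(a, b)` with `c_a = c_b = z ≠ 0`. -/
def coeffNonzero {N : ℕ} (φ ψ : Mat N → Mat N) (z : ℂ) (a b : Fin N) (r : ℕ) : ℂ :=
  (r.factorial : ℂ)⁻¹ * ∑ i, ∑ j, ∑ k, ∑ l, ∑ m, ∑ p, ∑ q,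
    ∫ U : UN N, ∫ W : UN N,
      (U.1 a m * conj (U.1 i m) * U.1 j m * conj (U.1 p m) * W.1 p q * conj (W.1 k q) *
        W.1 l q * conj (W.1 b q)) *
        opM m q r φ ψ i j k l U W (Pi.single m z, Pi.single q z) ∂(haarUN N) ∂(haarUN N)

/-- The coefficient at `h^r` for entries `(a, b)` with `c_a = c_b = 0`. -/
def coeffZero {N : ℕ} (φ ψ : Mat N → Mat N) (a b : Fin N) (r : ℕ) : ℂ :=
  (r.factorial : ℂ)⁻¹ * ∑ i, ∑ j, ∑ k, ∑ l, ∑ m, ∑ p, ∑ q, ∑ L, ∑ M,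
    ∫ U : UN N, ∫ W : UN N,
      (U.1 a L * conj (U.1 i L) * U.1 j m * conj (U.1 p m) * W.1 p q * conj (W.1 k q) *
        W.1 l M * conj (W.1 b M)) *
        opM m q r φ ψ i j k l U W 0 ∂(haarUN N) ∂(haarUN N)

/-- `F(h) = O(h^∞)` as `h ↘ 0`. -/
def IsRapidlyDecaying (F : ℝ → ℂ) : Prop :=
  ∀ R : ℕ, F =O[𝓝[>] 0] fun h => h ^ R

/-- `F(h) ≈ ∑_r h^r α_r` as `h ↘ 0`. -/
def HasAsymptoticExpansion (F : ℝ → ℂ) (α : ℕ → ℂ) : Prop :=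
  ∀ R : ℕ, (fun h : ℝ => F h - ∑ r ∈ Finset.range R, (h : ℂ) ^ r * α r) =O[𝓝[>] 0]
    fun h => h ^ R

end BerezinToeplitz

end

open BerezinToeplitz

open MeasureTheory Filter Topology Asymptotics
open scoped Matrix Matrix.Norms.Elementwise ContDiff ComplexConjugate

namespace BerezinToeplitz

section

/-! ### The Frobenius size of a matrix -/

/-! In the coordinates `(U, d)` everything is a scalar Gaussian integral. Since `(U diag(d) U*)^k =
U diag(d^k) U*`, the kernel between two spectral points is a finite sum of monomials in entries of
`U`, `W` times `exp(d_m ē_q / h)` (`kernel_spectralPoint`). Integrating such exponentials against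
the weight gives the reproducing property (`proj_kernelFun`, `proj_proj`), so `⟨T_φ T_ψ K_{X,χ_b},
K_{X,χ_a}⟩` is the entry `a` of `T_φ T_ψ K_{X,χ_b}` at `X` (`innerL2_kernelFun`). Because `K_h(X,
X)` is diagonal, the `(a, b)` entry of the Berezin transform is a finite sum of integrals over `U`,
`W`, `d`, `e` of a unitary monomial times `φ_ij ψ_kl exp(phase / h)` (`berezin_eq_sum`), where, with
`z = c_a` and `w = c_b`, `phase = -|d|² - |e|² + d_m ē_q + z d̄_L + e_M w̄ - (|z|² + |w|²)/2`.

The real part of the phase splits into a part in `d`, a part in `e` and `-|d_m - e_q|²/2`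
(`re_phase`). It is bounded away from zero from above, with quadratic decay, unless `z = w`, and `L
= m` or `z = 0`, and `M = q` or `w = 0` (`exists_re_phase_le_neg`). The remaining terms are
`O(h^∞)`; this gives the off-diagonal decay and removes the sums over `L`, `M` when `z ≠ 0`.

For a surviving term the phase, recentred at `(z χ_m, z χ_q)`, is exactly the quadratic form
`quadExp` (`phase_single_add`), so no stationary phase remainder appears. Scaling by `√h = t` leaves
`t ↦ ∫ F(p + t y) exp(quadExp y) dy`. Integration by parts shows that its derivative is `2t` times
the same average of `mixedOp F` (`hasDerivAt_gaussAvg`): a heat equation in the time `t² = h`, whose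
Taylor expansion is the asserted series (`gaussAvg_expansion`). A cutoff near `p` reduces to
compactly supported functions, and compactness of `U(N)` makes the remainders uniform
(`hasAsymptoticExpansion_term`).

Well-definedness is a matter of Gaussian growth: if `F` has a finite integral against `exp(a|Y|²/h)
dμ_h`, its image under the kernel is an entire series of growth `exp(|X|²/(4ah))`, which lies in the
space once `a > 1/2` (`memH_proj`). Two applications fit when `h` is small. Finally, smooth symbols
on the closed set of normal matrices extend smoothly to all matrices, and only the values on normal
matrices matter. -/

/-- The square of the Frobenius norm. -/
noncomputable def nsq {N : ℕ} (A : Mat N) : ℝ := ∑ i, ∑ j, ‖A i j‖ ^ 2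

/-- The Frobenius norm. -/
noncomputable def frob {N : ℕ} (A : Mat N) : ℝ := √(nsq A)

variable {N : ℕ}

lemma nsq_nonneg (A : Mat N) : 0 ≤ nsq A :=
  Finset.sum_nonneg fun _ _ => Finset.sum_nonneg fun _ _ => by positivity

lemma frob_nonneg (A : Mat N) : 0 ≤ frob A := Real.sqrt_nonneg _

lemma frob_sq (A : Mat N) : frob A ^ 2 = nsq A := Real.sq_sqrt (nsq_nonneg A)

lemma continuous_entry (i j : Fin N) : Continuous fun A : Mat N => A i j :=
  (continuous_apply j).comp (continuous_apply i)

lemma continuous_nsq : Continuous (nsq : Mat N → ℝ) :=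
  continuous_finsetSum _ fun i _ => continuous_finsetSum _ fun j _ =>
    ((continuous_entry i j).norm.pow 2)

lemma continuous_frob : Continuous (frob : Mat N → ℝ) := continuous_nsq.sqrt

lemma norm_entry_le_frob (A : Mat N) (i j : Fin N) : ‖A i j‖ ≤ frob A := by
  apply Real.le_sqrt_of_sq_le
  calc ‖A i j‖ ^ 2 ≤ ∑ j, ‖A i j‖ ^ 2 :=
        Finset.single_le_sum (f := fun j => ‖A i j‖ ^ 2) (fun _ _ => by positivity)
          (Finset.mem_univ j)
    _ ≤ _ := Finset.single_le_sum (f := fun i => ∑ j, ‖A i j‖ ^ 2)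
        (fun _ _ => Finset.sum_nonneg fun _ _ => by positivity) (Finset.mem_univ i)

/-- Cauchy–Schwarz in each entry. This submultiplicativity fails for the ambient elementwise norm,
which is why sizes of powers are measured by `frob`. -/
lemma nsq_mul_le (A B : Mat N) : nsq (A * B) ≤ nsq A * nsq B := by
  have h : ∀ i k, ‖(A * B) i k‖ ^ 2 ≤ (∑ j, ‖A i j‖ ^ 2) * ∑ j, ‖B j k‖ ^ 2 := by
    intro i k
    calc ‖(A * B) i k‖ ^ 2 ≤ (∑ j, ‖A i j‖ * ‖B j k‖) ^ 2 := by
          gcongr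
          rw [Matrix.mul_apply]
          exact (norm_sum_le _ _).trans_eq (by simp)
      _ ≤ _ := Finset.sum_mul_sq_le_sq_mul_sq _ _ _
  calc nsq (A * B) ≤ ∑ i, ∑ k, (∑ j, ‖A i j‖ ^ 2) * ∑ j, ‖B j k‖ ^ 2 :=
        Finset.sum_le_sum fun i _ => Finset.sum_le_sum fun k _ => h i k
    _ = nsq A * nsq B := by
        rw [nsq, nsq, Finset.sum_comm (f := fun i j => ‖B i j‖ ^ 2), Finset.sum_mul_sum]

lemma frob_mul_le (A B : Mat N) : frob (A * B) ≤ frob A * frob B := by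
  rw [frob, frob, frob, ← Real.sqrt_mul (nsq_nonneg A)]
  exact Real.sqrt_le_sqrt (nsq_mul_le A B)

lemma frob_pow_succ_le (A : Mat N) (k : ℕ) : frob (A ^ (k + 1)) ≤ frob A ^ (k + 1) := by
  induction k with
  | zero => simp
  | succ k ih =>
    rw [pow_succ A, pow_succ (frob A)]
    exact (frob_mul_le _ _).trans (by gcongr; exact frob_nonneg A)

/-- Passing to entries makes the bound valid also for `k = 0`, where the Frobenius norm of the
identity is `√N` but its entries are at most one. -/
lemma norm_pow_entry_le (A : Mat N) (k : ℕ) (i j : Fin N) : ‖(A ^ k) i j‖ ≤ frob A ^ k := by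
  cases k with
  | zero =>
    rw [pow_zero, pow_zero, Matrix.one_apply]
    split_ifs <;> simp
  | succ k => exact (norm_entry_le_frob _ i j).trans (frob_pow_succ_le A k)

lemma nsq_conjTranspose (A : Mat N) : nsq Aᴴ = nsq A := by
  simp only [nsq, Matrix.conjTranspose_apply, norm_star]
  exact Finset.sum_comm

lemma frob_conjTranspose (A : Mat N) : frob Aᴴ = frob A := by rw [frob, nsq_conjTranspose, frob]

lemma nsq_eq_trace (A : Mat N) : (nsq A : ℂ) = (A * Aᴴ).trace := by
  simp [nsq, Matrix.trace, Matrix.mul_apply, Complex.mul_conj']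

lemma unitary_conjTranspose_mul (U : UN N) : (U : Mat N)ᴴ * (U : Mat N) = 1 :=
  Unitary.coe_star_mul_self U

lemma unitary_mul_conjTranspose (U : UN N) : (U : Mat N) * (U : Mat N)ᴴ = 1 :=
  Unitary.coe_mul_star_self U

lemma spectralPoint_mul (U : UN N) (d e : Fin N → ℂ) :
    spectralPoint U d * spectralPoint U e = spectralPoint U (d * e) := by
  simp only [spectralPoint]
  calc _ = (U : Mat N) * Matrix.diagonal d * ((U : Mat N)ᴴ * (U : Mat N)) * Matrix.diagonal e
          * (U : Mat N)ᴴ := by simp only [Matrix.mul_assoc]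
    _ = _ := by
      rw [unitary_conjTranspose_mul, Matrix.mul_one, Matrix.mul_assoc (U : Mat N),
        Matrix.diagonal_mul_diagonal]
      rfl

lemma spectralPoint_conjTranspose (U : UN N) (d : Fin N → ℂ) :
    (spectralPoint U d)ᴴ = spectralPoint U (star d) := by
  simp [spectralPoint, Matrix.mul_assoc]

lemma spectralPoint_pow (U : UN N) (d : Fin N → ℂ) (k : ℕ) :
    spectralPoint U d ^ k = spectralPoint U (d ^ k) := by
  induction k with
  | zero => simp [spectralPoint, unitary_mul_conjTranspose]
  | succ k ih => rw [pow_succ, ih, spectralPoint_mul, pow_succ]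

lemma spectralPoint_mem (U : UN N) (d : Fin N → ℂ) : spectralPoint U d ∈ normalMatrices N := by
  simp only [normalMatrices, Set.mem_ofPred_eq, spectralPoint_conjTranspose, spectralPoint_mul,
    mul_comm]

lemma spectralPoint_entry (U : UN N) (d : Fin N → ℂ) (i j : Fin N) :
    spectralPoint U d i j = ∑ m, U.1 i m * d m * conj (U.1 j m) := by
  simp [spectralPoint, Matrix.mul_apply, Matrix.diagonal_apply]

lemma spectralPoint_one (d : Fin N → ℂ) : spectralPoint 1 d = Matrix.diagonal d := by
  simp [spectralPoint]

/-- The trace of `Z Z*` is unitarily invariant. This lets the Gaussian weight in `d` be regarded as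
a function of the matrix alone. -/
lemma nsq_spectralPoint (U : UN N) (d : Fin N → ℂ) :
    nsq (spectralPoint U d) = ∑ i, ‖d i‖ ^ 2 := by
  have h : (nsq (spectralPoint U d) : ℂ) = ((∑ i, ‖d i‖ ^ 2 : ℝ) : ℂ) := by
    rw [nsq_eq_trace, spectralPoint_conjTranspose, spectralPoint_mul, spectralPoint,
      Matrix.trace_mul_comm, ← Matrix.mul_assoc, unitary_conjTranspose_mul, Matrix.one_mul,
      Matrix.trace_diagonal]
    simp [Complex.mul_conj']
  exact_mod_cast h

lemma continuous_spectralPoint :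
    Continuous fun p : UN N × (Fin N → ℂ) => spectralPoint p.1 p.2 := by
  unfold spectralPoint
  have h1 : Continuous fun p : UN N × (Fin N → ℂ) => (p.1 : Mat N) :=
    continuous_subtype_val.comp continuous_fst
  have h2 : Continuous fun p : UN N × (Fin N → ℂ) => (Matrix.diagonal p.2 : Mat N) :=
    continuous_snd.matrix_diagonal
  exact (h1.matrix_mul h2).matrix_mul h1.matrix_conjTranspose

lemma norm_mulVec_le (A : Mat N) (v : Fin N → ℂ) : ‖A *ᵥ v‖ ≤ N * ‖A‖ * ‖v‖ := by
  refine (pi_norm_le_iff_of_nonneg (by positivity)).2 fun i => ?_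
  calc ‖(A *ᵥ v) i‖ ≤ ∑ j, ‖A i j * v j‖ := norm_sum_le Finset.univ fun j => A i j * v j
    _ ≤ ∑ _j : Fin N, ‖A‖ * ‖v‖ := Finset.sum_le_sum fun j _ => by
        rw [norm_mul]
        gcongr
        · exact Matrix.norm_entry_le_entrywise_sup_norm A
        · exact norm_le_pi_norm v j
    _ = _ := by simp [mul_assoc]

lemma norm_pow_le_frob (A : Mat N) (k : ℕ) : ‖A ^ k‖ ≤ frob A ^ k :=
  (Matrix.norm_le_iff (pow_nonneg (frob_nonneg A) k)).2 fun i j => norm_pow_entry_le A k i j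

lemma norm_mul_le_elementwise (A B : Mat N) : ‖A * B‖ ≤ N * ‖A‖ * ‖B‖ := by
  refine (Matrix.norm_le_iff (by positivity)).2 fun i k => ?_
  rw [Matrix.mul_apply]
  calc _ ≤ ∑ j, ‖A i j * B j k‖ := norm_sum_le _ _
    _ ≤ ∑ _j : Fin N, ‖A‖ * ‖B‖ := Finset.sum_le_sum fun j _ => by
        rw [norm_mul]
        gcongr <;> exact Matrix.norm_entry_le_entrywise_sup_norm _
    _ = _ := by simp [mul_assoc]

/-! ### The kernel -/

lemma norm_kernel_term_le {h : ℝ} (hh : 0 < h) (X Y : Mat N) (k : ℕ) :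
    ‖((k.factorial : ℂ) * (h : ℂ) ^ k)⁻¹ • (X ^ k * Yᴴ ^ k)‖ ≤
      N * ((frob X * frob Y / h) ^ k / k.factorial) := by
  rw [norm_smul]
  have h1 : ‖((k.factorial : ℂ) * (h : ℂ) ^ k)⁻¹‖ = ((k.factorial : ℝ) * h ^ k)⁻¹ := by
    simp [abs_of_pos hh]
  have h2 : ‖X ^ k * Yᴴ ^ k‖ ≤ N * frob X ^ k * frob Y ^ k := by
    refine (norm_mul_le_elementwise _ _).trans ?_
    have h3 := norm_pow_le_frob X k
    have h4 := norm_pow_le_frob Yᴴ k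
    rw [frob_conjTranspose] at h4
    have := pow_nonneg (frob_nonneg X) k
    gcongr
  rw [h1]
  calc _ ≤ ((k.factorial : ℝ) * h ^ k)⁻¹ * (N * frob X ^ k * frob Y ^ k) := by gcongr
    _ = _ := by
      rw [div_pow, mul_pow]
      field_simp

lemma summable_kernel_bound (h x y : ℝ) :
    Summable fun k : ℕ => (N : ℝ) * ((x * y / h) ^ k / k.factorial) :=
  (Real.summable_pow_div_factorial _).mul_left _

lemma hasSum_kernel {h : ℝ} (hh : 0 < h) (X Y : Mat N) :
    HasSum (fun k : ℕ => ((k.factorial : ℂ) * (h : ℂ) ^ k)⁻¹ • (X ^ k * Yᴴ ^ k))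
      (kernel h X Y) :=
  (Summable.of_norm_bounded (summable_kernel_bound h (frob X) (frob Y))
    (norm_kernel_term_le hh X Y)).hasSum

lemma norm_kernel_le {h : ℝ} (hh : 0 < h) (X Y : Mat N) :
    ‖kernel h X Y‖ ≤ N * Real.exp (frob X * frob Y / h) := by
  have h1 : HasSum (fun k : ℕ => (N : ℝ) * ((frob X * frob Y / h) ^ k / k.factorial))
      (N * Real.exp (frob X * frob Y / h)) := by
    rw [Real.exp_eq_exp_ℝ]
    exact (NormedSpace.expSeries_div_hasSum_exp (frob X * frob Y / h)).mul_left _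
  rw [kernel]
  exact tsum_of_norm_bounded h1 (norm_kernel_term_le hh X Y)

lemma continuous_kernel {h : ℝ} (hh : 0 < h) :
    Continuous fun p : Mat N × Mat N => kernel h p.1 p.2 := by
  rw [continuous_iff_continuousAt]
  intro p
  have hU : {q : Mat N × Mat N | frob q.1 < frob p.1 + 1 ∧ frob q.2 < frob p.2 + 1} ∈ 𝓝 p := by
    refine IsOpen.mem_nhds ?_ ⟨by linarith, by linarith⟩
    exact (isOpen_lt (continuous_frob.comp continuous_fst) continuous_const).inter
      (isOpen_lt (continuous_frob.comp continuous_snd) continuous_const)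
  refine ContinuousOn.continuousAt (continuousOn_tsum (fun k => ?_)
    (summable_kernel_bound (N := N) h (frob p.1 + 1) (frob p.2 + 1)) ?_) hU
  · have h1 : Continuous fun q : Mat N × Mat N => q.1 ^ k := continuous_fst.pow k
    have h2 : Continuous fun q : Mat N × Mat N => q.2ᴴ ^ k :=
      continuous_snd.matrix_conjTranspose.pow k
    exact ((h1.matrix_mul h2).const_smul
      (((k.factorial : ℂ) * (h : ℂ) ^ k)⁻¹)).continuousOn
  · intro k q hq
    refine (norm_kernel_term_le hh q.1 q.2 k).trans ?_
    have := frob_nonneg q.1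
    have := frob_nonneg q.2
    have h1 := hq.1.le
    have h2 := hq.2.le
    have : 0 ≤ frob p.1 + 1 := by linarith
    gcongr

/-- Powers act on the eigenvalues only, so the matrix series resums to scalar exponentials. Every
later integral becomes a scalar Gaussian because of this formula. -/
lemma kernel_spectralPoint {h : ℝ} (hh : 0 < h) (U W : UN N) (d e : Fin N → ℂ) (i j : Fin N) :
    kernel h (spectralPoint U d) (spectralPoint W e) i j =
      ∑ m, ∑ p, ∑ q, U.1 i m * conj (U.1 p m) * W.1 p q * conj (W.1 j q) *
        Complex.exp (d m * conj (e q) / h) := by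
  have h1 : HasSum (fun k : ℕ => (((k.factorial : ℂ) * (h : ℂ) ^ k)⁻¹ •
      (spectralPoint U d ^ k * (spectralPoint W e)ᴴ ^ k)) i j)
      (kernel h (spectralPoint U d) (spectralPoint W e) i j) :=
    Pi.hasSum.1 (Pi.hasSum.1 (hasSum_kernel hh _ _) i) j
  refine h1.unique ?_
  have h2 : ∀ m p q, HasSum (fun k : ℕ => U.1 i m * conj (U.1 p m) * W.1 p q * conj (W.1 j q) *
      ((d m * conj (e q) / h) ^ k / k.factorial))
      (U.1 i m * conj (U.1 p m) * W.1 p q * conj (W.1 j q) *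
        Complex.exp (d m * conj (e q) / h)) := by
    intro m p q
    rw [Complex.exp_eq_exp_ℂ]
    exact (NormedSpace.expSeries_div_hasSum_exp (d m * conj (e q) / (h : ℂ))).mul_left _
  convert hasSum_sum fun m (_ : m ∈ Finset.univ) => hasSum_sum fun p (_ : p ∈ Finset.univ) =>
    hasSum_sum fun q (_ : q ∈ Finset.univ) => h2 m p q using 1
  funext k
  rw [spectralPoint_conjTranspose, spectralPoint_pow, spectralPoint_pow, Matrix.smul_apply,
    Matrix.mul_apply]
  simp only [spectralPoint_entry, Finset.sum_mul_sum, Finset.smul_sum]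
  rw [Finset.sum_comm]
  refine Finset.sum_congr rfl fun m _ => Finset.sum_congr rfl fun p _ =>
    Finset.sum_congr rfl fun q _ => ?_
  simp only [Pi.pow_apply, Pi.star_apply, smul_eq_mul, div_eq_mul_inv, mul_pow, mul_inv,
    RCLike.star_def, inv_pow]
  ring

lemma kernel_diagonal_left {h : ℝ} (hh : 0 < h) (W : UN N) (c e : Fin N → ℂ) (i j : Fin N) :
    kernel h (Matrix.diagonal c) (spectralPoint W e) i j =
      ∑ q, W.1 i q * conj (W.1 j q) * Complex.exp (c i * conj (e q) / h) := by
  rw [← spectralPoint_one, kernel_spectralPoint hh]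
  rw [Finset.sum_eq_single i, Finset.sum_eq_single i]
  · simp
  · intro p _ hp
    simp [hp]
  · simp
  · intro m _ hm
    simp [Matrix.one_apply, hm.symm]
  · simp

lemma kernel_diagonal_right {h : ℝ} (hh : 0 < h) (W : UN N) (c e : Fin N → ℂ) (i j : Fin N) :
    kernel h (spectralPoint W e) (Matrix.diagonal c) i j =
      ∑ q, W.1 i q * conj (W.1 j q) * Complex.exp (e q * conj (c j) / h) := by
  rw [← spectralPoint_one, kernel_spectralPoint hh]
  refine Finset.sum_congr rfl fun q _ => ?_
  rw [Finset.sum_eq_single j, Finset.sum_eq_single j]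
  · simp
  · intro p _ hp
    simp [hp.symm]
  · simp
  · intro m _ hm
    simp [Matrix.one_apply, hm]
  · simp

lemma kernel_diagonal {h : ℝ} (hh : 0 < h) (c : Fin N → ℂ) :
    kernel h (Matrix.diagonal c) (Matrix.diagonal c) =
      Matrix.diagonal fun i => ((Real.exp (‖c i‖ ^ 2 / h) : ℝ) : ℂ) := by
  ext i j
  have := kernel_diagonal_left hh (1 : UN N) c c i j
  rw [spectralPoint_one] at this
  rw [this, Finset.sum_eq_single i]
  · by_cases hij : i = j
    · subst hij
      simp [Complex.mul_conj']
    · simp [hij, Ne.symm hij]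
  · intro q _ hq
    simp [Matrix.one_apply, hq.symm]
  · simp

lemma kernel_conjTranspose {h : ℝ} (hh : 0 < h) (X Y : Mat N) (i j : Fin N) :
    conj (kernel h X Y i j) = kernel h Y X j i := by
  have h1 : HasSum (fun k : ℕ => (((k.factorial : ℂ) * (h : ℂ) ^ k)⁻¹ •
      (X ^ k * Yᴴ ^ k)) i j) (kernel h X Y i j) :=
    Pi.hasSum.1 (Pi.hasSum.1 (hasSum_kernel hh _ _) i) j
  have h2 : HasSum (fun k : ℕ => (((k.factorial : ℂ) * (h : ℂ) ^ k)⁻¹ •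
      (Y ^ k * Xᴴ ^ k)) j i) (kernel h Y X j i) :=
    Pi.hasSum.1 (Pi.hasSum.1 (hasSum_kernel hh _ _) j) i
  refine (h1.map (starRingEnd ℂ) Complex.continuous_conj).unique ?_
  convert h2 using 1
  funext k
  have h3 : Y ^ k * Xᴴ ^ k = (X ^ k * Yᴴ ^ k)ᴴ := by
    rw [Matrix.conjTranspose_mul, Matrix.conjTranspose_pow, Matrix.conjTranspose_pow,
      Matrix.conjTranspose_conjTranspose]
  rw [h3]
  change conj (((k.factorial : ℂ) * (h : ℂ) ^ k)⁻¹ * (X ^ k * Yᴴ ^ k) i j) =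
    ((k.factorial : ℂ) * (h : ℂ) ^ k)⁻¹ * (X ^ k * Yᴴ ^ k)ᴴ j i
  rw [Matrix.conjTranspose_apply]
  simp

end

section

/-! ### Complex Gaussian integrals -/

/-- The exponent `-b |z|² + α z + β z̄`. -/
noncomputable def gaussExponent (b : ℝ) (α β z : ℂ) : ℂ :=
  -b * ‖z‖ ^ 2 + α * z + β * conj z

/-- In `z = x + iy` the quadratic form has no cross term, so the integral is a product of two real
Gaussians with linear coefficients `α + β` and `i(α - β)`. -/
lemma gaussExponent_real_prod (b : ℝ) (α β : ℂ) (p : ℝ × ℝ) :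
    Complex.exp (gaussExponent b α β (Complex.measurableEquivRealProd.symm p)) =
      Complex.exp (-b * p.1 ^ 2 + (α + β) * p.1 + 0) *
        Complex.exp (-b * p.2 ^ 2 + (Complex.I * (α - β)) * p.2 + 0) := by
  rw [← Complex.exp_add, gaussExponent, ← Complex.conj_mul']
  congr 1
  have h1 : Complex.measurableEquivRealProd.symm p = p.1 + p.2 * Complex.I := by
    apply Complex.ext <;> simp
  rw [h1]
  simp only [map_add, map_mul, Complex.conj_ofReal, Complex.conj_I]
  linear_combination (b * (p.2 : ℂ) ^ 2) * Complex.I_sq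

lemma integrable_cexp_gaussExponent {b : ℝ} (hb : 0 < b) (α β : ℂ) :
    Integrable fun z : ℂ => Complex.exp (gaussExponent b α β z) := by
  rw [← (Complex.volume_preserving_equiv_real_prod.symm _).integrable_comp_emb
    (MeasurableEquiv.measurableEmbedding _)]
  have hb' : 0 < (b : ℂ).re := by simpa using hb
  refine ((integrable_cexp_quadratic hb' (α + β) 0).mul_prod
    (integrable_cexp_quadratic hb' (Complex.I * (α - β)) 0)).congr (ae_of_all _ fun p => ?_)
  exact (gaussExponent_real_prod b α β p).symm

lemma integral_cexp_gaussExponent {b : ℝ} (hb : 0 < b) (α β : ℂ) :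
    ∫ z : ℂ, Complex.exp (gaussExponent b α β z) = Real.pi / b * Complex.exp (α * β / b) := by
  rw [← (Complex.volume_preserving_equiv_real_prod.symm _).integral_comp
    (MeasurableEquiv.measurableEmbedding _)]
  have hb' : (-(b : ℂ)).re < 0 := by simpa using hb
  have hb0 : (b : ℂ) ≠ 0 := by exact_mod_cast hb.ne'
  simp_rw [gaussExponent_real_prod]
  rw [Measure.volume_eq_prod, integral_prod_mul (fun x : ℝ =>
      Complex.exp (-b * (x : ℂ) ^ 2 + (α + β) * x + 0)) (fun x : ℝ =>
      Complex.exp (-b * (x : ℂ) ^ 2 + (Complex.I * (α - β)) * x + 0)), integral_cexp_quadratic hb', integral_cexp_quadratic hb',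
    mul_mul_mul_comm, ← Complex.exp_add, ← Complex.cpow_add _ _ (by
      rw [neg_neg]
      exact div_ne_zero (by exact_mod_cast Real.pi_ne_zero) hb0)]
  -- The two square roots of `π/b` multiply to `π/b`, and `((α + β)² - (α - β)²)/(4b) = αβ/b`.
  congr 1
  · norm_num
  · congr 1
    field_simp
    linear_combination ((α - β) ^ 2) * Complex.I_sq

lemma integrable_cexp_sum_gaussExponent {ι : Type*} [Fintype ι] {b : ℝ} (hb : 0 < b)
    (α β : ι → ℂ) :
    Integrable fun d : ι → ℂ => Complex.exp (∑ i, gaussExponent b (α i) (β i) (d i)) := by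
  simp_rw [Complex.exp_sum]
  exact Integrable.fintype_prod fun i => integrable_cexp_gaussExponent hb (α i) (β i)

lemma integral_cexp_sum_gaussExponent {ι : Type*} [Fintype ι] {b : ℝ} (hb : 0 < b)
    (α β : ι → ℂ) :
    ∫ d : ι → ℂ, Complex.exp (∑ i, gaussExponent b (α i) (β i) (d i)) =
      (Real.pi / b) ^ Fintype.card ι * Complex.exp (∑ i, α i * β i / b) := by
  simp_rw [Complex.exp_sum]
  rw [integral_fintype_prod_volume_eq_prod
    (fun i z => Complex.exp (gaussExponent b (α i) (β i) z))]
  simp_rw [integral_cexp_gaussExponent hb, Finset.prod_mul_distrib]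
  rw [Finset.prod_const, Finset.card_univ]

lemma integrable_exp_neg_mul_sum_sq {ι : Type*} [Fintype ι] {b : ℝ} (hb : 0 < b) :
    Integrable fun d : ι → ℂ => Real.exp (-b * ∑ i, ‖d i‖ ^ 2) := by
  refine (integrable_cexp_sum_gaussExponent hb (fun _ : ι => 0) (fun _ => 0)).norm.congr
    (ae_of_all _ fun d => ?_)
  simp only [gaussExponent, Complex.norm_exp]
  congr 1
  simp only [zero_mul, add_zero, ← Finset.mul_sum]
  have h1 : (-(b : ℂ) * ∑ i, (‖d i‖ : ℂ) ^ 2) = ((-b * ∑ i, ‖d i‖ ^ 2 : ℝ) : ℂ) := by push_cast; ring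
  rw [h1, Complex.ofReal_re]

/-! ### The measures -/

variable {N : ℕ}

instance instSecondCountableMat : SecondCountableTopology (Mat N) :=
  inferInstanceAs (SecondCountableTopology (Fin N → Fin N → ℂ))

instance instSecondCountableUN : SecondCountableTopology (UN N) :=
  
  TopologicalSpace.Subtype.secondCountableTopology (Matrix.unitaryGroup (Fin N) ℂ : Set (Mat N))

instance instIsProbabilityMeasureHaarUN : IsProbabilityMeasure (haarUN N) :=
  ⟨by
    have := Measure.haarMeasure_self (G := UN N) (K₀ := ⊤)
    simpa [haarUN] using this⟩

/-- The measure `dU dd` on `U(N) × ℂ^N`. -/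
noncomputable def paramMeasure (N : ℕ) : Measure (UN N × (Fin N → ℂ)) := (haarUN N).prod volume

/-- The image of `dU dd` on the normal matrices. -/
noncomputable def flatMeasure (N : ℕ) : Measure (Mat N) :=
  (paramMeasure N).map fun p => spectralPoint p.1 p.2

instance instSFiniteParam : SFinite (paramMeasure N) := by unfold paramMeasure; infer_instance

instance instSFiniteFlat : SFinite (flatMeasure N) := by unfold flatMeasure; infer_instance

lemma measurable_spectralPoint :
    Measurable fun p : UN N × (Fin N → ℂ) => spectralPoint p.1 p.2 :=
  continuous_spectralPoint.measurable

/-- The Gaussian weight `(π h)^{-N} e^{-|Y|²/h}`. -/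
noncomputable def weight (h : ℝ) (Y : Mat N) : ℝ :=
  ((Real.pi * h) ^ N)⁻¹ * Real.exp (-nsq Y / h)

lemma continuous_weight (h : ℝ) : Continuous (weight h : Mat N → ℝ) :=
  continuous_const.mul (Real.continuous_exp.comp ((continuous_nsq.neg).div_const h))

lemma weight_pos {h : ℝ} (hh : 0 < h) (Y : Mat N) : 0 < weight h Y := by
  have := Real.pi_pos
  unfold weight
  positivity

/-- All the measures `μ_h` are densities against one measure independent of `h`. This makes
integrability at `h₀` usable at every smaller `h`. -/
lemma normalMeasure_eq (h : ℝ) :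
    normalMeasure N h = (flatMeasure N).withDensity fun Y => ENNReal.ofReal (weight h Y) := by
  have hw : Measurable fun Y : Mat N => ENNReal.ofReal (weight h Y) :=
    (continuous_weight h).measurable.ennreal_ofReal
  have hg : Measurable fun d : Fin N → ℂ =>
      ENNReal.ofReal (((Real.pi * h) ^ N)⁻¹ * Real.exp (-(∑ i, ‖d i‖ ^ 2) / h)) := by
    fun_prop
  have hsf : SFinite (volume.withDensity fun d : Fin N → ℂ =>
      ENNReal.ofReal (((Real.pi * h) ^ N)⁻¹ * Real.exp (-(∑ i, ‖d i‖ ^ 2) / h))) := by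
    infer_instance
  ext s hs
  rw [normalMeasure, gaussian, prod_withDensity_right hg,
    Measure.map_apply measurable_spectralPoint hs, withDensity_apply _ hs,
    withDensity_apply _ (measurable_spectralPoint hs), flatMeasure,
    setLIntegral_map hs hw measurable_spectralPoint]
  simp only [weight, nsq_spectralPoint, paramMeasure]

lemma integrable_normalMeasure_iff {E : Type*} [NormedAddCommGroup E] [NormedSpace ℝ E] {h : ℝ}
    (hh : 0 < h) (f : Mat N → E) :
    Integrable f (normalMeasure N h) ↔ Integrable (fun Y => weight h Y • f Y) (flatMeasure N) := by
  rw [normalMeasure_eq, integrable_withDensity_iff_integrable_smul'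
    (continuous_weight h).measurable.ennreal_ofReal (ae_of_all _ fun _ => ENNReal.ofReal_lt_top)]
  simp only [ENNReal.toReal_ofReal (weight_pos hh _).le]

lemma integral_normalMeasure {E : Type*} [NormedAddCommGroup E] [NormedSpace ℝ E] {h : ℝ}
    (hh : 0 < h) (f : Mat N → E) :
    ∫ Y, f Y ∂(normalMeasure N h) = ∫ Y, weight h Y • f Y ∂(flatMeasure N) := by
  rw [normalMeasure_eq, integral_withDensity_eq_integral_toReal_smul
    (continuous_weight h).measurable.ennreal_ofReal (ae_of_all _ fun _ => ENNReal.ofReal_lt_top)]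
  simp only [ENNReal.toReal_ofReal (weight_pos hh _).le]

lemma normalMeasure_absolutelyContinuous (h : ℝ) : normalMeasure N h ≪ flatMeasure N := by
  rw [normalMeasure_eq]
  exact withDensity_absolutelyContinuous _ _

instance instSFiniteNormal (h : ℝ) : SFinite (normalMeasure N h) := by
  rw [normalMeasure_eq]; infer_instance

lemma ae_mem_normalMatrices (h : ℝ) : ∀ᵐ Y ∂(normalMeasure N h), Y ∈ normalMatrices N := by
  have hcl : MeasurableSet (normalMatrices N) := by
    refine IsClosed.measurableSet ?_
    have h1 : Continuous fun Z : Mat N => Zᴴ * Z :=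
      continuous_id.matrix_conjTranspose.matrix_mul continuous_id
    have h2 : Continuous fun Z : Mat N => Z * Zᴴ :=
      continuous_id.matrix_mul continuous_id.matrix_conjTranspose
    exact isClosed_eq h1 h2
  have h2 : ∀ᵐ Y ∂(flatMeasure N), Y ∈ normalMatrices N :=
    (ae_map_iff measurable_spectralPoint.aemeasurable hcl).2
      (ae_of_all _ fun p => spectralPoint_mem p.1 p.2)
  exact (normalMeasure_absolutelyContinuous h).ae_le h2

lemma integrable_exp_neg_nsq {b : ℝ} (hb : 0 < b) :
    Integrable (fun Y : Mat N => Real.exp (-b * nsq Y)) (flatMeasure N) := by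
  have hc : Continuous fun Y : Mat N => Real.exp (-b * nsq Y) :=
    Real.continuous_exp.comp (continuous_const.mul continuous_nsq)
  rw [flatMeasure, integrable_map_measure hc.aestronglyMeasurable
    measurable_spectralPoint.aemeasurable]
  simp only [Function.comp_def, nsq_spectralPoint, paramMeasure]
  exact (integrable_exp_neg_mul_sum_sq (ι := Fin N) hb).comp_snd _

end

section

variable {N : ℕ}

/-! ### Membership in the reproducing kernel space -/

lemma weight_mul_exp (h γ : ℝ) (Y : Mat N) :
    weight h Y * Real.exp (γ * nsq Y) =
      ((Real.pi * h) ^ N)⁻¹ * Real.exp (-(1 / h - γ) * nsq Y) := by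
  rw [weight, mul_assoc, ← Real.exp_add]
  congr 2
  ring

lemma integrable_exp_nsq {h γ : ℝ} (hh : 0 < h) (hγ : γ < 1 / h) :
    Integrable (fun Y : Mat N => Real.exp (γ * nsq Y)) (normalMeasure N h) := by
  rw [integrable_normalMeasure_iff hh]
  simp only [smul_eq_mul, weight_mul_exp]
  exact (integrable_exp_neg_nsq (by linarith)).const_mul _

lemma norm_pow_mulVec_le (X : Mat N) (k : ℕ) (v : Fin N → ℂ) :
    ‖X ^ k *ᵥ v‖ ≤ N * (‖v‖ * frob X ^ k) := by
  refine (norm_mulVec_le _ _).trans ?_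
  have := norm_pow_le_frob X k
  calc _ ≤ N * frob X ^ k * ‖v‖ := by gcongr
    _ = _ := by ring

lemma continuous_mulVec_left (v : Fin N → ℂ) : Continuous fun A : Mat N => A *ᵥ v :=
  continuous_id.matrix_mulVec continuous_const

lemma monomial_mem_polySpan (k : ℕ) (v : Fin N → ℂ) :
    (fun Z : Mat N => Z ^ k *ᵥ v) ∈ polySpan N := by
  have h1 : (fun Z : Mat N => Z ^ k *ᵥ v) =
      ∑ j, v j • fun Z : Mat N => Z ^ k *ᵥ Pi.single j 1 := by
    funext Z i
    simp [Matrix.mulVec, dotProduct, mul_comm]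
  rw [h1]
  exact Submodule.sum_mem _ fun j _ => Submodule.smul_mem _ _ (Submodule.subset_span ⟨(k, j), rfl⟩)

/-! ### Entire power series with vector coefficients -/

section Series

variable {v : ℕ → Fin N → ℂ} (hs : ∀ r : ℝ, 0 ≤ r → Summable fun k => ‖v k‖ * r ^ k)
include hs

lemma hasSum_pow_mulVec (X : Mat N) :
    HasSum (fun k => X ^ k *ᵥ v k) (∑' k, X ^ k *ᵥ v k) :=
  (Summable.of_norm_bounded ((hs _ (frob_nonneg X)).mul_left (N : ℝ))
    fun k => norm_pow_mulVec_le X k (v k)).hasSum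

lemma continuous_tsum_pow_mulVec : Continuous fun X : Mat N => ∑' k, X ^ k *ᵥ v k := by
  rw [continuous_iff_continuousAt]
  intro X
  have hU : {Y : Mat N | frob Y < frob X + 1} ∈ 𝓝 X :=
    (isOpen_lt continuous_frob continuous_const).mem_nhds (by simp)
  have h0 : 0 ≤ frob X + 1 := by linarith [frob_nonneg X]
  refine ContinuousOn.continuousAt (continuousOn_tsum (fun k => ?_)
    ((hs _ h0).mul_left (N : ℝ)) ?_) hU
  · exact ((continuous_mulVec_left (v k)).comp (continuous_pow k)).continuousOn
  · intro k Y hY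
    refine (norm_pow_mulVec_le Y k (v k)).trans ?_
    have := frob_nonneg Y
    have h2 : frob Y ≤ frob X + 1 := le_of_lt hY
    gcongr

lemma norm_sum_pow_mulVec_le (X : Mat N) (n : ℕ) :
    ‖∑ k ∈ Finset.range n, X ^ k *ᵥ v k‖ ≤ N * ∑' k, ‖v k‖ * frob X ^ k := by
  refine (norm_sum_le _ _).trans ?_
  refine (Finset.sum_le_sum fun k _ => norm_pow_mulVec_le X k (v k)).trans ?_
  rw [← Finset.mul_sum]
  gcongr
  exact (hs _ (frob_nonneg X)).sum_le_tsum _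
    fun k _ => mul_nonneg (norm_nonneg _) (pow_nonneg (frob_nonneg X) k)

lemma norm_tsum_pow_mulVec_le (X : Mat N) :
    ‖∑' k, X ^ k *ᵥ v k‖ ≤ N * ∑' k, ‖v k‖ * frob X ^ k :=
  le_of_tendsto (hasSum_pow_mulVec hs X).tendsto_sum_nat.norm
    (Eventually.of_forall fun n => norm_sum_pow_mulVec_le hs X n)

/-- The growth bound is imposed on the sum of norms, so the series and all its partial sums share
the majorant `exp(γ|X|²)`. Its square is `μ_h`-integrable because `2γ < 1/h`, and dominated
convergence shows that the partial sums approximate in `L²`. -/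
lemma memH_of_series {h C γ : ℝ} (hh : 0 < h) (hγ : 2 * γ < 1 / h)
    (hb : ∀ r : ℝ, 0 ≤ r → ∑' k, ‖v k‖ * r ^ k ≤ C * Real.exp (γ * r ^ 2)) :
    MemH h fun X : Mat N => ∑' k, X ^ k *ᵥ v k := by
  set f : Mat N → Fin N → ℂ := fun X => ∑' k, X ^ k *ᵥ v k with hf
  have hfc : Continuous f := continuous_tsum_pow_mulVec hs
  have hbX : ∀ X : Mat N, N * ∑' k, ‖v k‖ * frob X ^ k ≤ N * C * Real.exp (γ * nsq X) := by
    intro X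
    rw [mul_assoc, ← frob_sq]
    exact mul_le_mul_of_nonneg_left (hb _ (frob_nonneg X)) (Nat.cast_nonneg N)
  have hfb : ∀ X, ‖f X‖ ≤ N * C * Real.exp (γ * nsq X) :=
    fun X => (norm_tsum_pow_mulVec_le hs X).trans (hbX X)
  have hsq : ∀ X : Mat N, (N * C * Real.exp (γ * nsq X)) ^ 2 =
      (N * C) ^ 2 * Real.exp (2 * γ * nsq X) := by
    intro X
    rw [mul_pow, ← Real.exp_nat_mul]
    congr 2
    push_cast
    ring
  have hint : Integrable (fun X : Mat N => (N * C) ^ 2 * Real.exp (2 * γ * nsq X))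
      (normalMeasure N h) := (integrable_exp_nsq hh hγ).const_mul _
  refine ⟨hfc.continuousOn, ?_, ?_⟩
  · rw [memLp_two_iff_integrable_sq_norm hfc.aestronglyMeasurable]
    refine hint.mono' (hfc.norm.pow 2).aestronglyMeasurable (ae_of_all _ fun X => ?_)
    rw [← hsq, Real.norm_of_nonneg (by positivity)]
    gcongr
    exact hfb X
  · intro ε hε
    set p : ℕ → Mat N → Fin N → ℂ := fun n X => ∑ k ∈ Finset.range n, X ^ k *ᵥ v k with hp
    have hpc : ∀ n, Continuous (p n) := fun n => continuous_finsetSum _ fun k _ =>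
      (continuous_mulVec_left (v k)).comp (continuous_pow k)
    have hpb : ∀ n X, ‖p n X‖ ≤ N * C * Real.exp (γ * nsq X) :=
      fun n X => (norm_sum_pow_mulVec_le hs X n).trans (hbX X)
    have hpm : ∀ n, p n ∈ polySpan N := by
      intro n
      have : p n = ∑ k ∈ Finset.range n, fun X : Mat N => X ^ k *ᵥ v k := by
        funext X
        simp [hp]
      rw [this]
      exact Submodule.sum_mem _ fun k _ => monomial_mem_polySpan k (v k)
    have hlim : Tendsto (fun n => ∫⁻ Y, (∑ i, ‖f Y i - p n Y i‖ₑ ^ 2) ∂(normalMeasure N h))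
        atTop (𝓝 (∫⁻ _Y : Mat N, 0 ∂(normalMeasure N h))) := by
      refine tendsto_lintegral_of_dominated_convergence
        (fun X => ∑ _i : Fin N, 4 * ENNReal.ofReal ((N * C) ^ 2 * Real.exp (2 * γ * nsq X)))
        (fun n => ?_) (fun n => ae_of_all _ fun X => ?_) ?_ (ae_of_all _ fun X => ?_)
      · refine Finset.measurable_sum _ fun i _ => ?_
        exact ((((continuous_apply i).comp hfc).sub
          ((continuous_apply i).comp (hpc n))).measurable.enorm).pow_const 2
      · refine Finset.sum_le_sum fun i _ => ?_
        have h1 : ‖f X i - p n X i‖ ≤ 2 * (N * C * Real.exp (γ * nsq X)) := by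
          have h2 := (norm_le_pi_norm (f X) i).trans (hfb X)
          have h3 := (norm_le_pi_norm (p n X) i).trans (hpb n X)
          linarith [norm_sub_le (f X i) (p n X i)]
        have h4 : ‖f X i - p n X i‖ ^ 2 ≤ 4 * ((N * C) ^ 2 * Real.exp (2 * γ * nsq X)) := by
          rw [← hsq]
          calc _ ≤ (2 * (N * C * Real.exp (γ * nsq X))) ^ 2 := by gcongr
            _ = _ := by ring
        rw [← ofReal_norm, ← ENNReal.ofReal_pow (norm_nonneg _)]
        refine (ENNReal.ofReal_le_ofReal h4).trans_eq ?_
        rw [ENNReal.ofReal_mul (by norm_num)]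
        norm_num
      · rw [lintegral_finsetSum' _ fun i _ => by
          exact ((hint.aestronglyMeasurable.aemeasurable).ennreal_ofReal).const_mul _]
        refine (ENNReal.sum_lt_top.2 fun i _ => ?_).ne
        rw [lintegral_const_mul' _ _ (by norm_num)]
        exact ENNReal.mul_lt_top (by norm_num) (hint.lintegral_lt_top)
      · have h1 : Tendsto (fun n => p n X) atTop (𝓝 (f X)) :=
          (hasSum_pow_mulVec hs X).tendsto_sum_nat
        have h2 : (0 : ENNReal) = ∑ _i : Fin N, 0 := by simp
        rw [h2]
        refine tendsto_finsetSum _ fun i _ => ?_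
        have h3 : Tendsto (fun n => f X i - p n X i) atTop (𝓝 0) := by
          have := (tendsto_const_nhds (x := f X i)).sub
            (((continuous_apply i).tendsto (f X)).comp h1)
          rwa [sub_self] at this
        have h4 := ENNReal.Tendsto.pow (n := 2) h3.enorm
        simpa using h4
    rw [lintegral_zero] at hlim
    obtain ⟨n, hn⟩ := (hlim.eventually_lt_const (ENNReal.ofReal_pos.2 hε)).exists
    exact ⟨p n, hpm n, hn.le⟩

end Series

/-! ### The kernel functions -/

lemma kernelFun_eq_tsum {h : ℝ} (hh : 0 < h) (X : Mat N) (χ : Fin N → ℂ) :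
    kernelFun h X χ = fun Y => ∑' k : ℕ,
      Y ^ k *ᵥ (((k.factorial : ℂ) * (h : ℂ) ^ k)⁻¹ • (Xᴴ ^ k *ᵥ χ)) := by
  funext Y
  have h1 := (hasSum_kernel hh Y X).map (Matrix.mulVec.addMonoidHomLeft χ)
    (continuous_mulVec_left χ)
  rw [kernelFun]
  refine h1.tsum_eq.symm.trans (tsum_congr fun k => ?_)
  simp [Matrix.mulVec.addMonoidHomLeft, Matrix.smul_mulVec, Matrix.mulVec_smul]

/-- Completing the square. The parameter `δ` trades the growth `exp(|X||Y|/h)` of the kernel for an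
arbitrarily small share `δ|Y|²/h` of the Gaussian weight, at the price of a larger factor in `X`. -/
lemma mul_div_le_add_sq {h δ : ℝ} (hh : 0 < h) (hδ : 0 < δ) (x y : ℝ) :
    x * y / h ≤ 1 / (4 * δ * h) * x ^ 2 + δ / h * y ^ 2 := by
  have h1 : 1 / (4 * δ * h) * x ^ 2 + δ / h * y ^ 2 - x * y / h =
      (x - 2 * δ * y) ^ 2 / (4 * δ * h) := by
    field_simp
    ring
  have h2 : 0 ≤ (x - 2 * δ * y) ^ 2 / (4 * δ * h) := by positivity
  linarith

lemma norm_factorial_inv {h : ℝ} (hh : 0 < h) (k : ℕ) :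
    ‖((k.factorial : ℂ) * (h : ℂ) ^ k)⁻¹‖ = ((k.factorial : ℝ) * h ^ k)⁻¹ := by
  simp [abs_of_pos hh]

lemma hasSum_exp_div (x : ℝ) : HasSum (fun k : ℕ => x ^ k / k.factorial) (Real.exp x) := by
  rw [Real.exp_eq_exp_ℝ]
  exact NormedSpace.expSeries_div_hasSum_exp x

lemma memH_kernelFun {h : ℝ} (hh : 0 < h) (X : Mat N) (χ : Fin N → ℂ) :
    MemH h (kernelFun h X χ) := by
  have hb : ∀ (r : ℝ), 0 ≤ r → ∀ k : ℕ,
      ‖((k.factorial : ℂ) * (h : ℂ) ^ k)⁻¹ • (Xᴴ ^ k *ᵥ χ)‖ * r ^ k ≤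
        (N * ‖χ‖) * ((frob X * r / h) ^ k / k.factorial) := by
    intro r hr k
    rw [norm_smul, norm_factorial_inv hh]
    have h1 := norm_pow_mulVec_le Xᴴ k χ
    rw [frob_conjTranspose] at h1
    calc _ ≤ ((k.factorial : ℝ) * h ^ k)⁻¹ * (N * (‖χ‖ * frob X ^ k)) * r ^ k := by gcongr
      _ = _ := by
        rw [div_pow, mul_pow]
        field_simp
  have hsum : ∀ r : ℝ, HasSum (fun k : ℕ => (N * ‖χ‖) * ((frob X * r / h) ^ k / k.factorial))
      ((N * ‖χ‖) * Real.exp (frob X * r / h)) := fun r => (hasSum_exp_div _).mul_left _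
  have hs : ∀ r : ℝ, 0 ≤ r → Summable fun k : ℕ =>
      ‖((k.factorial : ℂ) * (h : ℂ) ^ k)⁻¹ • (Xᴴ ^ k *ᵥ χ)‖ * r ^ k := fun r hr =>
    Summable.of_nonneg_of_le (fun k => by positivity) (hb r hr) (hsum r).summable
  rw [kernelFun_eq_tsum hh]
  -- Taking `δ = 1/4` gives `2γ = 1/(2h)`, half of the admissible rate.
  refine memH_of_series hs hh (γ := 1 / 4 / h)
    (C := N * ‖χ‖ * Real.exp (1 / (4 * (1 / 4) * h) * frob X ^ 2)) ?_ ?_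
  · have : 0 < 1 / h := by positivity
    calc 2 * (1 / 4 / h) = (1 / h) / 2 := by ring
      _ < 1 / h := by linarith
  · intro r hr
    refine ((hs r hr).tsum_le_tsum (hb r hr) (hsum r).summable).trans ?_
    rw [(hsum r).tsum_eq, mul_assoc (N * ‖χ‖), ← Real.exp_add]
    gcongr
    exact mul_div_le_add_sq hh (by norm_num) _ _

/-! ### The integral operator with kernel `K_h` -/

/-- The integral operator `F ↦ ∫ K_h(·, Y) F(Y) dμ_h(Y)`. -/
noncomputable def proj (h : ℝ) (F : Mat N → Fin N → ℂ) (X : Mat N) : Fin N → ℂ :=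
  ∫ Y, kernel h X Y *ᵥ F Y ∂(normalMeasure N h)

/-- The Taylor coefficients of `proj h F`. -/
noncomputable def projCoeff (h : ℝ) (F : Mat N → Fin N → ℂ) (k : ℕ) : Fin N → ℂ :=
  ((k.factorial : ℂ) * (h : ℂ) ^ k)⁻¹ • ∫ Y, Yᴴ ^ k *ᵥ F Y ∂(normalMeasure N h)

lemma mulVec_integral (A : Mat N) {μ : Measure (Mat N)} {F : Mat N → Fin N → ℂ}
    (hF : Integrable F μ) : A *ᵥ ∫ Y, F Y ∂μ = ∫ Y, A *ᵥ F Y ∂μ :=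
  ((Matrix.mulVecLin A).toContinuousLinearMap.integral_comp_comm hF).symm

section Proj

variable {h a : ℝ} (hh : 0 < h) {F : Mat N → Fin N → ℂ}

include hh in
lemma integrable_exp_nsq_mul_norm
    (hF : Integrable (fun Y => Real.exp (-((1 - a) / h) * nsq Y) * ‖F Y‖) (flatMeasure N)) :
    Integrable (fun Y => Real.exp (a / h * nsq Y) * ‖F Y‖) (normalMeasure N h) := by
  rw [integrable_normalMeasure_iff hh]
  refine (hF.const_mul (((Real.pi * h) ^ N)⁻¹)).congr (ae_of_all _ fun Y => ?_)
  simp only [smul_eq_mul, ← mul_assoc, weight_mul_exp]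
  congr 4
  ring

variable (ha : 0 < a) (hc : Continuous F)
  (hF : Integrable (fun Y => Real.exp (a / h * nsq Y) * ‖F Y‖) (normalMeasure N h))

include hh ha in
lemma exp_mul_div_le (r : ℝ) (Y : Mat N) : Real.exp (r * frob Y / h) ≤
    Real.exp (1 / (4 * a * h) * r ^ 2) * Real.exp (a / h * nsq Y) := by
  rw [← Real.exp_add, ← frob_sq]
  exact Real.exp_le_exp.2 (mul_div_le_add_sq hh ha _ _)

include hh ha hc hF

lemma integrable_exp_frob_mul_norm (r : ℝ) :
    Integrable (fun Y => Real.exp (r * frob Y / h) * ‖F Y‖) (normalMeasure N h) := by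
  refine (hF.const_mul (Real.exp (1 / (4 * a * h) * r ^ 2))).mono'
    (Continuous.aestronglyMeasurable ?_) (ae_of_all _ fun Y => ?_)
  · exact (Real.continuous_exp.comp ((continuous_const.mul continuous_frob).div_const h)).mul
      hc.norm
  · rw [Real.norm_of_nonneg (by positivity), ← mul_assoc]
    gcongr
    exact exp_mul_div_le hh ha r Y

lemma integral_exp_frob_mul_norm_le (r : ℝ) :
    ∫ Y, Real.exp (r * frob Y / h) * ‖F Y‖ ∂(normalMeasure N h) ≤
      (∫ Y, Real.exp (a / h * nsq Y) * ‖F Y‖ ∂(normalMeasure N h)) *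
        Real.exp (1 / (4 * a * h) * r ^ 2) := by
  rw [mul_comm, ← integral_const_mul]
  refine integral_mono (integrable_exp_frob_mul_norm hh ha hc hF r) (hF.const_mul _) fun Y => ?_
  simp only
  rw [← mul_assoc]
  gcongr
  exact exp_mul_div_le hh ha r Y

lemma integrable_kernel_mulVec (X : Mat N) :
    Integrable (fun Y => kernel h X Y *ᵥ F Y) (normalMeasure N h) := by
  refine ((integrable_exp_frob_mul_norm hh ha hc hF (frob X)).const_mul ((N : ℝ) * N)).mono'
    (Continuous.aestronglyMeasurable ?_) (ae_of_all _ fun Y => ?_)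
  · exact ((continuous_kernel hh).comp (continuous_const.prodMk continuous_id)).matrix_mulVec hc
  · refine (norm_mulVec_le _ _).trans ?_
    have := norm_kernel_le hh X Y
    calc _ ≤ N * (N * Real.exp (frob X * frob Y / h)) * ‖F Y‖ := by gcongr
      _ = _ := by ring

lemma integrable_pow_mulVec (k : ℕ) :
    Integrable (fun Y : Mat N => Yᴴ ^ k *ᵥ F Y) (normalMeasure N h) := by
  refine ((integrable_exp_frob_mul_norm hh ha hc hF h).const_mul
    ((N : ℝ) * k.factorial)).mono' (Continuous.aestronglyMeasurable ?_) (ae_of_all _ fun Y => ?_)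
  · have h1 : Continuous fun Y : Mat N => Yᴴ ^ k := continuous_id.matrix_conjTranspose.pow k
    exact h1.matrix_mulVec hc
  · refine (norm_pow_mulVec_le _ _ _).trans ?_
    rw [frob_conjTranspose]
    have h1 : frob Y ^ k / k.factorial ≤ Real.exp (h * frob Y / h) := by
      rw [mul_div_cancel_left₀ _ hh.ne']
      exact Real.pow_div_factorial_le_exp _ (frob_nonneg Y) k
    rw [div_le_iff₀ (by positivity)] at h1
    calc _ ≤ N * (‖F Y‖ * (Real.exp (h * frob Y / h) * k.factorial)) := by gcongr
      _ = _ := by ring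

/-- The partial sum is moved under the integral and dominated there by `exp(r|Y|/h)`; completing the
square with `δ = a` then produces the rate `1/(4ah)`. -/
lemma sum_projCoeff_le {r : ℝ} (hr : 0 ≤ r) (n : ℕ) :
    ∑ k ∈ Finset.range n, ‖projCoeff h F k‖ * r ^ k ≤
      (N * ∫ Y, Real.exp (a / h * nsq Y) * ‖F Y‖ ∂(normalMeasure N h)) *
        Real.exp (1 / (4 * a * h) * r ^ 2) := by
  have h1 : ∀ k, ‖projCoeff h F k‖ * r ^ k ≤
      ∫ Y, ((k.factorial : ℝ) * h ^ k)⁻¹ * r ^ k * ‖Yᴴ ^ k *ᵥ F Y‖ ∂(normalMeasure N h) := by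
    intro k
    rw [projCoeff, norm_smul, norm_factorial_inv hh, integral_const_mul, mul_right_comm]
    gcongr
    exact norm_integral_le_integral_norm _
  refine (Finset.sum_le_sum fun k _ => h1 k).trans ?_
  rw [← integral_finsetSum _ fun k _ =>
    (integrable_pow_mulVec hh ha hc hF k).norm.const_mul _]
  rw [mul_assoc]
  refine le_trans ?_ (mul_le_mul_of_nonneg_left (integral_exp_frob_mul_norm_le hh ha hc hF r)
    (Nat.cast_nonneg N))
  rw [← integral_const_mul]
  refine integral_mono (integrable_finsetSum _ fun k _ =>
    (integrable_pow_mulVec hh ha hc hF k).norm.const_mul _)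
    ((integrable_exp_frob_mul_norm hh ha hc hF r).const_mul _) fun Y => ?_
  simp only
  have h2 : ∀ k : ℕ, ((k.factorial : ℝ) * h ^ k)⁻¹ * r ^ k * ‖Yᴴ ^ k *ᵥ F Y‖ ≤
      (r * frob Y / h) ^ k / k.factorial * (N * ‖F Y‖) := by
    intro k
    have h3 := norm_pow_mulVec_le Yᴴ k (F Y)
    rw [frob_conjTranspose] at h3
    calc _ ≤ ((k.factorial : ℝ) * h ^ k)⁻¹ * r ^ k * (N * (‖F Y‖ * frob Y ^ k)) := by gcongr
      _ = _ := by
        rw [div_pow, mul_pow]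
        field_simp
  refine (Finset.sum_le_sum fun k _ => h2 k).trans ?_
  rw [← Finset.sum_mul]
  have hy := frob_nonneg Y
  calc _ ≤ Real.exp (r * frob Y / h) * (N * ‖F Y‖) := by
        gcongr
        exact sum_le_hasSum _ (fun k _ => by positivity) (hasSum_exp_div _)
    _ = _ := by ring

lemma summable_projCoeff {r : ℝ} (hr : 0 ≤ r) : Summable fun k => ‖projCoeff h F k‖ * r ^ k :=
  summable_of_sum_range_le (fun k => by positivity) (sum_projCoeff_le hh ha hc hF hr)

lemma tsum_projCoeff_le {r : ℝ} (hr : 0 ≤ r) : ∑' k, ‖projCoeff h F k‖ * r ^ k ≤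
    (N * ∫ Y, Real.exp (a / h * nsq Y) * ‖F Y‖ ∂(normalMeasure N h)) *
      Real.exp (1 / (4 * a * h) * r ^ 2) :=
  Real.tsum_le_of_sum_range_le (fun k => by positivity) (sum_projCoeff_le hh ha hc hF hr)

/-- Termwise integration of the kernel series. It exhibits the image of the integral operator as a
limit of elements of `polySpan`, the form that `memH_of_series` needs. -/
lemma proj_eq_tsum : proj h F = fun X => ∑' k, X ^ k *ᵥ projCoeff h F k := by
  funext X
  have h1 : HasSum (fun k : ℕ => ∫ Y, (((k.factorial : ℂ) * (h : ℂ) ^ k)⁻¹ •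
      (X ^ k * Yᴴ ^ k)) *ᵥ F Y ∂(normalMeasure N h)) (proj h F X) := by
    have hbs : ∀ Y : Mat N, HasSum (fun k : ℕ => (N * (N * ((frob X * frob Y / h) ^ k /
        k.factorial)) * ‖F Y‖)) (N * (N * Real.exp (frob X * frob Y / h)) * ‖F Y‖) := fun Y =>
      (((hasSum_exp_div _).mul_left _).mul_left _).mul_right _
    refine hasSum_integral_of_dominated_convergence
      (fun k Y => N * (N * ((frob X * frob Y / h) ^ k / k.factorial)) * ‖F Y‖)
      (fun k => Continuous.aestronglyMeasurable ?_) (fun k => ae_of_all _ fun Y => ?_)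
      (ae_of_all _ fun Y => (hbs Y).summable) ?_ (ae_of_all _ fun Y => ?_)
    · have h2 : Continuous fun Y : Mat N => X ^ k * Yᴴ ^ k :=
        continuous_const.matrix_mul (continuous_id.matrix_conjTranspose.pow k)
      exact (h2.const_smul (((k.factorial : ℂ) * (h : ℂ) ^ k)⁻¹)).matrix_mulVec hc
    · refine (norm_mulVec_le _ _).trans ?_
      have := norm_kernel_term_le hh X Y k
      gcongr
    · simp only [(hbs _).tsum_eq]
      refine ((integrable_exp_frob_mul_norm hh ha hc hF (frob X)).const_mul
        ((N : ℝ) * N)).congr (ae_of_all _ fun Y => ?_)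
      simp only
      ring
    · exact (hasSum_kernel hh X Y).map (Matrix.mulVec.addMonoidHomLeft (F Y))
        (continuous_mulVec_left (F Y))
  refine h1.tsum_eq.symm.trans (tsum_congr fun k => ?_)
  rw [projCoeff, Matrix.mulVec_smul, mulVec_integral _ (integrable_pow_mulVec hh ha hc hF k),
    ← integral_smul]
  refine integral_congr_ae (ae_of_all _ fun Y => ?_)
  simp only [Matrix.smul_mulVec, Matrix.mulVec_mulVec]

lemma continuous_proj : Continuous (proj h F) := by
  rw [proj_eq_tsum hh ha hc hF]
  exact continuous_tsum_pow_mulVec fun r hr => summable_projCoeff hh ha hc hF hr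

lemma exists_norm_proj_le :
    ∃ C, 0 ≤ C ∧ ∀ X, ‖proj h F X‖ ≤ C * Real.exp (1 / (4 * a * h) * nsq X) := by
  refine ⟨N * (N * ∫ Y, Real.exp (a / h * nsq Y) * ‖F Y‖ ∂(normalMeasure N h)), ?_, fun X => ?_⟩
  · have : 0 ≤ ∫ Y, Real.exp (a / h * nsq Y) * ‖F Y‖ ∂(normalMeasure N h) :=
      integral_nonneg fun Y => by positivity
    positivity
  · rw [proj_eq_tsum hh ha hc hF]
    refine (norm_tsum_pow_mulVec_le (fun r hr => summable_projCoeff hh ha hc hF hr) X).trans ?_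
    rw [mul_assoc, ← frob_sq]
    exact mul_le_mul_of_nonneg_left (tsum_projCoeff_le hh ha hc hF (frob_nonneg X))
      (Nat.cast_nonneg N)

/-- The growth rate `1/(4ah)` doubles to `1/(2ah)` on squaring, and this stays below `1/h` exactly
when `a > 1/2`. -/
lemma memH_proj (ha' : 1 / 2 < a) : MemH h (proj h F) := by
  rw [proj_eq_tsum hh ha hc hF]
  refine memH_of_series (fun r hr => summable_projCoeff hh ha hc hF hr) hh ?_
    (fun r hr => tsum_projCoeff_le hh ha hc hF hr)
  rw [← mul_div_assoc, div_lt_div_iff₀ (by positivity) hh]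
  nlinarith

end Proj

end

section

variable {N : ℕ}

/-! ### The reproducing property -/

/-- The two kernels share the middle point, so the inner `U* U` cancels and a single eigenvalue
`d_m` occurs in both exponents. -/
lemma kernel_mul_kernel_entry {h : ℝ} (hh : 0 < h) (c : Fin N → ℂ) (U W : UN N)
    (d e : Fin N → ℂ) (a j : Fin N) :
    (kernel h (Matrix.diagonal c) (spectralPoint U d) *
      kernel h (spectralPoint U d) (spectralPoint W e)) a j =
      ∑ m, ∑ p, ∑ q, U.1 a m * conj (U.1 p m) * (W.1 p q * conj (W.1 j q)) *
        Complex.exp (c a * conj (d m) / h + d m * conj (e q) / h) := by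
  set A : Mat N := Matrix.of fun i m => U.1 i m * Complex.exp (c i * conj (d m) / h) with hA
  set B : Mat N := Matrix.of fun m j => ∑ p, ∑ q, conj (U.1 p m) * W.1 p q * conj (W.1 j q) *
    Complex.exp (d m * conj (e q) / h) with hB
  have h1 : kernel h (Matrix.diagonal c) (spectralPoint U d) = A * (U : Mat N)ᴴ := by
    ext i j
    rw [kernel_diagonal_left hh, Matrix.mul_apply]
    refine Finset.sum_congr rfl fun m _ => ?_
    simp only [hA, Matrix.of_apply, Matrix.conjTranspose_apply, RCLike.star_def]
    ring
  have h2 : kernel h (spectralPoint U d) (spectralPoint W e) = (U : Mat N) * B := by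
    ext i j
    rw [kernel_spectralPoint hh, Matrix.mul_apply]
    refine Finset.sum_congr rfl fun m _ => ?_
    simp only [hB, Matrix.of_apply, Finset.mul_sum]
    refine Finset.sum_congr rfl fun p _ => Finset.sum_congr rfl fun q _ => ?_
    ring
  rw [h1, h2, Matrix.mul_assoc, ← Matrix.mul_assoc _ (U : Mat N), unitary_conjTranspose_mul,
    Matrix.one_mul, Matrix.mul_apply]
  refine Finset.sum_congr rfl fun m _ => ?_
  simp only [hA, hB, Matrix.of_apply, Finset.mul_sum, Complex.exp_add]
  refine Finset.sum_congr rfl fun p _ => Finset.sum_congr rfl fun q _ => ?_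
  ring

lemma continuous_UN_entry (i j : Fin N) : Continuous fun U : UN N => U.1 i j :=
  (continuous_entry i j).comp continuous_subtype_val

lemma integrable_of_continuous_compact {α : Type*} [TopologicalSpace α] [CompactSpace α]
    [MeasurableSpace α] [OpensMeasurableSpace α] {μ : Measure α} [IsFiniteMeasure μ]
    {f : α → ℂ} (hf : Continuous f) : Integrable f μ := by
  have h := (hf.norm.bddAbove_range_of_hasCompactSupport
    (HasCompactSupport.of_compactSpace _))
  obtain ⟨C, hC⟩ := h
  exact Integrable.of_bound (hf.stronglyMeasurable_of_hasCompactSupport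
    (HasCompactSupport.of_compactSpace _)).aestronglyMeasurable C
    (ae_of_all _ fun x => hC ⟨x, rfl⟩)

/-- The one-variable Gaussian identity behind the reproducing property. -/
lemma integral_weight_exp {h : ℝ} (hh : 0 < h) (m : Fin N) (x y : ℂ) :
    Integrable (fun d : Fin N → ℂ =>
      ((((Real.pi * h) ^ N)⁻¹ * Real.exp (-(∑ i, ‖d i‖ ^ 2) / h) : ℝ) : ℂ) *
        Complex.exp (x * conj (d m) / h + d m * y / h)) ∧
    ∫ d : Fin N → ℂ, ((((Real.pi * h) ^ N)⁻¹ * Real.exp (-(∑ i, ‖d i‖ ^ 2) / h) : ℝ) : ℂ) *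
        Complex.exp (x * conj (d m) / h + d m * y / h) = Complex.exp (x * y / h) := by
  have hb : 0 < 1 / h := by positivity
  have h0 : (h : ℂ) ≠ 0 := by exact_mod_cast hh.ne'
  have hpi : (Real.pi : ℂ) ≠ 0 := by exact_mod_cast Real.pi_ne_zero
  have key : ∀ d : Fin N → ℂ,
      ((((Real.pi * h) ^ N)⁻¹ * Real.exp (-(∑ i, ‖d i‖ ^ 2) / h) : ℝ) : ℂ) *
        Complex.exp (x * conj (d m) / h + d m * y / h) =
      (((Real.pi * h : ℝ) : ℂ) ^ N)⁻¹ * Complex.exp (∑ i, gaussExponent (1 / h)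
        ((Pi.single m (y / h) : Fin N → ℂ) i) ((Pi.single m (x / h) : Fin N → ℂ) i) (d i)) := by
    intro d
    simp only [gaussExponent, Finset.sum_add_distrib, Pi.single_apply, ite_mul, zero_mul,
      Finset.sum_ite_eq', Finset.mem_univ, if_true, ← Finset.mul_sum]
    push_cast
    rw [mul_assoc, ← Complex.exp_add]
    congr 2
    ring
  simp_rw [key]
  refine ⟨(integrable_cexp_sum_gaussExponent hb _ _).const_mul _, ?_⟩
  rw [integral_const_mul, integral_cexp_sum_gaussExponent hb]
  rw [Finset.sum_eq_single m (by intro i _ hi; simp [hi]) (by simp)]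
  simp only [Pi.single_eq_same, Fintype.card_fin]
  push_cast
  rw [← mul_assoc]
  have h1 : ((Real.pi * h : ℂ) ^ N)⁻¹ * (Real.pi / (1 / h) : ℂ) ^ N = 1 := by
    rw [div_div_eq_mul_div, div_one, inv_mul_cancel₀ (pow_ne_zero _ (mul_ne_zero hpi h0))]
  rw [h1, one_mul]
  congr 1
  field_simp

lemma integrable_exp_mul_norm_kernelFun {h a : ℝ} (hh : 0 < h) (ha : a < 1) (Z : Mat N)
    (v : Fin N → ℂ) : Integrable (fun Y => Real.exp (a / h * nsq Y) * ‖kernelFun h Z v Y‖)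
      (normalMeasure N h) := by
  -- Half of the room left between `a` and `1` absorbs the growth of the kernel function.
  set δ : ℝ := (1 - a) / 2 with hδ
  have hδ0 : 0 < δ := by rw [hδ]; linarith
  have hc : Continuous (kernelFun h Z v) :=
    ((continuous_kernel hh).comp (continuous_id.prodMk continuous_const)).matrix_mulVec
      continuous_const
  have h1 : (a + δ) / h < 1 / h := by
    gcongr
    rw [hδ]
    linarith
  refine ((integrable_exp_nsq hh h1).const_mul (N * N * ‖v‖ *
    Real.exp (1 / (4 * δ * h) * frob Z ^ 2))).mono' (Continuous.aestronglyMeasurable ?_)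
    (ae_of_all _ fun Y => ?_)
  · exact (Real.continuous_exp.comp (continuous_const.mul continuous_nsq)).mul hc.norm
  · rw [Real.norm_of_nonneg (by positivity)]
    have h2 : ‖kernelFun h Z v Y‖ ≤ N * (N * Real.exp (frob Z * frob Y / h)) * ‖v‖ := by
      refine (norm_mulVec_le _ _).trans ?_
      have := norm_kernel_le hh Y Z
      rw [mul_comm (frob Y)] at this
      gcongr
    have h3 := exp_mul_div_le hh hδ0 (frob Z) Y
    calc _ ≤ Real.exp (a / h * nsq Y) * (N * (N * (Real.exp (1 / (4 * δ * h) * frob Z ^ 2) *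
          Real.exp (δ / h * nsq Y))) * ‖v‖) := by
          refine mul_le_mul_of_nonneg_left (h2.trans ?_) (Real.exp_nonneg _)
          gcongr
      _ = _ := by
          rw [add_div, add_mul, Real.exp_add]
          ring

lemma continuous_kernelFun {h : ℝ} (hh : 0 < h) (Z : Mat N) (v : Fin N → ℂ) :
    Continuous (kernelFun h Z v) :=
  ((continuous_kernel hh).comp (continuous_id.prodMk continuous_const)).matrix_mulVec
    continuous_const

lemma integral_pi_apply {α : Type*} [MeasurableSpace α] {μ : Measure α} {f : α → Fin N → ℂ}
    (hf : Integrable f μ) (i : Fin N) : (∫ x, f x ∂μ) i = ∫ x, f x i ∂μ :=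
  ((ContinuousLinearMap.proj (R := ℂ) (φ := fun _ : Fin N => ℂ) i).integral_comp_comm hf).symm

lemma integral_flatMeasure {E : Type*} [NormedAddCommGroup E] [NormedSpace ℝ E] {f : Mat N → E}
    (hf : AEStronglyMeasurable f (flatMeasure N)) :
    ∫ Y, f Y ∂(flatMeasure N) = ∫ p, f (spectralPoint p.1 p.2) ∂(paramMeasure N) :=
  integral_map measurable_spectralPoint.aemeasurable hf

/-- The reproducing property on kernel functions. The Gaussian integral over `d` gives `exp(c_a ē_q
/ h)`, the same for every `m`, and then `∑_m u_am ū_rm` is a Kronecker delta. Of the Haar measure,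
only its total mass one enters beyond integrability of continuous functions. -/
lemma proj_kernelFun {h : ℝ} (hh : 0 < h) (c : Fin N → ℂ) (W : UN N) (e v : Fin N → ℂ) :
    proj h (kernelFun h (spectralPoint W e) v) (Matrix.diagonal c) =
      kernelFun h (spectralPoint W e) v (Matrix.diagonal c) := by
  have hint := integrable_kernel_mulVec hh (a := 1 / 2) (by norm_num)
    (continuous_kernelFun hh (spectralPoint W e) v)
    (integrable_exp_mul_norm_kernelFun hh (by norm_num) _ _) (Matrix.diagonal c)
  funext a
  rw [proj, integral_pi_apply hint a, integral_normalMeasure hh]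
  have hcont : Continuous fun Y : Mat N => weight h Y •
      (kernel h (Matrix.diagonal c) Y *ᵥ kernelFun h (spectralPoint W e) v Y) a := by
    refine (continuous_weight h).smul (Continuous.comp (continuous_apply a)
      (f := fun Y : Mat N => kernel h (Matrix.diagonal c) Y *ᵥ
        kernelFun h (spectralPoint W e) v Y) ?_)
    exact ((continuous_kernel hh).comp (continuous_const.prodMk continuous_id)).matrix_mulVec
      (continuous_kernelFun hh _ _)
  rw [integral_flatMeasure hcont.aestronglyMeasurable]
  have hpt : ∀ p : UN N × (Fin N → ℂ), weight h (spectralPoint p.1 p.2) •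
      (kernel h (Matrix.diagonal c) (spectralPoint p.1 p.2) *ᵥ
        kernelFun h (spectralPoint W e) v (spectralPoint p.1 p.2)) a =
      ∑ j, ∑ m, ∑ r, ∑ q, (p.1.1 a m * conj (p.1.1 r m) * (W.1 r q * conj (W.1 j q) * v j)) *
        (((((Real.pi * h) ^ N)⁻¹ * Real.exp (-(∑ i, ‖p.2 i‖ ^ 2) / h) : ℝ) : ℂ) *
        Complex.exp (c a * conj (p.2 m) / h + p.2 m * conj (e q) / h)) := by
    intro p
    rw [kernelFun, Matrix.mulVec_mulVec, Matrix.mulVec, dotProduct, weight, nsq_spectralPoint,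
      Complex.real_smul, Finset.mul_sum]
    refine Finset.sum_congr rfl fun j _ => ?_
    rw [kernel_mul_kernel_entry hh, Finset.sum_mul, Finset.mul_sum]
    refine Finset.sum_congr rfl fun m _ => ?_
    rw [Finset.sum_mul, Finset.mul_sum]
    refine Finset.sum_congr rfl fun r _ => ?_
    rw [Finset.sum_mul, Finset.mul_sum]
    refine Finset.sum_congr rfl fun q _ => ?_
    ring
  simp_rw [hpt]
  have hU : ∀ j m r q : Fin N, Integrable (fun U : UN N =>
      U.1 a m * conj (U.1 r m) * (W.1 r q * conj (W.1 j q) * v j)) (haarUN N) := by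
    intro j m r q
    refine integrable_of_continuous_compact ?_
    exact ((continuous_UN_entry a m).mul
      (Complex.continuous_conj.comp (continuous_UN_entry r m))).mul continuous_const
  have hI : ∀ j m r q : Fin N, Integrable (fun p : UN N × (Fin N → ℂ) =>
      (p.1.1 a m * conj (p.1.1 r m) * (W.1 r q * conj (W.1 j q) * v j)) *
        (((((Real.pi * h) ^ N)⁻¹ * Real.exp (-(∑ i, ‖p.2 i‖ ^ 2) / h) : ℝ) : ℂ) *
        Complex.exp (c a * conj (p.2 m) / h + p.2 m * conj (e q) / h))) (paramMeasure N) :=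
    fun j m r q => (hU j m r q).mul_prod (integral_weight_exp hh m (c a) (conj (e q))).1
  have hval : ∀ j m r q : Fin N, ∫ p : UN N × (Fin N → ℂ),
      (p.1.1 a m * conj (p.1.1 r m) * (W.1 r q * conj (W.1 j q) * v j)) *
        (((((Real.pi * h) ^ N)⁻¹ * Real.exp (-(∑ i, ‖p.2 i‖ ^ 2) / h) : ℝ) : ℂ) *
        Complex.exp (c a * conj (p.2 m) / h + p.2 m * conj (e q) / h)) ∂(paramMeasure N) =
      (∫ U : UN N, U.1 a m * conj (U.1 r m) * (W.1 r q * conj (W.1 j q) * v j) ∂(haarUN N)) *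
        Complex.exp (c a * conj (e q) / h) := by
    intro j m r q
    rw [← (integral_weight_exp hh m (c a) (conj (e q))).2]
    exact integral_prod_mul (fun U : UN N =>
      U.1 a m * conj (U.1 r m) * (W.1 r q * conj (W.1 j q) * v j)) (fun d : Fin N → ℂ =>
      ((((Real.pi * h) ^ N)⁻¹ * Real.exp (-(∑ i, ‖d i‖ ^ 2) / h) : ℝ) : ℂ) *
        Complex.exp (c a * conj (d m) / h + d m * conj (e q) / h))
  rw [integral_finsetSum _ fun j _ => integrable_finsetSum _ fun m _ =>
    integrable_finsetSum _ fun r _ => integrable_finsetSum _ fun q _ => hI j m r q]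
  rw [kernelFun, Matrix.mulVec, dotProduct]
  refine Finset.sum_congr rfl fun j _ => ?_
  rw [integral_finsetSum _ fun m _ =>
    integrable_finsetSum _ fun r _ => integrable_finsetSum _ fun q _ => hI j m r q]
  have hstep : ∀ m : Fin N, ∫ p : UN N × (Fin N → ℂ), ∑ r, ∑ q,
      (p.1.1 a m * conj (p.1.1 r m) * (W.1 r q * conj (W.1 j q) * v j)) *
        (((((Real.pi * h) ^ N)⁻¹ * Real.exp (-(∑ i, ‖p.2 i‖ ^ 2) / h) : ℝ) : ℂ) *
        Complex.exp (c a * conj (p.2 m) / h + p.2 m * conj (e q) / h)) ∂(paramMeasure N) =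
      ∑ r, ∑ q, (∫ U : UN N, U.1 a m * conj (U.1 r m) *
        (W.1 r q * conj (W.1 j q) * v j) ∂(haarUN N)) * Complex.exp (c a * conj (e q) / h) := by
    intro m
    rw [integral_finsetSum _ fun r _ => integrable_finsetSum _ fun q _ => hI j m r q]
    refine Finset.sum_congr rfl fun r _ => ?_
    rw [integral_finsetSum _ fun q _ => hI j m r q]
    exact Finset.sum_congr rfl fun q _ => hval j m r q
  simp_rw [hstep]
  rw [Finset.sum_comm]
  have hdelta : ∀ r q : Fin N, ∑ m, (∫ U : UN N, U.1 a m * conj (U.1 r m) *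
      (W.1 r q * conj (W.1 j q) * v j) ∂(haarUN N)) * Complex.exp (c a * conj (e q) / h) =
      if a = r then W.1 r q * conj (W.1 j q) * v j * Complex.exp (c a * conj (e q) / h)
      else 0 := by
    intro r q
    rw [← Finset.sum_mul, ← integral_finsetSum _ fun m _ => hU j m r q]
    have h1 : ∀ U : UN N, ∑ m, U.1 a m * conj (U.1 r m) * (W.1 r q * conj (W.1 j q) * v j) =
        (if a = r then 1 else 0) * (W.1 r q * conj (W.1 j q) * v j) := by
      intro U
      rw [← Finset.sum_mul]
      congr 1
      have := congr_fun (congr_fun (unitary_mul_conjTranspose U) a) r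
      rw [Matrix.mul_apply, Matrix.one_apply] at this
      simpa using this
    simp_rw [h1]
    rw [integral_const]
    split_ifs <;> simp
  have hswap : ∀ r : Fin N, ∑ m, ∑ q, (∫ U : UN N, U.1 a m * conj (U.1 r m) *
      (W.1 r q * conj (W.1 j q) * v j) ∂(haarUN N)) * Complex.exp (c a * conj (e q) / h) =
      if a = r then ∑ q, W.1 r q * conj (W.1 j q) * v j * Complex.exp (c a * conj (e q) / h)
      else 0 := by
    intro r
    rw [Finset.sum_comm]
    simp_rw [hdelta]
    split_ifs <;> simp
  simp_rw [hswap]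
  rw [Finset.sum_ite_eq, if_pos (Finset.mem_univ a), kernel_diagonal_left hh, Finset.sum_mul]
  refine Finset.sum_congr rfl fun q _ => ?_
  ring

/-- Fubini puts the outer integral on the product of two kernels, where `proj_kernelFun` applies.
The general case is thus reduced to kernel functions without a density argument. -/
lemma proj_proj {h a : ℝ} (hh : 0 < h) {F : Mat N → Fin N → ℂ} (ha : 1 / 2 < a)
    (hc : Continuous F)
    (hF : Integrable (fun Y => Real.exp (a / h * nsq Y) * ‖F Y‖) (normalMeasure N h))
    (c : Fin N → ℂ) :
    proj h (proj h F) (Matrix.diagonal c) = proj h F (Matrix.diagonal c) := by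
  have ha0 : 0 < a := by linarith
  set X : Mat N := Matrix.diagonal c with hX
  set μ := normalMeasure N h with hμ
  have hkc : Continuous fun p : Mat N × Mat N =>
      kernel h X p.1 *ᵥ (kernel h p.1 p.2 *ᵥ F p.2) :=
    (((continuous_kernel hh).comp (continuous_const.prodMk continuous_fst))).matrix_mulVec
      ((continuous_kernel hh).matrix_mulVec (hc.comp continuous_snd))
  -- The middle variable bears growth `1/4` from the outer kernel (`δ = 1/4`) and `1/(4a)` from the
  -- inner one; the sum is below one for `a > 1/3`.
  have hγ : (1 / 4 + 1 / (4 * a)) / h < 1 / h := by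
    gcongr
    rw [div_add_div _ _ (by norm_num) (by positivity), div_lt_one (by positivity)]
    linarith
  have hI : Integrable (fun p : Mat N × Mat N =>
      kernel h X p.1 *ᵥ (kernel h p.1 p.2 *ᵥ F p.2)) (μ.prod μ) := by
    refine (((integrable_exp_nsq hh hγ).mul_prod hF).const_mul
      (N * N * (N * N) * Real.exp (1 / (4 * (1 / 4) * h) * frob X ^ 2))).mono'
      hkc.aestronglyMeasurable (ae_of_all _ fun p => ?_)
    have h1 := norm_kernel_le hh X p.1
    have h2 := norm_kernel_le hh p.1 p.2
    have h3 := exp_mul_div_le hh (show (0 : ℝ) < 1 / 4 by norm_num) (frob X) p.1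
    have h4 := exp_mul_div_le hh ha0 (frob p.1) p.2
    rw [frob_sq] at h4
    have h5 : ‖kernel h p.1 p.2 *ᵥ F p.2‖ ≤ N * (N * Real.exp (frob p.1 * frob p.2 / h)) *
        ‖F p.2‖ := (norm_mulVec_le _ _).trans (by gcongr)
    refine (norm_mulVec_le _ _).trans ?_
    calc _ ≤ N * (N * (Real.exp (1 / (4 * (1 / 4) * h) * frob X ^ 2) *
          Real.exp (1 / 4 / h * nsq p.1))) * (N * (N * (Real.exp (1 / (4 * a * h) * nsq p.1) *
          Real.exp (a / h * nsq p.2))) * ‖F p.2‖) := by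
          refine mul_le_mul ?_ (h5.trans (by gcongr)) (norm_nonneg _) (by positivity)
          refine mul_le_mul_of_nonneg_left (h1.trans ?_) (Nat.cast_nonneg N)
          gcongr
      _ = _ := by
          have h6 : (1 / 4 + 1 / (4 * a)) / h * nsq p.1 =
              1 / 4 / h * nsq p.1 + 1 / (4 * a * h) * nsq p.1 := by
            field_simp
          rw [h6, Real.exp_add]
          ring
  have h1 : proj h (proj h F) X = ∫ Y, ∫ Z, kernel h X Y *ᵥ (kernel h Y Z *ᵥ F Z) ∂μ ∂μ := by
    refine integral_congr_ae (ae_of_all _ fun Y => ?_)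
    exact mulVec_integral _ (integrable_kernel_mulVec hh ha0 hc hF Y)
  rw [h1, integral_integral_swap hI]
  have hm1 : AEStronglyMeasurable (fun Z => ∫ Y, kernel h X Y *ᵥ (kernel h Y Z *ᵥ F Z) ∂μ)
      (flatMeasure N) := by
    have hj : StronglyMeasurable fun p : Mat N × Mat N =>
        kernel h X p.2 *ᵥ (kernel h p.2 p.1 *ᵥ F p.1) :=
      (hkc.comp continuous_swap).stronglyMeasurable
    exact hj.integral_prod_right'.aestronglyMeasurable
  have hm2 : Continuous fun Z : Mat N => kernel h X Z *ᵥ F Z :=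
    ((continuous_kernel hh).comp (continuous_const.prodMk continuous_id)).matrix_mulVec hc
  have hm3 : AEStronglyMeasurable (fun Z => weight h Z •
      ∫ Y, kernel h X Y *ᵥ (kernel h Y Z *ᵥ F Z) ∂μ) (flatMeasure N) :=
    (continuous_weight h).aestronglyMeasurable.smul hm1
  have hm4 : AEStronglyMeasurable (fun Z => weight h Z • (kernel h X Z *ᵥ F Z))
      (flatMeasure N) := ((continuous_weight h).smul hm2).aestronglyMeasurable
  -- The integrals are pulled back to the parameters because the reproducing identity is available
  -- for kernel functions based at spectral points.
  rw [integral_normalMeasure hh, proj, integral_normalMeasure hh, integral_flatMeasure hm3,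
    integral_flatMeasure hm4]
  refine integral_congr_ae (ae_of_all _ fun p => ?_)
  simp only
  congr 1
  exact proj_kernelFun hh c p.1 p.2 (F (spectralPoint p.1 p.2))

/-- Since `K_h(X, Y)* = K_h(Y, X)`, pairing with `K_{X,χ_i}` is the `i`-th component of a further
application of `proj` at `X`, which changes nothing by `proj_proj`. -/
lemma innerL2_kernelFun {h a : ℝ} (hh : 0 < h) {F : Mat N → Fin N → ℂ} (ha : 1 / 2 < a)
    (hc : Continuous F)
    (hF : Integrable (fun Y => Real.exp (a / h * nsq Y) * ‖F Y‖) (normalMeasure N h))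
    (c : Fin N → ℂ) (i : Fin N) :
    innerL2 h (proj h F) (kernelFun h (Matrix.diagonal c) (Pi.single i 1)) =
      proj h F (Matrix.diagonal c) i := by
  have ha0 : 0 < a := by linarith
  have hc' := continuous_proj hh ha0 hc hF
  obtain ⟨C, hC0, hC⟩ := exists_norm_proj_le hh ha0 hc hF
  have hF' : Integrable (fun Y => Real.exp ((1 / 4) / h * nsq Y) * ‖proj h F Y‖)
      (normalMeasure N h) := by
    have hγ : (1 / 4 + 1 / (4 * a)) / h < 1 / h := by
      gcongr
      rw [div_add_div _ _ (by norm_num) (by positivity), div_lt_one (by positivity)]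
      linarith
    refine ((integrable_exp_nsq hh hγ).const_mul C).mono' (Continuous.aestronglyMeasurable ?_)
      (ae_of_all _ fun Y => ?_)
    · exact (Real.continuous_exp.comp (continuous_const.mul continuous_nsq)).mul hc'.norm
    · rw [Real.norm_of_nonneg (by positivity)]
      calc _ ≤ Real.exp (1 / 4 / h * nsq Y) * (C * Real.exp (1 / (4 * a * h) * nsq Y)) := by
            gcongr
            exact hC Y
        _ = _ := by
            have h6 : (1 / 4 + 1 / (4 * a)) / h * nsq Y =
                1 / 4 / h * nsq Y + 1 / (4 * a * h) * nsq Y := by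
              field_simp
            rw [h6, Real.exp_add]
            ring
  rw [← proj_proj hh ha hc hF c, proj, integral_pi_apply
    (integrable_kernel_mulVec hh (by norm_num) hc' hF' _)]
  refine integral_congr_ae (ae_of_all _ fun Y => ?_)
  simp only [Matrix.mulVec, dotProduct, kernelFun, Pi.star_apply]
  refine Finset.sum_congr rfl fun j _ => ?_
  congr 1
  rw [Finset.sum_eq_single i (by intro b _ hb; simp [hb]) (by simp)]
  simp [kernel_conjTranspose hh]

end

section

set_option linter.unusedSectionVars false
/-! ### Wirtinger derivatives -/

section Wirtinger

variable {E : Type*} [NormedAddCommGroup E] [NormedSpace ℂ E] [NormedSpace ℝ E]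

lemma contDiff_fderiv_apply {F : E → ℂ} (hF : ContDiff ℝ ∞ F) (v : E) :
    ContDiff ℝ ∞ fun x => fderiv ℝ F x v :=
  (hF.fderiv_right (m := ∞) (by norm_cast)).clm_apply contDiff_const

lemma contDiff_dWirt {F : E → ℂ} (hF : ContDiff ℝ ∞ F) (v : E) : ContDiff ℝ ∞ (dWirt v F) :=
  contDiff_const.mul ((contDiff_fderiv_apply hF v).sub
    (contDiff_const.mul (contDiff_fderiv_apply hF _)))

lemma contDiff_dbarWirt {F : E → ℂ} (hF : ContDiff ℝ ∞ F) (v : E) :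
    ContDiff ℝ ∞ (dbarWirt v F) :=
  contDiff_const.mul ((contDiff_fderiv_apply hF v).add
    (contDiff_const.mul (contDiff_fderiv_apply hF _)))

lemma fderiv_apply_add_dWirt {F : E → ℂ} (x v : E) :
    fderiv ℝ F x v = dWirt v F x + dbarWirt v F x := by
  simp only [dWirt, dbarWirt]; ring

lemma fderiv_apply_I_smul {F : E → ℂ} (x v : E) :
    fderiv ℝ F x (Complex.I • v) = Complex.I * (dWirt v F x - dbarWirt v F x) := by
  simp only [dWirt, dbarWirt]
  linear_combination (fderiv ℝ F x (Complex.I • v)) * Complex.I_sq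

lemma fderiv_fderiv_apply_comm {F : E → ℂ} (hF : ContDiff ℝ ∞ F) (v w x : E) :
    fderiv ℝ (fun y => fderiv ℝ F y v) x w = fderiv ℝ (fun y => fderiv ℝ F y w) x v := by
  have h1 : Differentiable ℝ (fderiv ℝ F) :=
    (hF.fderiv_right (m := ∞) (by norm_cast)).differentiable (by simp)
  have h2 : IsSymmSndFDerivAt ℝ F x :=
    hF.contDiffAt.isSymmSndFDerivAt (by
      simpa using (WithTop.coe_le_coe.2 le_top : ((2 : ℕ∞) : WithTop ℕ∞) ≤ ∞))
  have h3 : ∀ u z, fderiv ℝ (fun y => fderiv ℝ F y u) x z = fderiv ℝ (fderiv ℝ F) x z u := by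
    intro u z
    rw [fderiv_clm_apply (h1 x) (differentiableAt_const u)]
    simp
  rw [h3, h3]
  exact h2 w v

lemma fderiv_dWirt_apply {F : E → ℂ} (hF : ContDiff ℝ ∞ F) (v w x : E) :
    fderiv ℝ (dWirt v F) x w = (1 / 2) * (fderiv ℝ (fun y => fderiv ℝ F y v) x w -
      Complex.I * fderiv ℝ (fun y => fderiv ℝ F y (Complex.I • v)) x w) := by
  have h1 := ((contDiff_fderiv_apply hF v).differentiable (by simp)).differentiableAt (x := x)
  have h2 := ((contDiff_fderiv_apply hF (Complex.I • v)).differentiable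
    (by simp)).differentiableAt (x := x)
  have h3 := ((h1.hasFDerivAt.sub (h2.hasFDerivAt.const_mul Complex.I)).const_mul
    (1 / 2 : ℂ)).fderiv
  have h4 : fderiv ℝ (dWirt v F) x = _ := h3
  rw [h4]
  simp

lemma fderiv_dbarWirt_apply {F : E → ℂ} (hF : ContDiff ℝ ∞ F) (v w x : E) :
    fderiv ℝ (dbarWirt v F) x w = (1 / 2) * (fderiv ℝ (fun y => fderiv ℝ F y v) x w +
      Complex.I * fderiv ℝ (fun y => fderiv ℝ F y (Complex.I • v)) x w) := by
  have h1 := ((contDiff_fderiv_apply hF v).differentiable (by simp)).differentiableAt (x := x)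
  have h2 := ((contDiff_fderiv_apply hF (Complex.I • v)).differentiable
    (by simp)).differentiableAt (x := x)
  have h3 := ((h1.hasFDerivAt.add (h2.hasFDerivAt.const_mul Complex.I)).const_mul
    (1 / 2 : ℂ)).fderiv
  have h4 : fderiv ℝ (dbarWirt v F) x = _ := h3
  rw [h4]
  simp
  ring

/-- Symmetry of the real second derivative, written in complex directions. -/
lemma dWirt_dbarWirt_comm {F : E → ℂ} (hF : ContDiff ℝ ∞ F) (v w : E) :
    dWirt v (dbarWirt w F) = dbarWirt w (dWirt v F) := by
  funext x
  rw [dWirt, dbarWirt, fderiv_dbarWirt_apply hF, fderiv_dbarWirt_apply hF,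
    fderiv_dWirt_apply hF, fderiv_dWirt_apply hF, fderiv_fderiv_apply_comm hF w v,
    fderiv_fderiv_apply_comm hF (Complex.I • w) v,
    fderiv_fderiv_apply_comm hF w (Complex.I • v),
    fderiv_fderiv_apply_comm hF (Complex.I • w) (Complex.I • v)]
  ring

lemma fderiv_comp_add_smul {F : E → ℂ} (hF : ContDiff ℝ ∞ F) (p : E) (t : ℝ) (y v : E) :
    fderiv ℝ (fun z => F (p + t • z)) y v = t * fderiv ℝ F (p + t • y) v := by
  have h1 : HasFDerivAt (fun z : E => p + t • z) (t • ContinuousLinearMap.id ℝ E) y :=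
    ((hasFDerivAt_id y).const_smul t).const_add p
  have h2 := (hF.differentiable (by simp) (p + t • y)).hasFDerivAt.comp y h1
  have h3 : fderiv ℝ (fun z => F (p + t • z)) y = _ := h2.fderiv
  rw [h3]
  simp

lemma dWirt_comp_add_smul {F : E → ℂ} (hF : ContDiff ℝ ∞ F) (p : E) (t : ℝ) (v y : E) :
    dWirt v (fun z => F (p + t • z)) y = t * dWirt v F (p + t • y) := by
  simp only [dWirt, fderiv_comp_add_smul hF]; ring

lemma dbarWirt_comp_add_smul {F : E → ℂ} (hF : ContDiff ℝ ∞ F) (p : E) (t : ℝ) (v y : E) :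
    dbarWirt v (fun z => F (p + t • z)) y = t * dbarWirt v F (p + t • y) := by
  simp only [dbarWirt, fderiv_comp_add_smul hF]; ring

lemma hasCompactSupport_dWirt {F : E → ℂ} (hF : HasCompactSupport F) (v : E) :
    HasCompactSupport (dWirt v F) := by
  refine hF.mono' fun x hx => ?_
  by_contra h
  have h1 : fderiv ℝ F x = 0 := by
    by_contra h2
    exact h (support_fderiv_subset ℝ h2)
  exact hx (by simp [dWirt, h1])

lemma hasCompactSupport_dbarWirt {F : E → ℂ} (hF : HasCompactSupport F) (v : E) :
    HasCompactSupport (dbarWirt v F) := by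
  refine hF.mono' fun x hx => ?_
  by_contra h
  have h1 : fderiv ℝ F x = 0 := by
    by_contra h2
    exact h (support_fderiv_subset ℝ h2)
  exact hx (by simp [dbarWirt, h1])

variable [FiniteDimensional ℝ E] [MeasurableSpace E] [BorelSpace E] {μ : Measure E}
  [μ.IsAddHaarMeasure] {f g : E → ℂ}

lemma integral_mul_dWirt (hf : Differentiable ℝ f) (hg : Differentiable ℝ g)
    (h1 : Integrable (fun x => f x * g x) μ)
    (h2 : ∀ v, Integrable (fun x => fderiv ℝ f x v * g x) μ)
    (h3 : ∀ v, Integrable (fun x => f x * fderiv ℝ g x v) μ) (v : E) :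
    ∫ x, f x * dWirt v g x ∂μ = -∫ x, dWirt v f x * g x ∂μ := by
  have key := fun w => integral_mul_fderiv_eq_neg_fderiv_mul_of_integrable (v := w)
    (h2 w) (h3 w) h1 (fun x _ => hf x) (fun x _ => hg x)
  have e1 : ∀ x, f x * dWirt v g x = (1 / 2) * (f x * fderiv ℝ g x v) -
      (Complex.I / 2) * (f x * fderiv ℝ g x (Complex.I • v)) := by
    intro x; rw [dWirt]; ring
  have e2 : ∀ x, dWirt v f x * g x = (1 / 2) * (fderiv ℝ f x v * g x) -
      (Complex.I / 2) * (fderiv ℝ f x (Complex.I • v) * g x) := by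
    intro x; rw [dWirt]; ring
  simp_rw [e1, e2]
  rw [integral_sub ((h3 _).const_mul _) ((h3 _).const_mul _),
    integral_sub ((h2 _).const_mul _) ((h2 _).const_mul _)]
  simp only [integral_const_mul, key]
  ring

lemma integral_mul_dbarWirt (hf : Differentiable ℝ f) (hg : Differentiable ℝ g)
    (h1 : Integrable (fun x => f x * g x) μ)
    (h2 : ∀ v, Integrable (fun x => fderiv ℝ f x v * g x) μ)
    (h3 : ∀ v, Integrable (fun x => f x * fderiv ℝ g x v) μ) (v : E) :
    ∫ x, f x * dbarWirt v g x ∂μ = -∫ x, dbarWirt v f x * g x ∂μ := by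
  have key := fun w => integral_mul_fderiv_eq_neg_fderiv_mul_of_integrable (v := w)
    (h2 w) (h3 w) h1 (fun x _ => hf x) (fun x _ => hg x)
  have e1 : ∀ x, f x * dbarWirt v g x = (1 / 2) * (f x * fderiv ℝ g x v) +
      (Complex.I / 2) * (f x * fderiv ℝ g x (Complex.I • v)) := by
    intro x; rw [dbarWirt]; ring
  have e2 : ∀ x, dbarWirt v f x * g x = (1 / 2) * (fderiv ℝ f x v * g x) +
      (Complex.I / 2) * (fderiv ℝ f x (Complex.I • v) * g x) := by
    intro x; rw [dbarWirt]; ring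
  simp_rw [e1, e2]
  rw [integral_add ((h3 _).const_mul _) ((h3 _).const_mul _),
    integral_add ((h2 _).const_mul _) ((h2 _).const_mul _)]
  simp only [integral_const_mul, key]
  ring

end Wirtinger

/-! ### The coupled Gaussian -/

variable {N : ℕ}

/-- The exponent `-|d|² - |e|² + d_m ē_q`. -/
noncomputable def quadExp (m q : Fin N) (y : Pairs N) : ℂ :=
  -(∑ i, y.1 i * conj (y.1 i)) - (∑ i, y.2 i * conj (y.2 i)) + y.1 m * conj (y.2 q)

/-- The polarization of `quadExp`. -/
noncomputable def quadExpDeriv (m q : Fin N) (y v : Pairs N) : ℂ :=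
  -(∑ i, (y.1 i * conj (v.1 i) + v.1 i * conj (y.1 i))) -
    (∑ i, (y.2 i * conj (v.2 i) + v.2 i * conj (y.2 i))) +
    (y.1 m * conj (v.2 q) + v.1 m * conj (y.2 q))

/-- The coupled Gaussian `exp (-|d|² - |e|² + d_m ē_q)`. -/
noncomputable def quadGauss (m q : Fin N) (y : Pairs N) : ℂ := Complex.exp (quadExp m q y)

/-- The squared Euclidean norm of a pair. -/
noncomputable def pairSq (y : Pairs N) : ℝ := (∑ i, ‖y.1 i‖ ^ 2) + ∑ i, ‖y.2 i‖ ^ 2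

lemma contDiff_fst_apply (i : Fin N) : ContDiff ℝ ∞ fun y : Pairs N => y.1 i :=
  (contDiff_apply ℝ ℂ i).comp contDiff_fst

lemma contDiff_snd_apply (i : Fin N) : ContDiff ℝ ∞ fun y : Pairs N => y.2 i :=
  (contDiff_apply ℝ ℂ i).comp contDiff_snd

lemma contDiff_conj {E : Type*} [NormedAddCommGroup E] [NormedSpace ℝ E] {F : E → ℂ}
    (hF : ContDiff ℝ ∞ F) : ContDiff ℝ ∞ fun x => conj (F x) :=
  Complex.conjCLE.contDiff.comp hF

lemma contDiff_quadExp (m q : Fin N) : ContDiff ℝ ∞ (quadExp m q) := by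
  unfold quadExp
  refine ((ContDiff.sum fun i _ => ?_).neg.sub (ContDiff.sum fun i _ => ?_)).add ?_
  · exact (contDiff_fst_apply i).mul (contDiff_conj (contDiff_fst_apply i))
  · exact (contDiff_snd_apply i).mul (contDiff_conj (contDiff_snd_apply i))
  · exact (contDiff_fst_apply m).mul (contDiff_conj (contDiff_snd_apply q))

lemma contDiff_quadGauss (m q : Fin N) : ContDiff ℝ ∞ (quadGauss m q) :=
  (contDiff_quadExp m q).cexp

/-- The exponent is real-quadratic, so its second order expansion is exact; directional derivatives
of `quadGauss` and the scaling by `√h` are both read off from it. -/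
lemma quadExp_add_smul (m q : Fin N) (y v : Pairs N) (s : ℝ) :
    quadExp m q (y + s • v) = quadExp m q y + s * quadExpDeriv m q y v + s ^ 2 * quadExp m q v := by
  have h : ∀ a b : ℂ, (a + s * b) * conj (a + s * b) =
      a * conj a + s * (a * conj b + b * conj a) + s ^ 2 * (b * conj b) := by
    intro a b
    rw [map_add, map_mul, Complex.conj_ofReal]
    ring
  simp only [quadExp, quadExpDeriv, Prod.fst_add, Prod.snd_add, Prod.smul_fst, Prod.smul_snd,
    Pi.add_apply, Pi.smul_apply, Complex.real_smul]
  simp only [h]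
  simp only [Finset.sum_add_distrib, ← Finset.mul_sum, map_add, map_mul, Complex.conj_ofReal]
  ring

lemma fderiv_quadGauss_apply (m q : Fin N) (y v : Pairs N) :
    fderiv ℝ (quadGauss m q) y v = quadExpDeriv m q y v * quadGauss m q y := by
  have hd : DifferentiableAt ℝ (quadGauss m q) y :=
    (contDiff_quadGauss m q).differentiable (by simp) y
  rw [← hd.lineDeriv_eq_fderiv]
  refine HasLineDerivAt.lineDeriv ?_
  rw [HasLineDerivAt]
  have h1 : HasDerivAt (fun s : ℝ => quadExp m q y + (s : ℂ) * quadExpDeriv m q y v +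
      (s : ℂ) ^ 2 * quadExp m q v) (quadExpDeriv m q y v) 0 := by
    have hs : HasDerivAt (fun s : ℝ => (s : ℂ)) 1 0 := Complex.ofRealCLM.hasDerivAt
    have h2 := ((hs.mul_const (quadExpDeriv m q y v)).const_add (quadExp m q y)).add
      ((hs.pow 2).mul_const (quadExp m q v))
    exact h2.congr_deriv (by simp)
  have h3 := h1.cexp
  simp only [quadGauss, quadExp_add_smul]
  exact h3.congr_deriv (by simp [mul_comm])

lemma I_smul_dirD (i : Fin N) : Complex.I • (dirD i : Pairs N) = (Pi.single i Complex.I, 0) := by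
  ext <;> simp [dirD, Pi.single_apply]

lemma I_smul_dirE (i : Fin N) : Complex.I • (dirE i : Pairs N) = (0, Pi.single i Complex.I) := by
  ext <;> simp [dirE, Pi.single_apply]

lemma conj_single_apply (i j : Fin N) (z : ℂ) :
    conj ((Pi.single i z : Fin N → ℂ) j) = if j = i then conj z else 0 := by
  rw [Pi.single_apply]; split_ifs <;> simp

lemma quadExpDeriv_dirD (m q i : Fin N) (y : Pairs N) (z : ℂ) :
    quadExpDeriv m q y (Pi.single i z, 0) = -(y.1 i * conj z + z * conj (y.1 i)) +
      (if m = i then z * conj (y.2 q) else 0) := by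
  simp only [quadExpDeriv, conj_single_apply]
  simp [Pi.single_apply, Finset.sum_add_distrib]

lemma quadExpDeriv_dirE (m q i : Fin N) (y : Pairs N) (z : ℂ) :
    quadExpDeriv m q y (0, Pi.single i z) = -(y.2 i * conj z + z * conj (y.2 i)) +
      (if q = i then y.1 m * conj z else 0) := by
  simp only [quadExpDeriv, conj_single_apply]
  simp [Pi.single_apply, Finset.sum_add_distrib]

/-- This and the next three identities turn multiplication of the Gaussian by a coordinate into
differentiation. The coupling `d_m ē_q` is holomorphic in `d` and antiholomorphic in `e`, so it is
invisible to `∂̄_d` and `∂_e` and adds one term to the other two derivatives. -/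
lemma dbarWirt_dirD_quadGauss (m q i : Fin N) (y : Pairs N) :
    dbarWirt (dirD i) (quadGauss m q) y = -(y.1 i * quadGauss m q y) := by
  rw [dbarWirt, fderiv_quadGauss_apply, fderiv_quadGauss_apply, I_smul_dirD, dirD,
    quadExpDeriv_dirD, quadExpDeriv_dirD]
  split_ifs <;> simp only [map_one, Complex.conj_I]
  · linear_combination (quadGauss m q y) / 2 * (y.1 i - conj (y.1 i) + conj (y.2 q)) * Complex.I_sq
  · linear_combination (quadGauss m q y) / 2 * (y.1 i - conj (y.1 i)) * Complex.I_sq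

lemma dWirt_dirD_quadGauss (m q i : Fin N) (y : Pairs N) :
    dWirt (dirD i) (quadGauss m q) y = -(conj (y.1 i) * quadGauss m q y) +
      (if m = i then conj (y.2 q) * quadGauss m q y else 0) := by
  rw [dWirt, fderiv_quadGauss_apply, fderiv_quadGauss_apply, I_smul_dirD, dirD,
    quadExpDeriv_dirD, quadExpDeriv_dirD]
  split_ifs <;> simp only [map_one, Complex.conj_I]
  · linear_combination (quadGauss m q y) / 2 * (conj (y.1 i) - y.1 i - conj (y.2 q)) * Complex.I_sq
  · linear_combination (quadGauss m q y) / 2 * (conj (y.1 i) - y.1 i) * Complex.I_sq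

lemma dWirt_dirE_quadGauss (m q i : Fin N) (y : Pairs N) :
    dWirt (dirE i) (quadGauss m q) y = -(conj (y.2 i) * quadGauss m q y) := by
  rw [dWirt, fderiv_quadGauss_apply, fderiv_quadGauss_apply, I_smul_dirE, dirE,
    quadExpDeriv_dirE, quadExpDeriv_dirE]
  split_ifs <;> simp only [map_one, Complex.conj_I]
  · linear_combination (quadGauss m q y) / 2 * (conj (y.2 i) - y.2 i + y.1 m) * Complex.I_sq
  · linear_combination (quadGauss m q y) / 2 * (conj (y.2 i) - y.2 i) * Complex.I_sq

lemma dbarWirt_dirE_quadGauss (m q i : Fin N) (y : Pairs N) :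
    dbarWirt (dirE i) (quadGauss m q) y = -(y.2 i * quadGauss m q y) +
      (if q = i then y.1 m * quadGauss m q y else 0) := by
  rw [dbarWirt, fderiv_quadGauss_apply, fderiv_quadGauss_apply, I_smul_dirE, dirE,
    quadExpDeriv_dirE, quadExpDeriv_dirE]
  split_ifs <;> simp only [map_one, Complex.conj_I]
  · linear_combination (quadGauss m q y) / 2 * (y.2 i - conj (y.2 i) - y.1 m) * Complex.I_sq
  · linear_combination (quadGauss m q y) / 2 * (y.2 i - conj (y.2 i)) * Complex.I_sq

/-- Separates the real differential into coordinates times Wirtinger derivatives, so that each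
coordinate can be traded for a derivative of the Gaussian. -/
lemma apply_eq_sum_wirtinger (F : Pairs N → ℂ) (x y : Pairs N) :
    fderiv ℝ F x y =
      ∑ i, (y.1 i * dWirt (dirD i) F x + conj (y.1 i) * dbarWirt (dirD i) F x) +
      ∑ i, (y.2 i * dWirt (dirE i) F x + conj (y.2 i) * dbarWirt (dirE i) F x) := by
  have hy : y = ∑ i, ((y.1 i).re • (dirD i : Pairs N) + (y.1 i).im • (Complex.I • dirD i)) +
      ∑ i, ((y.2 i).re • (dirE i : Pairs N) + (y.2 i).im • (Complex.I • dirE i)) := by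
    have hz : ∀ (u : Fin N → ℂ) (j : Fin N),
        u j = ∑ i, ((u i).re • (Pi.single i (1 : ℂ) : Fin N → ℂ) j +
          (u i).im • (Pi.single i Complex.I : Fin N → ℂ) j) := by
      intro u j
      rw [Finset.sum_eq_single j (by intro b _ hb; simp [hb.symm]) (by simp)]
      simp
    simp only [I_smul_dirD, I_smul_dirE]
    simp only [dirD, dirE]
    ext j
    · simpa [Prod.fst_sum] using hz y.1 j
    · simpa [Prod.snd_sum] using hz y.2 j
  have hz : ∀ z A B : ℂ, z * A + conj z * B =
      z.re * (A + B) + z.im * (Complex.I * (A - B)) := by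
    intro z A B
    nth_rw 1 [← Complex.re_add_im z]
    rw [← Complex.re_add_im (conj z)]
    simp only [Complex.conj_re, Complex.conj_im, Complex.ofReal_neg]
    ring
  conv_lhs => rw [hy]
  simp only [map_add, map_sum, map_smul, fderiv_apply_I_smul, Complex.real_smul, hz]
  simp only [fderiv_apply_add_dWirt]

end

section

variable {N : ℕ}

/-! ### Bounds for the coupled Gaussian -/

lemma pairSq_nonneg (y : Pairs N) : 0 ≤ pairSq y :=
  add_nonneg (Finset.sum_nonneg fun _ _ => by positivity)
    (Finset.sum_nonneg fun _ _ => by positivity)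

lemma sq_le_sum_sq (u : Fin N → ℂ) (i : Fin N) : ‖u i‖ ^ 2 ≤ ∑ i, ‖u i‖ ^ 2 :=
  Finset.single_le_sum (f := fun i => ‖u i‖ ^ 2) (fun _ _ => by positivity) (Finset.mem_univ i)

lemma re_mul_conj_le (z w : ℂ) : (z * conj w).re ≤ (‖z‖ ^ 2 + ‖w‖ ^ 2) / 2 := by
  have h1 := Complex.re_le_norm (z * conj w)
  rw [norm_mul, Complex.norm_conj] at h1
  nlinarith [sq_nonneg (‖z‖ - ‖w‖)]

lemma re_mul_conj_self (z : ℂ) : (z * conj z).re = ‖z‖ ^ 2 := by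
  rw [Complex.mul_conj', ← Complex.ofReal_pow, Complex.ofReal_re]

lemma re_quadExp (m q : Fin N) (y : Pairs N) :
    (quadExp m q y).re = -pairSq y + (y.1 m * conj (y.2 q)).re := by
  simp only [quadExp, Complex.add_re, Complex.sub_re, Complex.neg_re, Complex.re_sum,
    re_mul_conj_self, pairSq]
  ring

/-- The coupling is at most `(|d_m|² + |e_q|²)/2` and so uses up at most half of the decay. -/
lemma re_quadExp_le (m q : Fin N) (y : Pairs N) : (quadExp m q y).re ≤ -(1 / 2) * pairSq y := by
  rw [re_quadExp]
  have h1 := re_mul_conj_le (y.1 m) (y.2 q)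
  have h2 := sq_le_sum_sq y.1 m
  have h3 := sq_le_sum_sq y.2 q
  simp only [pairSq]
  linarith

lemma norm_quadGauss_le (m q : Fin N) (y : Pairs N) :
    ‖quadGauss m q y‖ ≤ Real.exp (-(1 / 2) * pairSq y) := by
  rw [quadGauss, Complex.norm_exp]
  exact Real.exp_le_exp.2 (re_quadExp_le m q y)

lemma integrable_exp_neg_pairSq {b : ℝ} (hb : 0 < b) :
    Integrable (fun y : Pairs N => Real.exp (-b * pairSq y)) := by
  have h := (integrable_exp_neg_mul_sum_sq (ι := Fin N) hb).mul_prod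
    (integrable_exp_neg_mul_sum_sq (ι := Fin N) hb)
  refine h.congr (ae_of_all _ fun y => ?_)
  simp only
  rw [← Real.exp_add, pairSq, mul_add]

lemma norm_sq_le_pairSq (y : Pairs N) : ‖y‖ ^ 2 ≤ pairSq y := by
  have h1 : ‖y‖ ≤ √(pairSq y) := by
    rw [Prod.norm_def]
    refine max_le ?_ ?_
    · refine (pi_norm_le_iff_of_nonneg (Real.sqrt_nonneg _)).2 fun i => Real.le_sqrt_of_sq_le ?_
      exact (sq_le_sum_sq y.1 i).trans (le_add_of_nonneg_right
        (Finset.sum_nonneg fun _ _ => by positivity))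
    · refine (pi_norm_le_iff_of_nonneg (Real.sqrt_nonneg _)).2 fun i => Real.le_sqrt_of_sq_le ?_
      exact (sq_le_sum_sq y.2 i).trans (le_add_of_nonneg_left
        (Finset.sum_nonneg fun _ _ => by positivity))
  calc ‖y‖ ^ 2 ≤ √(pairSq y) ^ 2 := by gcongr
    _ = pairSq y := Real.sq_sqrt (pairSq_nonneg y)

lemma norm_mul_quadGauss_le (m q : Fin N) (y : Pairs N) :
    ‖y‖ * ‖quadGauss m q y‖ ≤ Real.exp (-(1 / 4) * pairSq y) := by
  have h1 : ‖y‖ ≤ Real.exp (1 / 4 * pairSq y) := by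
    have h2 := Real.add_one_le_exp (1 / 4 * pairSq y)
    have h3 := norm_sq_le_pairSq y
    -- The square gives `‖y‖ ≤ 1 + ‖y‖²/4`.
    nlinarith [sq_nonneg (‖y‖ / 2 - 1)]
  calc _ ≤ Real.exp (1 / 4 * pairSq y) * Real.exp (-(1 / 2) * pairSq y) := by
        gcongr
        exact norm_quadGauss_le m q y
    _ = _ := by rw [← Real.exp_add]; congr 1; ring

lemma continuous_quadGauss (m q : Fin N) : Continuous (quadGauss m q) :=
  (contDiff_quadGauss m q).continuous

lemma integrable_quadGauss (m q : Fin N) : Integrable (quadGauss m q) :=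
  (integrable_exp_neg_pairSq (by norm_num)).mono' (continuous_quadGauss m q).aestronglyMeasurable
    (ae_of_all _ fun y => norm_quadGauss_le m q y)

lemma norm_quadExpDeriv_le (m q : Fin N) (y v : Pairs N) :
    ‖quadExpDeriv m q y v‖ ≤ (4 * N + 2) * (‖y‖ * ‖v‖) := by
  have hfst : ∀ (z : Pairs N) i, ‖z.1 i‖ ≤ ‖z‖ := fun z i =>
    (norm_le_pi_norm z.1 i).trans (norm_fst_le z)
  have hsnd : ∀ (z : Pairs N) i, ‖z.2 i‖ ≤ ‖z‖ := fun z i =>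
    (norm_le_pi_norm z.2 i).trans (norm_snd_le z)
  have hp : ∀ a b a' b' : ℂ, ‖a‖ ≤ ‖y‖ → ‖b‖ ≤ ‖v‖ → ‖a'‖ ≤ ‖v‖ → ‖b'‖ ≤ ‖y‖ →
      ‖a * conj b + a' * conj b'‖ ≤ 2 * (‖y‖ * ‖v‖) := by
    intro a b a' b' h1 h2 h3 h4
    refine (norm_add_le _ _).trans ?_
    rw [norm_mul, norm_mul, Complex.norm_conj, Complex.norm_conj]
    have h5 : ‖a‖ * ‖b‖ ≤ ‖y‖ * ‖v‖ := by gcongr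
    have h6 : ‖a'‖ * ‖b'‖ ≤ ‖v‖ * ‖y‖ := by gcongr
    linarith
  have hs1 : ‖∑ i, (y.1 i * conj (v.1 i) + v.1 i * conj (y.1 i))‖ ≤ N * (2 * (‖y‖ * ‖v‖)) :=
    (norm_sum_le_of_le _ fun i _ => hp _ _ _ _ (hfst y i) (hfst v i) (hfst v i)
      (hfst y i)).trans_eq (by simp)
  have hs2 : ‖∑ i, (y.2 i * conj (v.2 i) + v.2 i * conj (y.2 i))‖ ≤ N * (2 * (‖y‖ * ‖v‖)) :=
    (norm_sum_le_of_le _ fun i _ => hp _ _ _ _ (hsnd y i) (hsnd v i) (hsnd v i)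
      (hsnd y i)).trans_eq (by simp)
  have hs3 := hp _ _ _ _ (hfst y m) (hsnd v q) (hfst v m) (hsnd y q)
  rw [quadExpDeriv]
  refine (norm_add_le _ _).trans ?_
  have h7 := norm_sub_le (-(∑ i, (y.1 i * conj (v.1 i) + v.1 i * conj (y.1 i))))
    (∑ i, (y.2 i * conj (v.2 i) + v.2 i * conj (y.2 i)))
  rw [norm_neg] at h7
  linarith

/-- For fixed `d` the exponent in `e` has only an antiholomorphic linear term, so `exp(αβ/b) = 1`
and the coupling does not affect the integral. -/
lemma integral_quadGauss (m q : Fin N) :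
    ∫ y, quadGauss m q y = (Real.pi : ℂ) ^ (2 * N) := by
  have key : ∀ d e : Fin N → ℂ, quadGauss m q (d, e) =
      Complex.exp (∑ i, gaussExponent 1 0 0 (d i)) *
        Complex.exp (∑ i, gaussExponent 1 0 ((Pi.single q (d m) : Fin N → ℂ) i) (e i)) := by
    intro d e
    rw [← Complex.exp_add, quadGauss]
    congr 1
    simp only [quadExp, gaussExponent, Complex.mul_conj', Pi.single_apply, Finset.sum_add_distrib,
      ite_mul, zero_mul, Finset.sum_ite_eq', Finset.mem_univ, if_true, Complex.ofReal_one,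
      neg_mul, one_mul, Finset.sum_neg_distrib, Finset.sum_const_zero]
    ring
  rw [Measure.volume_eq_prod, integral_prod _ (integrable_quadGauss m q)]
  simp_rw [key, integral_const_mul, integral_cexp_sum_gaussExponent one_pos]
  simp only [zero_mul, zero_div, Finset.sum_const_zero, Complex.exp_zero, mul_one]
  rw [integral_mul_const, integral_cexp_sum_gaussExponent one_pos]
  simp [two_mul, pow_add]

instance instIsAddHaarMeasurePairs : (volume : Measure (Pairs N)).IsAddHaarMeasure :=
  Measure.prod.instIsAddHaarMeasure _ _

/-! ### The Gaussian averages and their expansion -/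

/-- The average `∫ F(p + t y) exp(-|d|² - |e|² + d_m ē_q) dy`, with `y = (d, e)`. -/
noncomputable def gaussAvg (m q : Fin N) (F : Pairs N → ℂ) (p : Pairs N) (t : ℝ) : ℂ :=
  ∫ y, F (p + t • y) * quadGauss m q y

lemma integrable_mul_quadGauss (m q : Fin N) {F : Pairs N → ℂ} (hc : Continuous F) {B : ℝ}
    (hB : ∀ x, ‖F x‖ ≤ B) : Integrable fun y => F y * quadGauss m q y :=
  (integrable_quadGauss m q).bdd_mul hc.aestronglyMeasurable (ae_of_all _ hB)

lemma continuous_add_smul (p : Pairs N) (t : ℝ) : Continuous fun y : Pairs N => p + t • y :=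
  continuous_const.add (continuous_id.const_smul t)

lemma norm_gaussAvg_le (m q : Fin N) {F : Pairs N → ℂ} {B : ℝ}
    (hB : ∀ x, ‖F x‖ ≤ B) (p : Pairs N) (t : ℝ) :
    ‖gaussAvg m q F p t‖ ≤ (∫ y, ‖quadGauss m q y‖) * B := by
  rw [← integral_mul_const]
  refine norm_integral_le_of_norm_le ((integrable_quadGauss m q).norm.mul_const B)
    (ae_of_all _ fun y => ?_)
  rw [norm_mul, mul_comm]
  exact mul_le_mul_of_nonneg_left (hB _) (norm_nonneg _)

lemma contDiff_mixedOp (m q : Fin N) {F : Pairs N → ℂ} (hF : ContDiff ℝ ∞ F) :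
    ContDiff ℝ ∞ (mixedOp m q F) :=
  ((ContDiff.sum fun _ _ => contDiff_dWirt (contDiff_dbarWirt hF _) _).add
    (ContDiff.sum fun _ _ => contDiff_dWirt (contDiff_dbarWirt hF _) _)).add
    (contDiff_dbarWirt (contDiff_dWirt hF _) _)

lemma hasCompactSupport_finset_sum {α ι : Type*} [TopologicalSpace α] (s : Finset ι)
    {f : ι → α → ℂ} (hf : ∀ i ∈ s, HasCompactSupport (f i)) :
    HasCompactSupport fun x => ∑ i ∈ s, f i x := by
  classical
  induction s using Finset.induction_on with
  | empty =>
    simp only [Finset.sum_empty]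
    exact HasCompactSupport.zero
  | insert a s ha ih =>
    simp only [Finset.sum_insert ha]
    exact (hf a (Finset.mem_insert_self a s)).add
      (ih fun i hi => hf i (Finset.mem_insert_of_mem hi))

lemma hasCompactSupport_mixedOp (m q : Fin N) {F : Pairs N → ℂ} (hF : HasCompactSupport F) :
    HasCompactSupport (mixedOp m q F) :=
  ((hasCompactSupport_finset_sum _ fun _ _ =>
    hasCompactSupport_dWirt (hasCompactSupport_dbarWirt hF _) _).add
    (hasCompactSupport_finset_sum _ fun _ _ =>
    hasCompactSupport_dWirt (hasCompactSupport_dbarWirt hF _) _)).add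
    (hasCompactSupport_dbarWirt (hasCompactSupport_dWirt hF _) _)

lemma exists_norm_le_of_hasCompactSupport {F : Pairs N → ℂ} (hF : ContDiff ℝ ∞ F)
    (hs : HasCompactSupport F) : ∃ B, ∀ x, ‖F x‖ ≤ B :=
  hs.exists_bound_of_continuous hF.continuous

section Derivative

variable (m q : Fin N) {F : Pairs N → ℂ} (hF : ContDiff ℝ ∞ F) (hs : HasCompactSupport F)
include hF hs

lemma exists_norm_fderiv_le : ∃ B, 0 ≤ B ∧ ∀ x, ‖fderiv ℝ F x‖ ≤ B := by
  obtain ⟨B, hB⟩ := (hs.fderiv ℝ).exists_bound_of_continuous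
    (hF.continuous_fderiv (by simp))
  exact ⟨B, (norm_nonneg _).trans (hB 0), hB⟩

/-- Compact support bounds `F` and its derivative, and the Gaussian decay supplies all the
integrability needed for integration by parts. The factor `t` is the chain rule for `y ↦ p + t y`.
-/
lemma ibp_aux (p : Pairs N) (t : ℝ) (v : Pairs N) :
    (∫ y, F (p + t • y) * dWirt v (quadGauss m q) y =
      -(t * ∫ y, dWirt v F (p + t • y) * quadGauss m q y)) ∧
    (∫ y, F (p + t • y) * dbarWirt v (quadGauss m q) y =
      -(t * ∫ y, dbarWirt v F (p + t • y) * quadGauss m q y)) ∧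
    Integrable (fun y => F (p + t • y) * dWirt v (quadGauss m q) y) ∧
    Integrable (fun y => F (p + t • y) * dbarWirt v (quadGauss m q) y) := by
  obtain ⟨B, hB⟩ := exists_norm_le_of_hasCompactSupport hF hs
  obtain ⟨B', hB0, hB'⟩ := exists_norm_fderiv_le hF hs
  set f : Pairs N → ℂ := fun y => F (p + t • y) with hf
  have hfc : ContDiff ℝ ∞ f := hF.comp (contDiff_const.add (contDiff_id.const_smul t))
  have hg := contDiff_quadGauss m q
  have h1 : Integrable (fun y => f y * quadGauss m q y) :=
    integrable_mul_quadGauss m q hfc.continuous fun y => hB _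
  have h2 : ∀ w, Integrable (fun y => fderiv ℝ f y w * quadGauss m q y) := by
    intro w
    refine integrable_mul_quadGauss m q (contDiff_fderiv_apply hfc w).continuous
      (B := |t| * (B' * ‖w‖)) fun y => ?_
    rw [hf, fderiv_comp_add_smul hF, norm_mul, Complex.norm_real, Real.norm_eq_abs]
    gcongr
    exact (ContinuousLinearMap.le_opNorm _ _).trans (by gcongr; exact hB' _)
  have h3 : ∀ w, Integrable (fun y => f y * fderiv ℝ (quadGauss m q) y w) := by
    intro w
    refine ((integrable_exp_neg_pairSq (N := N) (b := 1 / 4) (by norm_num)).const_mul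
      (B * ((4 * N + 2) * ‖w‖))).mono' ?_ (ae_of_all _ fun y => ?_)
    · exact (hfc.continuous.mul (contDiff_fderiv_apply hg w).continuous).aestronglyMeasurable
    · rw [fderiv_quadGauss_apply, norm_mul, norm_mul]
      have h4 := norm_quadExpDeriv_le m q y w
      have h5 := norm_mul_quadGauss_le m q y
      have h6 := hB (p + t • y)
      have h7 : 0 ≤ B := (norm_nonneg _).trans h6
      calc _ ≤ B * ((4 * N + 2) * (‖y‖ * ‖w‖) * ‖quadGauss m q y‖) := by gcongr
        _ = B * ((4 * N + 2) * ‖w‖) * (‖y‖ * ‖quadGauss m q y‖) := by ring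
        _ ≤ _ := by gcongr
  have hd1 := hfc.differentiable (by simp)
  have hd2 := hg.differentiable (by simp)
  refine ⟨?_, ?_, ?_, ?_⟩
  · rw [integral_mul_dWirt hd1 hd2 h1 h2 h3 v, ← integral_const_mul]
    simp only [hf, dWirt_comp_add_smul hF, mul_assoc]
  · rw [integral_mul_dbarWirt hd1 hd2 h1 h2 h3 v, ← integral_const_mul]
    simp only [hf, dbarWirt_comp_add_smul hF, mul_assoc]
  · refine (((h3 v).const_mul (1 / 2)).sub ((h3 (Complex.I • v)).const_mul
      (Complex.I / 2))).congr (ae_of_all _ fun y => ?_)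
    simp only [dWirt, Pi.sub_apply]
    ring
  · refine (((h3 v).const_mul (1 / 2)).add ((h3 (Complex.I • v)).const_mul
      (Complex.I / 2))).congr (ae_of_all _ fun y => ?_)
    simp only [dbarWirt, Pi.add_apply]
    ring

/-- Each coordinate times the Gaussian is a Wirtinger derivative of the Gaussian, and integrating by
parts moves it to `F` with a factor `t`. Every `∂∂̄` arises twice, from `d_i` and `d̄_i` (or `e_i`
and `ē_i`). The coupling terms of `d̄_m` and `e_q` each yield `∂̄_{d_m} ∂_{e_q}`, whence `2t` times
the full operator. -/
lemma integral_fderiv_apply_mul_quadGauss (p : Pairs N) (t : ℝ) :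
    ∫ y, fderiv ℝ F (p + t • y) y * quadGauss m q y =
      2 * t * gaussAvg m q (mixedOp m q F) p t := by
  have hD : ∀ v, ContDiff ℝ ∞ (dWirt v F) := fun v => contDiff_dWirt hF v
  have hD' : ∀ v, ContDiff ℝ ∞ (dbarWirt v F) := fun v => contDiff_dbarWirt hF v
  have hS : ∀ v, HasCompactSupport (dWirt v F) := fun v => hasCompactSupport_dWirt hs v
  have hS' : ∀ v, HasCompactSupport (dbarWirt v F) := fun v => hasCompactSupport_dbarWirt hs v
  have e1 : ∀ y, fderiv ℝ F (p + t • y) y * quadGauss m q y =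
      -(∑ i, (dWirt (dirD i) F (p + t • y) * dbarWirt (dirD i) (quadGauss m q) y +
        dbarWirt (dirD i) F (p + t • y) * dWirt (dirD i) (quadGauss m q) y) +
      ∑ i, (dWirt (dirE i) F (p + t • y) * dbarWirt (dirE i) (quadGauss m q) y +
        dbarWirt (dirE i) F (p + t • y) * dWirt (dirE i) (quadGauss m q) y) +
      (dbarWirt (dirD m) F (p + t • y) * dWirt (dirE q) (quadGauss m q) y +
        dWirt (dirE q) F (p + t • y) * dbarWirt (dirD m) (quadGauss m q) y)) := by
    intro y
    rw [apply_eq_sum_wirtinger, add_mul]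
    simp only [dbarWirt_dirD_quadGauss, dWirt_dirD_quadGauss, dWirt_dirE_quadGauss,
      dbarWirt_dirE_quadGauss, mul_add, mul_ite, mul_zero, Finset.sum_add_distrib,
      Finset.sum_ite_eq, Finset.mem_univ, if_true, Finset.sum_mul, add_mul, mul_neg,
      Finset.sum_neg_distrib]
    have e : ∀ a b c : ℂ, b * (a * c) = a * b * c := fun a b c => by ring
    simp only [e]
    ring
  have hI1 : ∀ v w, Integrable (fun y => dWirt v F (p + t • y) *
      dbarWirt w (quadGauss m q) y) := fun v w => (ibp_aux m q (hD v) (hS v) p t w).2.2.2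
  have hI2 : ∀ v w, Integrable (fun y => dbarWirt v F (p + t • y) *
      dWirt w (quadGauss m q) y) := fun v w => (ibp_aux m q (hD' v) (hS' v) p t w).2.2.1
  have hJ1 : ∀ v w, ∫ y, dWirt v F (p + t • y) * dbarWirt w (quadGauss m q) y =
      -(t * ∫ y, dWirt v (dbarWirt w F) (p + t • y) * quadGauss m q y) := by
    intro v w
    rw [(ibp_aux m q (hD v) (hS v) p t w).2.1, dWirt_dbarWirt_comm hF]
  have hJ2 : ∀ v w, ∫ y, dbarWirt v F (p + t • y) * dWirt w (quadGauss m q) y =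
      -(t * ∫ y, dWirt w (dbarWirt v F) (p + t • y) * quadGauss m q y) :=
    fun v w => (ibp_aux m q (hD' v) (hS' v) p t w).1
  have hK : ∀ v w, Integrable (fun y => dWirt v (dbarWirt w F) (p + t • y) *
      quadGauss m q y) := by
    intro v w
    obtain ⟨B, hB⟩ := exists_norm_le_of_hasCompactSupport (contDiff_dWirt (hD' w) v)
      (hasCompactSupport_dWirt (hS' w) v)
    exact integrable_mul_quadGauss m q (((contDiff_dWirt (hD' w) v).continuous).comp
      (continuous_add_smul p t)) fun y => hB _
  have e2 : gaussAvg m q (mixedOp m q F) p t =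
      ∑ i, (∫ y, dWirt (dirD i) (dbarWirt (dirD i) F) (p + t • y) * quadGauss m q y) +
      ∑ i, (∫ y, dWirt (dirE i) (dbarWirt (dirE i) F) (p + t • y) * quadGauss m q y) +
      ∫ y, dWirt (dirE q) (dbarWirt (dirD m) F) (p + t • y) * quadGauss m q y := by
    simp only [gaussAvg, mixedOp, add_mul, Finset.sum_mul, ← dWirt_dbarWirt_comm hF]
    rw [integral_add (Integrable.fun_add (integrable_finsetSum _ fun i _ => hK _ _)
      (integrable_finsetSum _ fun i _ => hK _ _)) (hK _ _),
      integral_add (integrable_finsetSum _ fun i _ => hK _ _)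
      (integrable_finsetSum _ fun i _ => hK _ _),
      integral_finsetSum _ fun i _ => hK _ _, integral_finsetSum _ fun i _ => hK _ _]
  simp_rw [e1]
  have hsum : ∀ dir : Fin N → Pairs N, Integrable (fun y => ∑ i,
      (dWirt (dir i) F (p + t • y) * dbarWirt (dir i) (quadGauss m q) y +
        dbarWirt (dir i) F (p + t • y) * dWirt (dir i) (quadGauss m q) y)) :=
    fun dir => integrable_finsetSum _ fun i _ => Integrable.fun_add (hI1 _ _) (hI2 _ _)
  have hsum' : ∀ dir : Fin N → Pairs N, ∫ y, ∑ i,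
      (dWirt (dir i) F (p + t • y) * dbarWirt (dir i) (quadGauss m q) y +
        dbarWirt (dir i) F (p + t • y) * dWirt (dir i) (quadGauss m q) y) =
      -(2 * t * ∑ i, ∫ y, dWirt (dir i) (dbarWirt (dir i) F) (p + t • y) *
        quadGauss m q y) := by
    intro dir
    rw [integral_finsetSum _ fun i _ => Integrable.fun_add (hI1 _ _) (hI2 _ _), Finset.mul_sum,
      ← Finset.sum_neg_distrib]
    refine Finset.sum_congr rfl fun i _ => ?_
    rw [integral_add (hI1 _ _) (hI2 _ _), hJ1, hJ2]
    ring
  rw [integral_neg, integral_add (Integrable.fun_add (hsum dirD) (hsum dirE))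
      (Integrable.fun_add (hI2 _ _) (hI1 _ _)),
    integral_add (hsum dirD) (hsum dirE), integral_add (hI2 _ _) (hI1 _ _), hsum', hsum', hJ1,
    hJ2, e2]
  ring

/-- Differentiation under the integral followed by the previous identity. In the variable `t²` this
is the heat equation for `mixedOp`. -/
lemma hasDerivAt_gaussAvg (p : Pairs N) (t : ℝ) :
    HasDerivAt (gaussAvg m q F p) (2 * t * gaussAvg m q (mixedOp m q F) p t) t := by
  obtain ⟨B, hB⟩ := exists_norm_le_of_hasCompactSupport hF hs
  obtain ⟨B', hB0, hB'⟩ := exists_norm_fderiv_le hF hs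
  rw [← integral_fderiv_apply_mul_quadGauss m q hF hs]
  refine (hasDerivAt_integral_of_dominated_loc_of_deriv_le (s := Set.univ)
    (F := fun t y => F (p + t • y) * quadGauss m q y)
    (F' := fun t y => fderiv ℝ F (p + t • y) y * quadGauss m q y)
    (bound := fun y => B' * Real.exp (-(1 / 4) * pairSq y)) univ_mem
    (Eventually.of_forall fun s => ?_) ?_ ?_ (ae_of_all _ fun y s _ => ?_) ?_
    (ae_of_all _ fun y s _ => ?_)).2
  · exact ((hF.continuous.comp (continuous_add_smul p s)).mul
      (continuous_quadGauss m q)).aestronglyMeasurable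
  · exact integrable_mul_quadGauss m q (hF.continuous.comp (continuous_add_smul p t))
      fun y => hB _
  · exact ((((hF.continuous_fderiv (by simp)).comp (continuous_add_smul p t)).clm_apply
      continuous_id).mul (continuous_quadGauss m q)).aestronglyMeasurable
  · rw [norm_mul]
    calc _ ≤ B' * ‖y‖ * ‖quadGauss m q y‖ := by
          gcongr
          exact (ContinuousLinearMap.le_opNorm _ _).trans (by gcongr; exact hB' _)
      _ = B' * (‖y‖ * ‖quadGauss m q y‖) := by ring
      _ ≤ _ := by gcongr; exact norm_mul_quadGauss_le m q y
  · exact (integrable_exp_neg_pairSq (by norm_num)).const_mul _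
  · have h1 : HasDerivAt (fun s : ℝ => p + s • y) y s := by
      simpa using ((hasDerivAt_id s).smul_const y).const_add p
    have h2 := (hF.differentiable (by simp) (p + s • y)).hasFDerivAt.comp_hasDerivAt s h1
    exact h2.mul_const _

end Derivative

lemma gaussAvg_zero (m q : Fin N) (F : Pairs N → ℂ) (p : Pairs N) :
    gaussAvg m q F p 0 = (Real.pi : ℂ) ^ (2 * N) * F p := by
  simp [gaussAvg, integral_const_mul, integral_quadGauss, mul_comm]

/-- The remainder of order `R + 1` for `F` vanishes at `t = 0`, and its derivative is `2t` times the
remainder of order `R` for `mixedOp F`, so induction and the mean value inequality suffice. The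
constant does not depend on `F` or `p`: `F` enters only through the bound for its `R`-th iterate,
and this allows integration over the unitary groups. -/
lemma gaussAvg_expansion (m q : Fin N) (R : ℕ) :
    ∃ C, 0 ≤ C ∧ ∀ F : Pairs N → ℂ, ContDiff ℝ ∞ F → HasCompactSupport F → ∀ B,
      (∀ x, ‖(mixedOp m q)^[R] F x‖ ≤ B) → ∀ p, ∀ t : ℝ, 0 ≤ t →
      ‖gaussAvg m q F p t - (Real.pi : ℂ) ^ (2 * N) * ∑ r ∈ Finset.range R,
        (t : ℂ) ^ (2 * r) * ((r.factorial : ℂ)⁻¹ * (mixedOp m q)^[r] F p)‖ ≤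
      C * B * t ^ (2 * R) := by
  induction R with
  | zero =>
    refine ⟨∫ y, ‖quadGauss m q y‖, integral_nonneg fun _ => norm_nonneg _, ?_⟩
    intro F hF hs B hB p t ht
    simpa using norm_gaussAvg_le m q hB p t
  | succ R ih =>
    obtain ⟨C, hC0, hC⟩ := ih
    refine ⟨2 * C, by positivity, ?_⟩
    intro F hF hs B hB p T hT
    have hB0 : 0 ≤ B := (norm_nonneg _).trans (hB 0)
    set v : ℝ → ℂ := fun t => gaussAvg m q F p t - (Real.pi : ℂ) ^ (2 * N) *
      ∑ r ∈ Finset.range (R + 1),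
        (t : ℂ) ^ (2 * r) * ((r.factorial : ℂ)⁻¹ * (mixedOp m q)^[r] F p) with hv
    have hder : ∀ t : ℝ, HasDerivAt v (2 * t * (gaussAvg m q (mixedOp m q F) p t -
        (Real.pi : ℂ) ^ (2 * N) * ∑ r ∈ Finset.range R, (t : ℂ) ^ (2 * r) *
          ((r.factorial : ℂ)⁻¹ * (mixedOp m q)^[r] (mixedOp m q F) p))) t := by
      intro t
      have h1 := hasDerivAt_gaussAvg m q hF hs p t
      have h2 : ∀ r : ℕ, HasDerivAt (fun t : ℝ => (t : ℂ) ^ (2 * (r + 1)) *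
          (((r + 1).factorial : ℂ)⁻¹ * (mixedOp m q)^[r + 1] F p))
          (2 * t * ((t : ℂ) ^ (2 * r) * ((r.factorial : ℂ)⁻¹ *
            (mixedOp m q)^[r] (mixedOp m q F) p))) t := by
        intro r
        have h3 : HasDerivAt (fun s : ℝ => (s : ℂ)) 1 t := Complex.ofRealCLM.hasDerivAt
        refine ((h3.pow (2 * (r + 1))).mul_const _).congr_deriv ?_
        rw [Function.iterate_succ_apply, Nat.factorial_succ]
        have h4 : (r : ℂ) + 1 ≠ 0 := by exact_mod_cast Nat.succ_ne_zero r
        have h5 : (r.factorial : ℂ) ≠ 0 := by exact_mod_cast r.factorial_ne_zero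
        have h6 : 2 * (r + 1) - 1 = 2 * r + 1 := by omega
        rw [h6]
        push_cast
        field_simp
        ring
      have h7 : HasDerivAt (fun t : ℝ => ∑ r ∈ Finset.range (R + 1), (t : ℂ) ^ (2 * r) *
          ((r.factorial : ℂ)⁻¹ * (mixedOp m q)^[r] F p))
          (∑ r ∈ Finset.range R, 2 * t * ((t : ℂ) ^ (2 * r) * ((r.factorial : ℂ)⁻¹ *
            (mixedOp m q)^[r] (mixedOp m q F) p))) t := by
        simp only [Finset.sum_range_succ' _ R, mul_zero, pow_zero]
        exact (HasDerivAt.fun_sum fun r _ => h2 r).add_const _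
      refine (h1.sub (h7.const_mul _)).congr_deriv ?_
      rw [← Finset.mul_sum]
      ring
    have hv0 : v 0 = 0 := by
      simp only [hv, gaussAvg_zero, Complex.ofReal_zero]
      rw [Finset.sum_range_succ']
      simp
    have hbound : ∀ t ∈ Set.Ico 0 T, ‖2 * (t : ℂ) * (gaussAvg m q (mixedOp m q F) p t -
        (Real.pi : ℂ) ^ (2 * N) * ∑ r ∈ Finset.range R, (t : ℂ) ^ (2 * r) *
          ((r.factorial : ℂ)⁻¹ * (mixedOp m q)^[r] (mixedOp m q F) p))‖ ≤
        2 * T * (C * B * T ^ (2 * R)) := by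
      intro t ht
      have h1 := hC (mixedOp m q F) (contDiff_mixedOp m q hF) (hasCompactSupport_mixedOp m q hs)
        B (by simpa only [Function.iterate_succ_apply] using hB) p t ht.1
      have ht0 := ht.1
      have htT := ht.2.le
      rw [norm_mul, norm_mul, Complex.norm_real, Real.norm_of_nonneg ht0, Complex.norm_ofNat]
      refine mul_le_mul (by linarith) (h1.trans ?_) (norm_nonneg _) (by positivity)
      gcongr
    have h8 := norm_image_sub_le_of_norm_deriv_le_segment'
      (fun t _ => (hder t).hasDerivWithinAt) hbound T ⟨hT, le_refl T⟩
    rw [hv0, sub_zero, sub_zero] at h8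
    refine h8.trans_eq ?_
    ring

end

section

set_option linter.unusedSectionVars false
variable {N : ℕ}

/-! ### Locality and parameter dependence of `mixedOp` -/

lemma dWirt_congr {E : Type*} [NormedAddCommGroup E] [NormedSpace ℂ E] [NormedSpace ℝ E] (v : E)
    {F G : E → ℂ} {x : E} (h : F =ᶠ[𝓝 x] G) : dWirt v F =ᶠ[𝓝 x] dWirt v G := by
  filter_upwards [h.fderiv (𝕜 := ℝ)] with y hy
  simp only [dWirt, hy]

lemma dbarWirt_congr {E : Type*} [NormedAddCommGroup E] [NormedSpace ℂ E] [NormedSpace ℝ E]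
    (v : E) {F G : E → ℂ} {x : E} (h : F =ᶠ[𝓝 x] G) : dbarWirt v F =ᶠ[𝓝 x] dbarWirt v G := by
  filter_upwards [h.fderiv (𝕜 := ℝ)] with y hy
  simp only [dbarWirt, hy]

lemma mixedOp_congr (m q : Fin N) {F G : Pairs N → ℂ} {x : Pairs N} (h : F =ᶠ[𝓝 x] G) :
    mixedOp m q F =ᶠ[𝓝 x] mixedOp m q G := by
  have h1 : ∀ᶠ y in 𝓝 x, ∀ i, dWirt (dirD i) (dbarWirt (dirD i) F) y =
      dWirt (dirD i) (dbarWirt (dirD i) G) y :=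
    eventually_all.2 fun i => dWirt_congr _ (dbarWirt_congr _ h)
  have h2 : ∀ᶠ y in 𝓝 x, ∀ i, dWirt (dirE i) (dbarWirt (dirE i) F) y =
      dWirt (dirE i) (dbarWirt (dirE i) G) y :=
    eventually_all.2 fun i => dWirt_congr _ (dbarWirt_congr _ h)
  filter_upwards [h1, h2, dbarWirt_congr (dirD m) (dWirt_congr (dirE q) h)] with y e1 e2 e3
  simp only [mixedOp, e1, e2, e3]

/-- Locality: a cutoff equal to one near the centre does not change the coefficients there. -/
lemma iterate_mixedOp_congr (m q : Fin N) (r : ℕ) {F G : Pairs N → ℂ} {x : Pairs N}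
    (h : F =ᶠ[𝓝 x] G) : (mixedOp m q)^[r] F =ᶠ[𝓝 x] (mixedOp m q)^[r] G := by
  induction r generalizing F G with
  | zero => exact h
  | succ r ih =>
    simp only [Function.iterate_succ_apply]
    exact ih (mixedOp_congr m q h)

lemma iterate_mixedOp_zero (m q : Fin N) (r : ℕ) : (mixedOp m q)^[r] (fun _ => 0) = fun _ => 0 := by
  induction r with
  | zero => rfl
  | succ r ih =>
    rw [Function.iterate_succ_apply]
    have h : mixedOp m q (fun _ => 0) = fun _ => 0 := by
      have h1 : ∀ v : Pairs N, dWirt v (fun _ => (0 : ℂ)) = fun _ => 0 := fun v => by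
        funext x; simp [dWirt]
      have h2 : ∀ v : Pairs N, dbarWirt v (fun _ => (0 : ℂ)) = fun _ => 0 := fun v => by
        funext x; simp [dbarWirt]
      funext x
      simp [mixedOp, h1, h2]
    rw [h, ih]

section Param

variable {V : Type*} [NormedAddCommGroup V] [NormedSpace ℂ V] [NormedSpace ℝ V]

lemma fderiv_partial_apply {F : V × Pairs N → ℂ} (hF : ContDiff ℝ ∞ F) (a : V) (x v : Pairs N) :
    fderiv ℝ (fun y => F (a, y)) x v = fderiv ℝ F (a, x) (0, v) := by
  have h1 : HasFDerivAt (fun y : Pairs N => (a, y)) (ContinuousLinearMap.inr ℝ V (Pairs N)) x :=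
    hasFDerivAt_prodMk_right a x
  have h2 := (hF.differentiable (by simp) (a, x)).hasFDerivAt.comp x h1
  have h3 : fderiv ℝ (fun y => F (a, y)) x = _ := h2.fderiv
  rw [h3]
  simp

lemma dWirt_partial {F : V × Pairs N → ℂ} (hF : ContDiff ℝ ∞ F) (a : V) (v : Pairs N) :
    dWirt v (fun y => F (a, y)) = fun y => dWirt ((0, v) : V × Pairs N) F (a, y) := by
  funext x
  simp [dWirt, fderiv_partial_apply hF]

lemma dbarWirt_partial {F : V × Pairs N → ℂ} (hF : ContDiff ℝ ∞ F) (a : V) (v : Pairs N) :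
    dbarWirt v (fun y => F (a, y)) = fun y => dbarWirt ((0, v) : V × Pairs N) F (a, y) := by
  funext x
  simp [dbarWirt, fderiv_partial_apply hF]

/-- The operator `mixedOp` acting on functions with an additional parameter. -/
noncomputable def paramOp (m q : Fin N) (F : V × Pairs N → ℂ) : V × Pairs N → ℂ :=
  fun x => (∑ i, dWirt ((0, dirD i) : V × Pairs N) (dbarWirt ((0, dirD i) : V × Pairs N) F) x) +
    (∑ i, dWirt ((0, dirE i) : V × Pairs N) (dbarWirt ((0, dirE i) : V × Pairs N) F) x) +
    dbarWirt ((0, dirD m) : V × Pairs N) (dWirt ((0, dirE q) : V × Pairs N) F) x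

lemma contDiff_paramOp (m q : Fin N) {F : V × Pairs N → ℂ} (hF : ContDiff ℝ ∞ F) :
    ContDiff ℝ ∞ (paramOp m q F) :=
  ((ContDiff.sum fun _ _ => contDiff_dWirt (contDiff_dbarWirt hF _) _).add
    (ContDiff.sum fun _ _ => contDiff_dWirt (contDiff_dbarWirt hF _) _)).add
    (contDiff_dbarWirt (contDiff_dWirt hF _) _)

lemma mixedOp_partial (m q : Fin N) {F : V × Pairs N → ℂ} (hF : ContDiff ℝ ∞ F) (a : V) :
    mixedOp m q (fun y => F (a, y)) = fun y => paramOp m q F (a, y) := by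
  funext x
  simp only [mixedOp, paramOp, dWirt_partial hF, dbarWirt_partial hF,
    dWirt_partial (contDiff_dbarWirt hF _), dbarWirt_partial (contDiff_dWirt hF _)]

/-- Treating the unitary matrices as parameters of a jointly smooth function makes all iterates
continuous in them, hence integrable and uniformly bounded on compact sets. -/
lemma iterate_mixedOp_partial (m q : Fin N) (r : ℕ) {F : V × Pairs N → ℂ}
    (hF : ContDiff ℝ ∞ F) (a : V) :
    (mixedOp m q)^[r] (fun y => F (a, y)) = fun y => (paramOp m q)^[r] F (a, y) := by
  induction r generalizing F with
  | zero => rfl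
  | succ r ih =>
    simp only [Function.iterate_succ_apply]
    rw [mixedOp_partial m q hF, ih (contDiff_paramOp m q hF)]

lemma continuous_iterate_paramOp (m q : Fin N) (r : ℕ) {F : V × Pairs N → ℂ}
    (hF : ContDiff ℝ ∞ F) : Continuous ((paramOp m q)^[r] F) := by
  induction r generalizing F with
  | zero => exact hF.continuous
  | succ r ih =>
    rw [Function.iterate_succ_apply]
    exact ih (contDiff_paramOp m q hF)

end Param

/-! ### Exponentially small terms -/

/-- One term of the exponential series, `exp(x) ≥ x^(n+R)/(n+R)!` at `x = δ/h`, already suffices. -/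
lemma isBigO_exp_neg_div {δ : ℝ} (hδ : 0 < δ) (n R : ℕ) :
    (fun h : ℝ => (h ^ n)⁻¹ * Real.exp (-δ / h)) =O[𝓝[>] 0] fun h => h ^ R := by
  refine IsBigO.of_bound ((n + R).factorial / δ ^ (n + R)) ?_
  filter_upwards [self_mem_nhdsWithin] with h hh
  have hh : 0 < h := hh
  rw [Real.norm_of_nonneg (by positivity), Real.norm_of_nonneg (by positivity)]
  have h1 := Real.pow_div_factorial_le_exp (δ / h) (by positivity) (n + R)
  have h2 : Real.exp (-δ / h) = (Real.exp (δ / h))⁻¹ := by rw [← Real.exp_neg, neg_div]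
  rw [h2]
  have h3 : (Real.exp (δ / h))⁻¹ ≤ ((δ / h) ^ (n + R) / (n + R).factorial)⁻¹ := by gcongr
  calc _ ≤ (h ^ n)⁻¹ * ((δ / h) ^ (n + R) / (n + R).factorial)⁻¹ := by gcongr
    _ = _ := by
      rw [div_pow]
      field_simp
      rw [pow_add]

lemma pairSq_le (x p : Pairs N) : pairSq x ≤ 2 * pairSq (x - p) + 2 * pairSq p := by
  have h : ∀ u v : Fin N → ℂ,
      ∑ i, ‖u i‖ ^ 2 ≤ 2 * ∑ i, ‖(u - v) i‖ ^ 2 + 2 * ∑ i, ‖v i‖ ^ 2 := by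
    intro u v
    rw [Finset.mul_sum, Finset.mul_sum, ← Finset.sum_add_distrib]
    refine Finset.sum_le_sum fun i _ => ?_
    have h1 : ‖u i‖ ≤ ‖u i - v i‖ + ‖v i‖ := norm_le_norm_sub_add _ _
    rw [Pi.sub_apply]
    nlinarith [sq_nonneg (‖u i - v i‖ - ‖v i‖), norm_nonneg (u i)]
  have h1 := h x.1 p.1
  have h2 := h x.2 p.2
  simp only [pairSq, Prod.fst_sub, Prod.snd_sub]
  linarith

/-- Decay at rate `κ/h` around `p` beats a growth `exp(β|x|²)` around the origin once `κ/h ≥ 2β`,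
the factor two coming from `|x|² ≤ 2|x - p|² + 2|p|²`. -/
lemma norm_cexp_phase_le {s : ℂ} {x p : Pairs N} {δ κ β h : ℝ} (hh : 0 < h) (hβ : 0 < β)
    (hκ : 2 * β * h ≤ κ) (hs : s.re ≤ -δ - κ * pairSq (x - p)) :
    ‖Complex.exp (s / h)‖ ≤
      Real.exp (-δ / h) * Real.exp (2 * β * pairSq p) * Real.exp (-β * pairSq x) := by
  rw [Complex.norm_exp, ← Real.exp_add, ← Real.exp_add, Complex.div_ofReal_re]
  refine Real.exp_le_exp.2 ?_
  have h1 := pairSq_nonneg (x - p)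
  have h2 : s.re / h ≤ -δ / h - 2 * β * pairSq (x - p) := by
    rw [div_le_iff₀ hh, sub_mul, div_mul_cancel₀ _ hh.ne']
    nlinarith
  have h3 := mul_le_mul_of_nonneg_left (pairSq_le x p) hβ.le
  linarith

section Term

variable {Ω : Type*} [TopologicalSpace Ω] [CompactSpace Ω] [MeasurableSpace Ω]
  [OpensMeasurableSpace Ω] {ν : Measure Ω} [IsFiniteMeasure ν]
  {A : Ω → ℂ} (hA : Continuous A) {f : Ω × Pairs N → ℂ} (hf : Continuous f)
  {β : ℝ} (hβ : 0 < β)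
  (hint : Integrable (fun z => ‖f z‖ * Real.exp (-β * pairSq z.2)) (ν.prod volume))
  {S : Pairs N → ℂ} (hS : Continuous S) {p : Pairs N} {δ κ : ℝ}

include hA in
lemma exists_norm_coeff_le : ∃ C, 0 ≤ C ∧ ∀ w, ‖A w‖ ≤ C := by
  obtain ⟨C, hC⟩ := hA.norm.bddAbove_range_of_hasCompactSupport
    (HasCompactSupport.of_compactSpace _)
  exact ⟨max C 0, le_max_right _ _, fun w => (hC ⟨w, rfl⟩).trans (le_max_left _ _)⟩

include hA hf hS in
lemma continuous_term {χ : Pairs N → ℂ} (hχ : Continuous χ) (h : ℝ) :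
    Continuous fun z : Ω × Pairs N =>
      A z.1 * (χ z.2 * f z) * Complex.exp (S z.2 / h) :=
  ((hA.comp continuous_fst).mul ((hχ.comp continuous_snd).mul hf)).mul
    (Complex.continuous_exp.comp ((hS.comp continuous_snd).div_const _))

include hA hf hβ hint hS in
lemma integrable_term {χ : Pairs N → ℂ} (hχ : Continuous χ) (hχ1 : ∀ x, ‖χ x‖ ≤ 1)
    (hre : ∀ x, χ x ≠ 0 → (S x).re ≤ -δ - κ * pairSq (x - p)) {h : ℝ} (hh : 0 < h)
    (hκ : 2 * β * h ≤ κ) {C : ℝ} (hC0 : 0 ≤ C) (hC : ∀ w, ‖A w‖ ≤ C) :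
    Integrable (fun z : Ω × Pairs N => A z.1 * (χ z.2 * f z) * Complex.exp (S z.2 / h))
      (ν.prod volume) ∧
    ‖∫ z : Ω × Pairs N, A z.1 * (χ z.2 * f z) * Complex.exp (S z.2 / h) ∂(ν.prod volume)‖ ≤
      C * Real.exp (2 * β * pairSq p) *
        (∫ z, ‖f z‖ * Real.exp (-β * pairSq z.2) ∂(ν.prod volume)) * Real.exp (-δ / h) := by
  have hb : ∀ z : Ω × Pairs N, ‖A z.1 * (χ z.2 * f z) * Complex.exp (S z.2 / h)‖ ≤
      C * Real.exp (2 * β * pairSq p) * Real.exp (-δ / h) *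
        (‖f z‖ * Real.exp (-β * pairSq z.2)) := by
    intro z
    by_cases hz : χ z.2 = 0
    · simp only [hz, zero_mul, mul_zero, norm_zero]
      positivity
    · rw [norm_mul, norm_mul, norm_mul]
      calc _ ≤ C * (1 * ‖f z‖) * (Real.exp (-δ / h) * Real.exp (2 * β * pairSq p) *
            Real.exp (-β * pairSq z.2)) := by
            gcongr
            · exact hC _
            · exact hχ1 _
            · exact norm_cexp_phase_le hh hβ hκ (hre _ hz)
        _ = _ := by ring
  refine ⟨(hint.const_mul _).mono' (continuous_term hA hf hS hχ h).aestronglyMeasurable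
    (ae_of_all _ hb), ?_⟩
  refine (norm_integral_le_of_norm_le (hint.const_mul _) (ae_of_all _ hb)).trans_eq ?_
  rw [integral_const_mul]
  ring

include hA hf hβ hint hS in
-- The gap `δ` yields `exp(-δ/h)`, which absorbs the prefactor `h^(-2N)`. The phase bound is needed
-- only where `χ ≠ 0`, so this covers both whole terms (`χ = 1`) and tails outside a cutoff.
lemma isRapidlyDecaying_term {χ : Pairs N → ℂ} (hχ : Continuous χ) (hχ1 : ∀ x, ‖χ x‖ ≤ 1)
    (hδ : 0 < δ) (hκ : 0 < κ)
    (hre : ∀ x, χ x ≠ 0 → (S x).re ≤ -δ - κ * pairSq (x - p)) :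
    IsRapidlyDecaying fun h : ℝ => (((Real.pi * h : ℝ) : ℂ) ^ (2 * N))⁻¹ *
      ∫ z : Ω × Pairs N, A z.1 * (χ z.2 * f z) * Complex.exp (S z.2 / h) ∂(ν.prod volume) := by
  intro R
  obtain ⟨C, hC0, hC⟩ := exists_norm_coeff_le hA
  refine IsBigO.trans ?_ (isBigO_exp_neg_div hδ (2 * N) R)
  refine IsBigO.of_bound ((Real.pi ^ (2 * N))⁻¹ * (C * Real.exp (2 * β * pairSq p) *
        (∫ z, ‖f z‖ * Real.exp (-β * pairSq z.2) ∂(ν.prod volume)))) ?_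
  have hpos : 0 < κ / (2 * β) := by positivity
  filter_upwards [Ioo_mem_nhdsGT hpos] with h hh
  have hκ' : 2 * β * h ≤ κ := by
    have := hh.2.le
    rw [le_div_iff₀ (by positivity)] at this
    linarith
  have hh0 : 0 < h := hh.1
  have h1 := (integrable_term hA hf hβ hint hS hχ hχ1 hre hh0 hκ' hC0 hC).2
  rw [norm_mul, norm_inv, norm_pow, Complex.norm_real,
    Real.norm_of_nonneg (by have := Real.pi_pos; positivity), Real.norm_of_nonneg (by positivity),
    mul_pow, mul_inv]
  have := Real.pi_pos
  calc _ ≤ (Real.pi ^ (2 * N))⁻¹ * (h ^ (2 * N))⁻¹ * (C * Real.exp (2 * β * pairSq p) *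
        (∫ z, ‖f z‖ * Real.exp (-β * pairSq z.2) ∂(ν.prod volume)) * Real.exp (-δ / h)) := by
        gcongr
    _ = _ := by ring

end Term

/-! ### Asymptotic expansion of a single term -/

/-- Substituting `x = p + √h y` removes `h` from the homogeneous quadratic exponent. The real
dimension `4N` gives the Jacobian `h^(2N)`, which cancels the normalization of the two Gaussians. -/
lemma integral_mul_cexp_quadExp (m q : Fin N) (F : Pairs N → ℂ) (p : Pairs N) {S : Pairs N → ℂ}
    (hS : ∀ y, S (p + y) = quadExp m q y) {h : ℝ} (hh : 0 < h) :
    ∫ x, F x * Complex.exp (S x / h) = (h : ℂ) ^ (2 * N) * gaussAvg m q F p (√h) := by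
  have hs : 0 < √h := Real.sqrt_pos.2 hh
  rw [← integral_add_left_eq_self _ p]
  have h1 := Measure.integral_comp_smul (volume : Measure (Pairs N))
    (fun y => F (p + y) * Complex.exp (S (p + y) / h)) (√h)
  have h2 : Module.finrank ℝ (Pairs N) = 4 * N := by
    simp [Pairs, Module.finrank_prod, Module.finrank_pi_fintype, Complex.finrank_real_complex]
    ring
  have h3 : (√h) ^ (4 * N) = h ^ (2 * N) := by
    rw [show 4 * N = 2 * (2 * N) by ring, pow_mul, Real.sq_sqrt hh.le]
  have h4 : ∀ y : Pairs N, F (p + √h • y) * Complex.exp (S (p + √h • y) / h) =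
      F (p + √h • y) * quadGauss m q y := by
    intro y
    rw [hS, quadGauss]
    congr 2
    have h5 := quadExp_add_smul m q 0 y (√h)
    have h6 : quadExp m q (0 : Pairs N) = 0 := by simp [quadExp]
    have h7 : quadExpDeriv m q (0 : Pairs N) y = 0 := by simp [quadExpDeriv]
    rw [zero_add, h6, h7, ← Complex.ofReal_pow, Real.sq_sqrt hh.le] at h5
    rw [h5]
    have : (h : ℂ) ≠ 0 := by exact_mod_cast hh.ne'
    field_simp
    ring
  simp only [h4] at h1
  rw [gaussAvg, h1, h2, h3, abs_of_pos (by positivity), Complex.real_smul]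
  have : (h : ℂ) ≠ 0 := by exact_mod_cast hh.ne'
  push_cast
  field_simp

lemma HasAsymptoticExpansion.add_rapidlyDecaying {F G : ℝ → ℂ} {α : ℕ → ℂ}
    (hF : HasAsymptoticExpansion F α) (hG : IsRapidlyDecaying G) :
    HasAsymptoticExpansion (fun h => F h + G h) α := by
  intro R
  refine ((hF R).add (hG R)).congr_left fun h => ?_
  ring

lemma HasAsymptoticExpansion.congr' {F G : ℝ → ℂ} {α : ℕ → ℂ}
    (hF : HasAsymptoticExpansion F α) (h : F =ᶠ[𝓝[>] 0] G) : HasAsymptoticExpansion G α := by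
  intro R
  refine (hF R).congr' ?_ EventuallyEq.rfl
  filter_upwards [h] with x hx
  rw [hx]

section Expansion

variable {Ω : Type*} [TopologicalSpace Ω] [CompactSpace Ω] [MeasurableSpace Ω]
  [OpensMeasurableSpace Ω] {ν : Measure Ω} [IsFiniteMeasure ν]
  [FirstCountableTopology Ω]
  {V : Type*} [NormedAddCommGroup V] [NormedSpace ℂ V] [NormedSpace ℝ V]
  {A : Ω → ℂ} {ι : Ω → V} {F : V × Pairs N → ℂ}

/-- `gaussAvg_expansion` is applied for each parameter and integrated. Compactness of `Ω × K` makes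
the bound `B` uniform; vanishing on neighbourhoods of points off `K` ensures that the derivatives
vanish there too. -/
lemma hasAsymptoticExpansion_near (hA : Continuous A) (hι : Continuous ι) (hF : ContDiff ℝ ∞ F)
    {K : Set (Pairs N)} (hK : IsCompact K)
    (hFK : ∀ a, ∀ x ∉ K, (fun y => F (a, y)) =ᶠ[𝓝 x] fun _ => 0)
    (m q : Fin N) {p : Pairs N} {S : Pairs N → ℂ} (hS : ∀ y, S (p + y) = quadExp m q y) :
    HasAsymptoticExpansion (fun h : ℝ => (((Real.pi * h : ℝ) : ℂ) ^ (2 * N))⁻¹ *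
      ∫ w, A w * (∫ x, F (ι w, x) * Complex.exp (S x / h)) ∂ν)
      (fun r => (r.factorial : ℂ)⁻¹ *
        ∫ w, A w * (mixedOp m q)^[r] (fun x => F (ι w, x)) p ∂ν) := by
  intro R
  obtain ⟨CA, hCA0, hCA⟩ := exists_norm_coeff_le hA
  obtain ⟨C, hC0, hC⟩ := gaussAvg_expansion m q R
  have hpart : ∀ a, ContDiff ℝ ∞ fun y => F (a, y) := fun a =>
    hF.comp (contDiff_const.prodMk contDiff_id)
  have hcs : ∀ a, HasCompactSupport fun y => F (a, y) := fun a =>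
    HasCompactSupport.intro hK fun x hx => (hFK a x hx).self_of_nhds
  have hcontr : ∀ r, Continuous fun z : Ω × Pairs N => (paramOp m q)^[r] F (ι z.1, z.2) :=
    fun r => (continuous_iterate_paramOp m q r hF).comp
      ((hι.comp continuous_fst).prodMk continuous_snd)
  obtain ⟨B, hB⟩ : ∃ B, ∀ w x, ‖(mixedOp m q)^[R] (fun y => F (ι w, y)) x‖ ≤ B := by
    obtain ⟨B, hB⟩ := (isCompact_univ.prod hK).exists_bound_of_continuousOn
      (hcontr R).continuousOn
    refine ⟨max B 0, fun w x => ?_⟩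
    by_cases hx : x ∈ K
    · rw [iterate_mixedOp_partial m q R hF]
      exact (hB (w, x) ⟨Set.mem_univ _, hx⟩).trans (le_max_left _ _)
    · have h1 := (iterate_mixedOp_congr m q R (hFK (ι w) x hx)).self_of_nhds
      rw [h1, iterate_mixedOp_zero]
      simp
  have hmi : ∀ r, Integrable (fun w => A w * (mixedOp m q)^[r] (fun x => F (ι w, x)) p) ν := by
    intro r
    refine integrable_of_continuous_compact (hA.mul ?_)
    simp only [iterate_mixedOp_partial m q r hF]
    exact (hcontr r).comp (continuous_id.prodMk continuous_const)
  have hgi : ∀ t, Integrable (fun w => A w * gaussAvg m q (fun x => F (ι w, x)) p t) ν := by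
    intro t
    refine integrable_of_continuous_compact (hA.mul ?_)
    obtain ⟨B', hB'⟩ : ∃ B', ∀ w x, ‖F (ι w, x)‖ ≤ B' := by
      obtain ⟨B, hB⟩ := (isCompact_univ.prod hK).exists_bound_of_continuousOn
        (hcontr 0).continuousOn
      refine ⟨max B 0, fun w x => ?_⟩
      by_cases hx : x ∈ K
      · exact (hB (w, x) ⟨Set.mem_univ _, hx⟩).trans (le_max_left _ _)
      · have h0 : F (ι w, x) = 0 := (hFK (ι w) x hx).self_of_nhds
        rw [h0]
        simp
    refine continuous_of_dominated (bound := fun y => B' * ‖quadGauss m q y‖) (fun w => ?_)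
      (fun w => ae_of_all _ fun y => ?_) ((integrable_quadGauss m q).norm.const_mul _)
      (ae_of_all _ fun y => ?_)
    · exact (((hpart (ι w)).continuous.comp (continuous_add_smul p t)).mul
        (continuous_quadGauss m q)).aestronglyMeasurable
    · rw [norm_mul]
      exact mul_le_mul_of_nonneg_right (hB' _ _) (norm_nonneg _)
    · exact (hF.continuous.comp (hι.prodMk continuous_const)).mul continuous_const
  have hpi : (Real.pi : ℂ) ≠ 0 := by exact_mod_cast Real.pi_ne_zero
  refine IsBigO.of_bound ((Real.pi ^ (2 * N))⁻¹ * (CA * (C * B)) * ν.real Set.univ) ?_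
  filter_upwards [self_mem_nhdsWithin] with h hh
  have hh : 0 < h := hh
  have hh' : (h : ℂ) ≠ 0 := by exact_mod_cast hh.ne'
  have key : (((Real.pi * h : ℝ) : ℂ) ^ (2 * N))⁻¹ *
      (∫ w, A w * (∫ x, F (ι w, x) * Complex.exp (S x / h)) ∂ν) -
      ∑ r ∈ Finset.range R, (h : ℂ) ^ r * ((r.factorial : ℂ)⁻¹ *
        ∫ w, A w * (mixedOp m q)^[r] (fun x => F (ι w, x)) p ∂ν) =
      ((Real.pi : ℂ) ^ (2 * N))⁻¹ * ∫ w, A w * (gaussAvg m q (fun x => F (ι w, x)) p (√h) -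
        (Real.pi : ℂ) ^ (2 * N) * ∑ r ∈ Finset.range R, ((√h : ℝ) : ℂ) ^ (2 * r) *
        ((r.factorial : ℂ)⁻¹ * (mixedOp m q)^[r] (fun x => F (ι w, x)) p)) ∂ν := by
    have e1 : ∀ w, A w * (gaussAvg m q (fun x => F (ι w, x)) p (√h) -
        (Real.pi : ℂ) ^ (2 * N) * ∑ r ∈ Finset.range R, ((√h : ℝ) : ℂ) ^ (2 * r) *
        ((r.factorial : ℂ)⁻¹ * (mixedOp m q)^[r] (fun x => F (ι w, x)) p)) =
        A w * gaussAvg m q (fun x => F (ι w, x)) p (√h) - ∑ r ∈ Finset.range R,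
          ((Real.pi : ℂ) ^ (2 * N) * ((h : ℂ) ^ r * (r.factorial : ℂ)⁻¹)) *
            (A w * (mixedOp m q)^[r] (fun x => F (ι w, x)) p) := by
      intro w
      rw [mul_sub, Finset.mul_sum, Finset.mul_sum]
      congr 1
      refine Finset.sum_congr rfl fun r _ => ?_
      have e2 : ((√h : ℝ) : ℂ) ^ (2 * r) = (h : ℂ) ^ r := by
        rw [pow_mul, ← Complex.ofReal_pow, Real.sq_sqrt hh.le]
      rw [e2]
      ring
    simp_rw [e1]
    rw [integral_sub (hgi _) (integrable_finsetSum _ fun r _ => (hmi r).const_mul _),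
      integral_finsetSum _ fun r _ => (hmi r).const_mul _]
    simp_rw [integral_const_mul, integral_mul_cexp_quadExp m q _ p hS hh]
    rw [mul_sub, Finset.mul_sum]
    congr 1
    · rw [← integral_const_mul, ← integral_const_mul]
      refine integral_congr_ae (ae_of_all _ fun w => ?_)
      simp only
      push_cast
      rw [mul_pow]
      field_simp
    · refine Finset.sum_congr rfl fun r _ => ?_
      field_simp
  rw [key, norm_mul, norm_inv, norm_pow, Complex.norm_real, Real.norm_of_nonneg Real.pi_pos.le]
  have hbd : ∀ w, ‖A w * (gaussAvg m q (fun x => F (ι w, x)) p (√h) -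
        (Real.pi : ℂ) ^ (2 * N) * ∑ r ∈ Finset.range R, ((√h : ℝ) : ℂ) ^ (2 * r) *
        ((r.factorial : ℂ)⁻¹ * (mixedOp m q)^[r] (fun x => F (ι w, x)) p))‖ ≤
      CA * (C * B * h ^ R) := by
    intro w
    have h1 := hC _ (hpart (ι w)) (hcs (ι w)) B (hB w) p (√h) (Real.sqrt_nonneg h)
    have e3 : (√h) ^ (2 * R) = h ^ R := by rw [pow_mul, Real.sq_sqrt hh.le]
    rw [e3] at h1
    rw [norm_mul]
    exact mul_le_mul (hCA w) h1 (norm_nonneg _) hCA0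
  have h2 := norm_integral_le_of_norm_le_const (μ := ν) (ae_of_all _ hbd)
  rw [Real.norm_of_nonneg (by positivity : 0 ≤ h ^ R)]
  have := Real.pi_pos
  calc _ ≤ (Real.pi ^ (2 * N))⁻¹ * (CA * (C * B * h ^ R) * ν.real Set.univ) := by gcongr
    _ = _ := by ring

/-- A bump around `p` splits the integral into a compactly supported part, which carries the whole
expansion, and a tail which is `O(h^∞)`. -/
lemma hasAsymptoticExpansion_term (hA : Continuous A) (hι : Continuous ι) (hF : ContDiff ℝ ∞ F)
    {β : ℝ} (hβ : 0 < β)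
    (hint : Integrable (fun z : Ω × Pairs N => ‖F (ι z.1, z.2)‖ * Real.exp (-β * pairSq z.2))
      (ν.prod volume))
    (m q : Fin N) {p : Pairs N} {S : Pairs N → ℂ} (hSc : Continuous S)
    (hS : ∀ y, S (p + y) = quadExp m q y) :
    HasAsymptoticExpansion (fun h : ℝ => (((Real.pi * h : ℝ) : ℂ) ^ (2 * N))⁻¹ *
      ∫ z : Ω × Pairs N, A z.1 * F (ι z.1, z.2) * Complex.exp (S z.2 / h) ∂(ν.prod volume))
      (fun r => (r.factorial : ℂ)⁻¹ *
        ∫ w, A w * (mixedOp m q)^[r] (fun x => F (ι w, x)) p ∂ν) := by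
  let η : ContDiffBump p := ⟨1, 2, one_pos, one_lt_two⟩
  have hηs : ContDiff ℝ ∞ fun x => ((η x : ℝ) : ℂ) :=
    Complex.ofRealCLM.contDiff.comp η.contDiff
  set G : V × Pairs N → ℂ := fun z => ((η z.2 : ℝ) : ℂ) * F z with hG
  have hGs : ContDiff ℝ ∞ G := (hηs.comp contDiff_snd).mul hF
  have hfc : Continuous fun z : Ω × Pairs N => F (ι z.1, z.2) :=
    hF.continuous.comp ((hι.comp continuous_fst).prodMk continuous_snd)
  have hre : ∀ x, (S x).re ≤ -(1 / 2) * pairSq (x - p) := by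
    intro x
    have := hS (x - p)
    rw [add_sub_cancel] at this
    rw [this]
    exact re_quadExp_le m q _
  have hη1 : ∀ x, ‖((η x : ℝ) : ℂ)‖ ≤ 1 := by
    intro x
    rw [Complex.norm_real, Real.norm_of_nonneg η.nonneg]
    exact η.le_one
  have hη2 : ∀ x, ‖(1 : ℂ) - ((η x : ℝ) : ℂ)‖ ≤ 1 := by
    intro x
    rw [← Complex.ofReal_one, ← Complex.ofReal_sub, Complex.norm_real,
      Real.norm_of_nonneg (sub_nonneg.2 η.le_one)]
    linarith [η.nonneg (x := x)]
  have hnear := hasAsymptoticExpansion_near (ν := ν) hA hι hGs (isCompact_closedBall p 2)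
    (fun a x hx => by
      have h1 : (Metric.closedBall p 2)ᶜ ∈ 𝓝 x := Metric.isClosed_closedBall.isOpen_compl.mem_nhds hx
      filter_upwards [h1] with y hy
      have h2 : η y = 0 := η.zero_of_le_dist (by
        have := not_le.1 (fun hle => hy (Metric.mem_closedBall.2 hle))
        exact this.le)
      simp [hG, h2]) m q hS
  -- Outside the unit ball `|x - p|² ≥ 1`, so half of the decay `-|x - p|²/2` can be spent on the
  -- gap `1/4`.
  have htail := isRapidlyDecaying_term (ν := ν) (p := p) (δ := 1 / 4) (κ := 1 / 4) hA hfc hβ hint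
    hSc (χ := fun x => (1 : ℂ) - ((η x : ℝ) : ℂ)) (continuous_const.sub hηs.continuous) hη2
    (by norm_num) (by norm_num) (fun x hx => by
      have h1 : 1 ≤ pairSq (x - p) := by
        by_contra hlt
        refine hx ?_
        have h2 : η x = 1 := η.one_of_mem_closedBall (by
          rw [Metric.mem_closedBall, dist_eq_norm]
          have h3 := norm_sq_le_pairSq (x - p)
          show ‖x - p‖ ≤ 1
          nlinarith [norm_nonneg (x - p)])
        simp [h2]
      have := hre x
      linarith)
  have hcoef : ∀ r w, (mixedOp m q)^[r] (fun x => G (ι w, x)) p =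
      (mixedOp m q)^[r] (fun x => F (ι w, x)) p := by
    intro r w
    refine (iterate_mixedOp_congr m q r ?_).self_of_nhds
    filter_upwards [η.eventuallyEq_one] with x hx
    simp [hG, hx]
  simp only [hcoef] at hnear
  refine (hnear.add_rapidlyDecaying htail).congr' ?_
  obtain ⟨C, hC0, hC⟩ := exists_norm_coeff_le hA
  have hpos : 0 < 1 / 4 / (2 * β) := by positivity
  filter_upwards [Ioo_mem_nhdsGT hpos] with h hh
  have hκ' : 2 * β * h ≤ 1 / 4 := by
    have := hh.2.le
    rw [le_div_iff₀ (by positivity)] at this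
    linarith
  have hre' : ∀ x, (S x).re ≤ -0 - 1 / 4 * pairSq (x - p) := fun x => by
    have := hre x
    have := pairSq_nonneg (x - p)
    linarith
  -- Only integrability is needed here, so no gap is required.
  have hI1 := (integrable_term (ν := ν) (p := p) (δ := 0) (κ := 1 / 4) hA hfc hβ hint hSc
    hηs.continuous hη1 (fun x _ => hre' x) hh.1 hκ' hC0 hC).1
  have hχ2 : Continuous fun x : Pairs N => (1 : ℂ) - ((η x : ℝ) : ℂ) :=
    continuous_const.sub hηs.continuous
  have hI2 := (integrable_term (ν := ν) (p := p) (δ := 0) (κ := 1 / 4) hA hfc hβ hint hSc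
    (χ := fun x => (1 : ℂ) - ((η x : ℝ) : ℂ)) hχ2 hη2 (fun x _ => hre' x) hh.1 hκ' hC0 hC).1
  have e1 : ∫ w, A w * (∫ x, G (ι w, x) * Complex.exp (S x / h)) ∂ν =
      ∫ z : Ω × Pairs N, A z.1 * (((η z.2 : ℝ) : ℂ) * F (ι z.1, z.2)) *
        Complex.exp (S z.2 / h) ∂(ν.prod volume) := by
    rw [integral_prod _ hI1]
    refine integral_congr_ae (ae_of_all _ fun w => ?_)
    simp only [hG, ← integral_const_mul]
    refine integral_congr_ae (ae_of_all _ fun x => ?_)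
    simp only
    ring
  rw [e1, ← mul_add, ← integral_add hI1 hI2]
  congr 1
  refine integral_congr_ae (ae_of_all _ fun z => ?_)
  simp only
  ring

end Expansion

end

section

variable {N : ℕ}

/-! ### The phase functions -/

/-- The phase of a term of the double integral for the entry with eigenvalues `z`, `w`. -/
noncomputable def phase (z w : ℂ) (m q L M : Fin N) (x : Pairs N) : ℂ :=
  quadExp m q x + z * conj (x.1 L) + x.2 M * conj w - ((‖z‖ ^ 2 + ‖w‖ ^ 2) / 2 : ℝ)

lemma continuous_phase (z w : ℂ) (m q L M : Fin N) : Continuous (phase z w m q L M) := by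
  have h1 : Continuous (quadExp m q) := (contDiff_quadExp m q).continuous
  have h2 : Continuous fun x : Pairs N => z * conj (x.1 L) :=
    continuous_const.mul (Complex.continuous_conj.comp ((continuous_apply L).comp continuous_fst))
  have h3 : Continuous fun x : Pairs N => x.2 M * conj w :=
    ((continuous_apply M).comp continuous_snd).mul continuous_const
  exact ((h1.add h2).add h3).sub continuous_const

/-- The part of the real part of `phase` that involves one of the two variables. -/
noncomputable def halfPhase (z : ℂ) (m L : Fin N) (d : Fin N → ℂ) : ℝ :=
  -(∑ i, ‖d i‖ ^ 2) + (z * conj (d L)).re + ‖d m‖ ^ 2 / 2 - ‖z‖ ^ 2 / 2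

lemma norm_sub_sq_complex (u v : ℂ) : ‖u - v‖ ^ 2 = ‖u‖ ^ 2 - 2 * (u * conj v).re + ‖v‖ ^ 2 := by
  rw [← Complex.normSq_eq_norm_sq, ← Complex.normSq_eq_norm_sq, ← Complex.normSq_eq_norm_sq,
    Complex.normSq_sub]
  ring

lemma re_mul_conj_comm (u v : ℂ) : (u * conj v).re = (v * conj u).re := by
  simp only [Complex.mul_re, Complex.conj_re, Complex.conj_im]
  ring

/-- Polarization: `Re(d_m ē_q) = (|d_m|² + |e_q|² - |d_m - e_q|²)/2` decouples the two variables up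
to a nonpositive term. -/
lemma re_phase (z w : ℂ) (m q L M : Fin N) (x : Pairs N) :
    (phase z w m q L M x).re =
      halfPhase z m L x.1 + halfPhase w q M x.2 - ‖x.1 m - x.2 q‖ ^ 2 / 2 := by
  simp only [phase, Complex.sub_re, Complex.add_re, re_quadExp, Complex.ofReal_re, halfPhase,
    norm_sub_sq_complex, pairSq, re_mul_conj_comm (x.2 M) w]
  ring

lemma sum_norm_sub_single (d : Fin N → ℂ) (L : Fin N) (v : ℂ) :
    ∑ i, ‖(d - Pi.single L v : Fin N → ℂ) i‖ ^ 2 =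
      (∑ i, ‖d i‖ ^ 2) - 2 * (v * conj (d L)).re + ‖v‖ ^ 2 := by
  have h : ∀ i, ‖(d - Pi.single L v : Fin N → ℂ) i‖ ^ 2 =
      ‖d i‖ ^ 2 + if i = L then - 2 * (v * conj (d L)).re + ‖v‖ ^ 2 else 0 := by
    intro i
    by_cases hi : i = L
    · subst hi
      rw [Pi.sub_apply, Pi.single_eq_same, norm_sub_sq_complex, re_mul_conj_comm]
      simp
      ring
    · simp [hi]
  simp only [h, Finset.sum_add_distrib, Finset.sum_ite_eq', Finset.mem_univ, if_true]
  ring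

lemma halfPhase_le_same {z : ℂ} {m L : Fin N} (h : L = m ∨ z = 0) (d : Fin N → ℂ) :
    halfPhase z m L d ≤ -(1 / 2) * ∑ i, ‖(d - Pi.single m z : Fin N → ℂ) i‖ ^ 2 := by
  have h1 := sq_le_sum_sq d m
  rw [sum_norm_sub_single, halfPhase]
  rcases h with rfl | rfl
  · linarith
  · simp
    linarith

/-- When `L ≠ m`, the relief `|d_m|²/2` does not help the coordinate `L`. There `-|d_L|² + Re(z
d̄_L)` peaks at `d_L = z/2` with value `|z|²/4`, short of the subtracted `|z|²/2` by `|z|²/4`. -/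
lemma halfPhase_le_ne {z : ℂ} {m L : Fin N} (h : L ≠ m) (d : Fin N → ℂ) :
    halfPhase z m L d ≤ -(‖z‖ ^ 2 / 4) - 1 / 2 * ∑ i, ‖(d - Pi.single L (z / 2) : Fin N → ℂ) i‖ ^ 2 := by
  have h1 : ‖d L‖ ^ 2 + ‖d m‖ ^ 2 ≤ ∑ i, ‖d i‖ ^ 2 := by
    rw [← Finset.sum_pair h (f := fun i => ‖d i‖ ^ 2)]
    exact Finset.sum_le_sum_of_subset_of_nonneg (Finset.subset_univ _) fun _ _ _ => by positivity
  have h2 : (z / 2 * conj (d L)).re = (z * conj (d L)).re / 2 := by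
    rw [div_mul_eq_mul_div]
    simp
  have h3 : ‖z / 2‖ ^ 2 = ‖z‖ ^ 2 / 4 := by
    rw [norm_div, div_pow]
    norm_num
  have h4 : (z / 2 * conj (d L)).re ≤ (‖z / 2‖ ^ 2 + ‖d L‖ ^ 2) / 2 := re_mul_conj_le _ _
  rw [sum_norm_sub_single, halfPhase, h2, h3]
  rw [h2, h3] at h4
  linarith

lemma exists_halfPhase_le (z : ℂ) (m L : Fin N) :
    ∃ v : Fin N → ℂ, ∀ d, halfPhase z m L d ≤ -(1 / 2) * ∑ i, ‖(d - v) i‖ ^ 2 := by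
  by_cases h : L = m
  · exact ⟨_, halfPhase_le_same (Or.inl h)⟩
  · refine ⟨Pi.single L (z / 2), fun d => (halfPhase_le_ne h d).trans ?_⟩
    have : 0 ≤ ‖z‖ ^ 2 := by positivity
    linarith

lemma exists_re_phase_le (z w : ℂ) (m q L M : Fin N) :
    ∃ p : Pairs N, ∀ x, (phase z w m q L M x).re ≤ -0 - 1 / 4 * pairSq (x - p) := by
  obtain ⟨v, hv⟩ := exists_halfPhase_le z m L
  obtain ⟨u, hu⟩ := exists_halfPhase_le w q M
  refine ⟨(v, u), fun x => ?_⟩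
  have h1 := hv x.1
  have h2 := hu x.2
  have h3 : 0 ≤ pairSq (x - (v, u)) := pairSq_nonneg _
  have h4 : 0 ≤ ‖x.1 m - x.2 q‖ ^ 2 := by positivity
  rw [re_phase]
  simp only [pairSq, Prod.fst_sub, Prod.snd_sub] at h3 ⊢
  linarith

lemma exists_re_phase_le_neg {z w : ℂ} {m q L M : Fin N}
    (h : (L ≠ m ∧ z ≠ 0) ∨ (M ≠ q ∧ w ≠ 0) ∨ z ≠ w) :
    ∃ (p : Pairs N) (δ : ℝ), 0 < δ ∧
      ∀ x, (phase z w m q L M x).re ≤ -δ - 1 / 4 * pairSq (x - p) := by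
  by_cases hL : L ≠ m ∧ z ≠ 0
  · obtain ⟨u, hu⟩ := exists_halfPhase_le w q M
    have hz : 0 < ‖z‖ := norm_pos_iff.2 hL.2
    refine ⟨(Pi.single L (z / 2), u), ‖z‖ ^ 2 / 4, by positivity, fun x => ?_⟩
    have h1 := halfPhase_le_ne (z := z) hL.1 x.1
    have h2 := hu x.2
    have h3 : 0 ≤ pairSq (x - (Pi.single L (z / 2), u)) := pairSq_nonneg _
    have h4 : 0 ≤ ‖x.1 m - x.2 q‖ ^ 2 := by positivity
    rw [re_phase]
    simp only [pairSq, Prod.fst_sub, Prod.snd_sub] at h3 ⊢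
    linarith
  by_cases hM : M ≠ q ∧ w ≠ 0
  · obtain ⟨u, hu⟩ := exists_halfPhase_le z m L
    have hw : 0 < ‖w‖ := norm_pos_iff.2 hM.2
    refine ⟨(u, Pi.single M (w / 2)), ‖w‖ ^ 2 / 4, by positivity, fun x => ?_⟩
    have h1 := halfPhase_le_ne (z := w) hM.1 x.2
    have h2 := hu x.1
    have h3 : 0 ≤ pairSq (x - (u, Pi.single M (w / 2))) := pairSq_nonneg _
    have h4 : 0 ≤ ‖x.1 m - x.2 q‖ ^ 2 := by positivity
    rw [re_phase]
    simp only [pairSq, Prod.fst_sub, Prod.snd_sub] at h3 ⊢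
    linarith
  have hzw : z ≠ w := by tauto
  have hzw' : 0 < ‖z - w‖ := norm_pos_iff.2 (sub_ne_zero.2 hzw)
  -- Going from `z` through `d_m` and `e_q` to `w`, the three squared steps add up to at least `|z -
  -- w|²/3`; a quarter of that is spent on the gap.
  refine ⟨(Pi.single m z, Pi.single q w), ‖z - w‖ ^ 2 / 12, by positivity, fun x => ?_⟩
  have h1 := halfPhase_le_same (z := z) (m := m) (L := L) (by tauto) x.1
  have h2 := halfPhase_le_same (z := w) (m := q) (L := M) (by tauto) x.2
  have h3 := sq_le_sum_sq (x.1 - Pi.single m z) m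
  have h4 := sq_le_sum_sq (x.2 - Pi.single q w) q
  rw [Pi.sub_apply, Pi.single_eq_same] at h3 h4
  have h5 : ‖z - w‖ ^ 2 ≤ 3 * (‖x.1 m - z‖ ^ 2 + ‖x.2 q - w‖ ^ 2 + ‖x.1 m - x.2 q‖ ^ 2) := by
    have h6 : ‖z - w‖ ≤ ‖x.1 m - z‖ + ‖x.2 q - w‖ + ‖x.1 m - x.2 q‖ := by
      calc ‖z - w‖ = ‖-(x.1 m - z) + (x.2 q - w) + (x.1 m - x.2 q)‖ := by congr 1; ring
        _ ≤ _ := by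
          refine (norm_add_le _ _).trans ?_
          have := norm_add_le (-(x.1 m - z)) (x.2 q - w)
          rw [norm_neg] at this
          linarith
    have h7 : ‖z - w‖ ^ 2 ≤ (‖x.1 m - z‖ + ‖x.2 q - w‖ + ‖x.1 m - x.2 q‖) ^ 2 := by gcongr
    nlinarith [sq_nonneg (‖x.1 m - z‖ - ‖x.2 q - w‖), sq_nonneg (‖x.2 q - w‖ - ‖x.1 m - x.2 q‖),
      sq_nonneg (‖x.1 m - z‖ - ‖x.1 m - x.2 q‖)]
  have h8 : 0 ≤ ‖x.1 m - x.2 q‖ ^ 2 := by positivity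
  rw [re_phase]
  simp only [pairSq, Prod.fst_sub, Prod.snd_sub] at h3 ⊢
  linarith

/-- At this point the phase and its linear part vanish. The phase being quadratic, nothing else
remains and the integral is exactly Gaussian. -/
lemma phase_single_add (z : ℂ) (m q : Fin N) (y : Pairs N) :
    phase z z m q m q ((Pi.single m z, Pi.single q z) + y) = quadExp m q y := by
  have h : ∀ (u : Fin N → ℂ) (i : Fin N),
      ∑ j, ((Pi.single i z : Fin N → ℂ) j + u j) * conj (((Pi.single i z : Fin N → ℂ) j + u j)) =
        (∑ j, u j * conj (u j)) + z * conj (u i) + u i * conj z + z * conj z := by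
    intro u i
    have h1 : ∀ j, ((Pi.single i z : Fin N → ℂ) j + u j) * conj (((Pi.single i z : Fin N → ℂ) j + u j)) =
        u j * conj (u j) + if j = i then z * conj (u i) + u i * conj z + z * conj z else 0 := by
      intro j
      by_cases hj : j = i
      · subst hj
        simp
        ring
      · simp [hj]
    simp only [h1, Finset.sum_add_distrib, Finset.sum_ite_eq', Finset.mem_univ, if_true]
    ring
  have hz : (((‖z‖ ^ 2 + ‖z‖ ^ 2) / 2 : ℝ) : ℂ) = z * conj z := by
    rw [Complex.mul_conj']
    push_cast
    ring
  simp only [phase, quadExp, Prod.fst_add, Prod.snd_add, hz, Pi.add_apply]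
  rw [h, h]
  simp only [Pi.single_eq_same, map_add]
  ring

lemma phase_zero (m q L M : Fin N) : phase 0 0 m q L M = quadExp m q := by
  funext x
  simp [phase]

/-! ### The inverse square root of a diagonal matrix -/

lemma aeval_diagonal (p : Polynomial ℝ) (x : Fin N → ℝ) :
    Polynomial.aeval (Matrix.diagonal fun i => ((x i : ℝ) : ℂ) : Mat N) p =
      Matrix.diagonal fun i => ((p.eval (x i) : ℝ) : ℂ) := by
  induction p using Polynomial.induction_on' with
  | add p q hp hq => simp [hp, hq]
  | monomial n a =>
    rw [Polynomial.aeval_monomial, Matrix.diagonal_pow, Algebra.algebraMap_eq_smul_one,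
      smul_mul_assoc, one_mul]
    ext i j
    by_cases hij : i = j
    · subst hij
      simp
    · simp [hij]

lemma cfc_diagonal (f : ℝ → ℝ) (x : Fin N → ℝ) :
    cfc f (Matrix.diagonal fun i => ((x i : ℝ) : ℂ) : Mat N) =
      Matrix.diagonal fun i => ((f (x i) : ℝ) : ℂ) := by
  set A : Mat N := Matrix.diagonal fun i => ((x i : ℝ) : ℂ) with hA
  -- A polynomial interpolating `f` on both the spectrum and the diagonal entries represents `cfc f
  -- A`, and the two sets never have to be compared.
  have hfin : (spectrum ℝ A ∪ Set.range x).Finite :=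
    Matrix.finite_real_spectrum.union (Set.finite_range x)
  have hp : ∀ t ∈ hfin.toFinset, (Lagrange.interpolate hfin.toFinset id f).eval t = f t :=
    fun t ht => Lagrange.eval_interpolate_at_node f (Set.injOn_id _) ht
  have hsa : IsSelfAdjoint A := by
    rw [IsSelfAdjoint, Matrix.star_eq_conjTranspose, hA, Matrix.diagonal_conjTranspose]
    congr 1
    funext i
    simp
  have h1 : cfc f A = cfc (Lagrange.interpolate hfin.toFinset id f).eval A :=
    cfc_congr fun t ht => (hp t (hfin.mem_toFinset.2 (Or.inl ht))).symm
  refine h1.trans ((cfc_polynomial _ A hsa).trans ((aeval_diagonal _ x).trans ?_))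
  congr 1
  funext i
  rw [hp _ (hfin.mem_toFinset.2 (Or.inr ⟨i, rfl⟩))]

lemma berezin_diagonal {h : ℝ} (hh : 0 < h)
    (T : (Mat N → (Fin N → ℂ)) → (Mat N → (Fin N → ℂ))) (c : Fin N → ℂ) (a b : Fin N) :
    berezin h T (Matrix.diagonal c) a b =
      ((Real.exp (-((‖c a‖ ^ 2 + ‖c b‖ ^ 2) / 2 / h)) : ℝ) : ℂ) *
        innerL2 h (T (kernelFun h (Matrix.diagonal c) (Pi.single b 1)))
          (kernelFun h (Matrix.diagonal c) (Pi.single a 1)) := by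
  have hs : ∀ t : ℝ, (√(Real.exp t))⁻¹ = Real.exp (-(t / 2)) := fun t => by
    rw [Real.exp_neg, Real.exp_half]
  rw [berezin, invSqrt, kernel_diagonal hh, cfc_diagonal, Matrix.mul_diagonal,
    Matrix.diagonal_mul, hs, hs, preBerezin, Matrix.of_apply, mul_right_comm,
    ← Complex.ofReal_mul, ← Real.exp_add]
  congr 4
  ring

end

section

variable {N : ℕ}

/-! ### Products of Toeplitz operators applied to kernel functions -/

/-- `φ` is integrable against `exp (-β |Y|²)`. -/
def HasGaussianRate (β : ℝ) (φ : Mat N → Mat N) : Prop :=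
  Integrable (fun Y => Real.exp (-β * nsq Y) * ‖φ Y‖) (flatMeasure N)

lemma norm_le_sum_entries (A : Mat N) : ‖A‖ ≤ ∑ i, ∑ j, ‖A i j‖ := by
  refine (Matrix.norm_le_iff (Finset.sum_nonneg fun _ _ => Finset.sum_nonneg fun _ _ =>
    norm_nonneg _)).2 fun i j => ?_
  calc ‖A i j‖ ≤ ∑ j, ‖A i j‖ :=
        Finset.single_le_sum (f := fun j => ‖A i j‖) (fun _ _ => norm_nonneg _) (Finset.mem_univ j)
    _ ≤ _ := Finset.single_le_sum (f := fun i => ∑ j, ‖A i j‖)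
        (fun _ _ => Finset.sum_nonneg fun _ _ => norm_nonneg _) (Finset.mem_univ i)

/-- Used to give both symbols a common rate. -/
lemma HasGaussianRate.mono {β β' : ℝ} (hβ : β ≤ β') {φ : Mat N → Mat N} (hc : Continuous φ)
    (hφ : HasGaussianRate β φ) : HasGaussianRate β' φ := by
  refine Integrable.mono' hφ (Continuous.aestronglyMeasurable ?_) (ae_of_all _ fun Y => ?_)
  · exact (Real.continuous_exp.comp (continuous_const.mul continuous_nsq)).mul hc.norm
  · rw [Real.norm_of_nonneg (by positivity)]
    have := nsq_nonneg Y
    gcongr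

lemma exists_hasGaussianRate {φ : Mat N → Mat N} (hc : Continuous φ) (hφ : GaussianIntegrable φ) :
    ∃ β, 0 < β ∧ HasGaussianRate β φ := by
  obtain ⟨h, hh, hint⟩ := hφ
  refine ⟨1 / h, by positivity, ?_⟩
  have h1 : Integrable (fun Y => ∑ i, ∑ j, (Real.pi * h) ^ N * ‖weight h Y • φ Y i j‖)
      (flatMeasure N) := integrable_finsetSum _ fun i _ => integrable_finsetSum _ fun j _ =>
    (((integrable_normalMeasure_iff hh _).1 (hint i j)).norm).const_mul _
  refine h1.mono' (Continuous.aestronglyMeasurable ?_) (ae_of_all _ fun Y => ?_)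
  · exact (Real.continuous_exp.comp (continuous_const.mul continuous_nsq)).mul hc.norm
  · have hp : (Real.pi * h) ^ N ≠ 0 := by
      have := Real.pi_pos
      positivity
    have h2 : ∀ i j, (Real.pi * h) ^ N * ‖weight h Y • φ Y i j‖ =
        Real.exp (-(1 / h) * nsq Y) * ‖φ Y i j‖ := by
      intro i j
      rw [norm_smul, Real.norm_of_nonneg (weight_pos hh Y).le, weight, ← mul_assoc,
        mul_inv_cancel_left₀ hp]
      congr 2
      ring
    rw [Real.norm_of_nonneg (by positivity)]
    simp only [h2, ← Finset.mul_sum]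
    gcongr
    exact norm_le_sum_entries _

/-- A budget: the rate `1/h` of the weight must pay for the growth `γ/h` of `F`, the rate `β` of the
symbol and the required margin `a/h`. -/
lemma integrable_exp_nsq_mul_norm_mulVec {h a β γ C : ℝ} (hh : 0 < h) {φ : Mat N → Mat N}
    (hc : Continuous φ) (hφ : HasGaussianRate β φ) {F : Mat N → Fin N → ℂ} (hF : Continuous F)
    (hC : 0 ≤ C) (hb : ∀ Y, ‖F Y‖ ≤ C * Real.exp (γ / h * nsq Y)) (hle : γ + β * h + a ≤ 1) :
    Integrable (fun Y => Real.exp (a / h * nsq Y) * ‖φ Y *ᵥ F Y‖) (normalMeasure N h) := by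
  refine integrable_exp_nsq_mul_norm hh ?_
  refine (Integrable.const_mul hφ (N * C)).mono' (Continuous.aestronglyMeasurable ?_)
    (ae_of_all _ fun Y => ?_)
  · exact (Real.continuous_exp.comp (continuous_const.mul continuous_nsq)).mul
      (hc.matrix_mulVec hF).norm
  · rw [Real.norm_of_nonneg (by positivity)]
    have h1 : ‖φ Y *ᵥ F Y‖ ≤ N * ‖φ Y‖ * (C * Real.exp (γ / h * nsq Y)) :=
      (norm_mulVec_le _ _).trans (by gcongr; exact hb Y)
    have h2 : Real.exp (-((1 - a) / h) * nsq Y) * Real.exp (γ / h * nsq Y) ≤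
        Real.exp (-β * nsq Y) := by
      rw [← Real.exp_add, ← add_mul]
      refine Real.exp_le_exp.2 (mul_le_mul_of_nonneg_right ?_ (nsq_nonneg Y))
      have h3 : -((1 - a) / h) + γ / h = (γ + a - 1) / h := by ring
      rw [h3, div_le_iff₀ hh]
      linarith
    calc _ ≤ Real.exp (-((1 - a) / h) * nsq Y) *
          (N * ‖φ Y‖ * (C * Real.exp (γ / h * nsq Y))) := by gcongr
      _ = N * C * (Real.exp (-((1 - a) / h) * nsq Y) * Real.exp (γ / h * nsq Y) * ‖φ Y‖) := by
        ring
      _ ≤ _ := by gcongr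

lemma norm_kernelFun_le {h a : ℝ} (hh : 0 < h) (ha : 0 < a) (X : Mat N) (χ : Fin N → ℂ)
    (Y : Mat N) : ‖kernelFun h X χ Y‖ ≤
      N * N * ‖χ‖ * Real.exp (1 / (4 * a * h) * frob X ^ 2) * Real.exp (a / h * nsq Y) := by
  refine (norm_mulVec_le _ _).trans ?_
  have h1 := norm_kernel_le hh Y X
  have h2 := exp_mul_div_le hh ha (frob X) Y
  rw [mul_comm (frob Y)] at h1
  calc _ ≤ N * (N * (Real.exp (1 / (4 * a * h) * frob X ^ 2) * Real.exp (a / h * nsq Y))) *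
        ‖χ‖ := by
        gcongr
        exact h1.trans (by gcongr)
    _ = _ := by ring

lemma continuous_kernel_right {h : ℝ} (hh : 0 < h) (X : Mat N) :
    Continuous fun Y : Mat N => kernel h X Y :=
  ((continuous_kernel hh).comp (Continuous.prodMk_right X)).congr fun _ => rfl

lemma integrable_mulVec (A : Mat N) {μ : Measure (Mat N)} {F : Mat N → Fin N → ℂ}
    (hF : Integrable F μ) : Integrable (fun Y => A *ᵥ F Y) μ :=
  (Matrix.mulVecLin A).toContinuousLinearMap.integrable_comp hF

section Toeplitz

variable {φ ψ : Mat N → Mat N} (hφc : Continuous φ) (hψc : Continuous ψ) {β h : ℝ} (hh : 0 < h)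
  (hβh : 16 * β * h ≤ 1)

lemma toeplitz_eq_proj (h : ℝ) (φ : Mat N → Mat N) (f : Mat N → Fin N → ℂ) :
    toeplitz h φ f = proj h fun Y => φ Y *ᵥ f Y := rfl

include hψc hh hβh in
lemma integrable_toeplitz_kernelFun (hψ : HasGaussianRate β ψ) (X : Mat N) (χ : Fin N → ℂ) :
    Integrable (fun Y => Real.exp (4 / 5 / h * nsq Y) * ‖ψ Y *ᵥ kernelFun h X χ Y‖)
      (normalMeasure N h) :=
  integrable_exp_nsq_mul_norm_mulVec hh hψc hψ (continuous_kernelFun hh X χ)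
    (C := N * N * ‖χ‖ * Real.exp (1 / (4 * (1 / 10) * h) * frob X ^ 2)) (by positivity)
    -- The budget is `1/10 + βh + 4/5` with `βh ≤ 1/16`, below one.
    (norm_kernelFun_le hh (by norm_num) X χ) (by linarith)

include hψc hh in
lemma continuous_mulVec_kernelFun (X : Mat N) (χ : Fin N → ℂ) :
    Continuous fun Y => ψ Y *ᵥ kernelFun h X χ Y :=
  hψc.matrix_mulVec (continuous_kernelFun hh X χ)

include hψc hh hβh in
lemma continuous_toeplitz_kernelFun (hψ : HasGaussianRate β ψ) (X : Mat N) (χ : Fin N → ℂ) :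
    Continuous (toeplitz h ψ (kernelFun h X χ)) :=
  continuous_proj hh (a := 4 / 5) (by norm_num) (continuous_mulVec_kernelFun hψc hh X χ)
    (integrable_toeplitz_kernelFun hψc hh hβh hψ X χ)

include hφc hψc hh hβh in
lemma integrable_toeplitz_toeplitz (hφ : HasGaussianRate β φ) (hψ : HasGaussianRate β ψ)
    (X : Mat N) (χ : Fin N → ℂ) :
    Integrable (fun Y => Real.exp (5 / 8 / h * nsq Y) *
      ‖φ Y *ᵥ toeplitz h ψ (kernelFun h X χ) Y‖) (normalMeasure N h) := by
  obtain ⟨C, hC0, hC⟩ := exists_norm_proj_le hh (a := 4 / 5) (by norm_num)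
    (continuous_mulVec_kernelFun hψc hh X χ) (integrable_toeplitz_kernelFun hψc hh hβh hψ X χ)
  -- The first operator, with margin `4/5`, produces growth `1/(4 · 4/5) = 5/16`. The second budget
  -- is then exhausted: `5/16 + 1/16 + 5/8 = 1`, and the margin `5/8` still exceeds `1/2`.
  refine integrable_exp_nsq_mul_norm_mulVec hh hφc hφ (γ := 5 / 16)
    (continuous_toeplitz_kernelFun hψc hh hβh hψ X χ) hC0 (fun Y => ?_) (by linarith)
  have h1 : (1 / (4 * (4 / 5) * h) : ℝ) = 5 / 16 / h := by field_simp; norm_num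
  rw [← h1]
  exact hC Y

include hφc hψc hh hβh in
lemma toeplitzDefined_kernelFun (hφ : HasGaussianRate β φ) (hψ : HasGaussianRate β ψ)
    (X : Mat N) (χ : Fin N → ℂ) :
    ToeplitzDefined h ψ (kernelFun h X χ) ∧
      ToeplitzDefined h φ (toeplitz h ψ (kernelFun h X χ)) := by
  have hc1 := continuous_mulVec_kernelFun hψc hh X χ
  have hi1 := integrable_toeplitz_kernelFun hψc hh hβh hψ X χ
  have hc2 := hφc.matrix_mulVec (continuous_toeplitz_kernelFun hψc hh hβh hψ X χ)
  have hi2 := integrable_toeplitz_toeplitz hφc hψc hh hβh hφ hψ X χ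
  have hm := memH_proj hh (a := 4 / 5) (by norm_num) hc1 hi1 (by norm_num)
  exact ⟨⟨memH_kernelFun hh X χ,
    fun Z _ => integrable_kernel_mulVec hh (by norm_num) hc1 hi1 Z, hm⟩,
    ⟨hm, fun Z _ => integrable_kernel_mulVec hh (by norm_num) hc2 hi2 Z,
      memH_proj hh (by norm_num) hc2 hi2 (by norm_num)⟩⟩

/-- The integrand of the double integral for an entry of the product of two Toeplitz operators. -/
noncomputable def sandwich (h : ℝ) (φ ψ : Mat N → Mat N) (X Y Z : Mat N) : Mat N :=
  kernel h X Y * (φ Y * (kernel h Y Z * (ψ Z * kernel h Z X)))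

lemma sandwich_apply (h : ℝ) (φ ψ : Mat N → Mat N) (X Y Z : Mat N) (a b : Fin N) :
    (kernel h X Y *ᵥ (φ Y *ᵥ (kernel h Y Z *ᵥ (ψ Z *ᵥ kernelFun h X (Pi.single b 1) Z)))) a =
      sandwich h φ ψ X Y Z a b := by
  simp only [kernelFun, Matrix.mulVec_mulVec, Matrix.mulVec_single_one, sandwich,
    ← Matrix.mul_assoc]
  rfl

include hh in
lemma mulVec_proj_apply {a : ℝ} (ha : 0 < a) {F : Mat N → Fin N → ℂ} (hc : Continuous F)
    (hF : Integrable (fun Y => Real.exp (a / h * nsq Y) * ‖F Y‖) (normalMeasure N h))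
    (A X : Mat N) (i : Fin N) : (A *ᵥ proj h F X) i =
      ∫ x : UN N × (Fin N → ℂ), (weight h (spectralPoint x.1 x.2) : ℂ) *
        (A *ᵥ (kernel h X (spectralPoint x.1 x.2) *ᵥ F (spectralPoint x.1 x.2))) i
        ∂(paramMeasure N) := by
  have hint := integrable_kernel_mulVec hh ha hc hF X
  have hint' : Integrable (fun Y => A *ᵥ (kernel h X Y *ᵥ F Y)) (normalMeasure N h) :=
    integrable_mulVec A hint
  have hcont : Continuous fun Y => weight h Y • (A *ᵥ (kernel h X Y *ᵥ F Y)) i :=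
    (continuous_weight h).smul ((continuous_apply i).comp
      (continuous_const.matrix_mulVec ((continuous_kernel_right hh X).matrix_mulVec hc)))
  rw [proj, mulVec_integral _ hint, integral_pi_apply hint', integral_normalMeasure hh,
    integral_flatMeasure hcont.aestronglyMeasurable]
  simp only [Complex.real_smul]

include hφc hψc hh hβh in
lemma innerL2_toeplitz_toeplitz (hφ : HasGaussianRate β φ) (hψ : HasGaussianRate β ψ)
    (c : Fin N → ℂ) (a b : Fin N) :
    innerL2 h (toeplitz h φ (toeplitz h ψ (kernelFun h (Matrix.diagonal c) (Pi.single b 1))))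
      (kernelFun h (Matrix.diagonal c) (Pi.single a 1)) =
      ∫ x : UN N × (Fin N → ℂ), (∫ y : UN N × (Fin N → ℂ),
        (weight h (spectralPoint x.1 x.2) : ℂ) * ((weight h (spectralPoint y.1 y.2) : ℂ) *
          sandwich h φ ψ (Matrix.diagonal c) (spectralPoint x.1 x.2) (spectralPoint y.1 y.2) a b)
        ∂(paramMeasure N)) ∂(paramMeasure N) := by
  have hc1 := continuous_mulVec_kernelFun hψc hh (Matrix.diagonal c) (Pi.single b 1)
  have hi1 := integrable_toeplitz_kernelFun hψc hh hβh hψ (Matrix.diagonal c) (Pi.single b 1)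
  have hc2 := hφc.matrix_mulVec
    (continuous_toeplitz_kernelFun hψc hh hβh hψ (Matrix.diagonal c) (Pi.single b 1))
  have hi2 := integrable_toeplitz_toeplitz hφc hψc hh hβh hφ hψ (Matrix.diagonal c)
    (Pi.single b 1)
  rw [toeplitz_eq_proj h φ, innerL2_kernelFun hh (a := 5 / 8) (by norm_num) hc2 hi2,
    ← Matrix.one_mulVec (proj h _ _), mulVec_proj_apply hh (by norm_num) hc2 hi2]
  refine integral_congr_ae (ae_of_all _ fun x => ?_)
  simp only [Matrix.one_mulVec]
  rw [integral_const_mul, toeplitz_eq_proj h ψ, Matrix.mulVec_mulVec,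
    mulVec_proj_apply hh (by norm_num) hc1 hi1]
  simp only [← Matrix.mulVec_mulVec, sandwich_apply]

end Toeplitz

end

section

variable {N : ℕ}

/-! ### The terms of the double integral -/

/-- The monomial in the entries of the two unitary matrices that occurs in a term. -/
noncomputable def termCoeff (a b i j k l m p q L M : Fin N) (w : UN N × UN N) : ℂ :=
  w.1.1 a L * conj (w.1.1 i L) * w.1.1 j m * conj (w.1.1 p m) * w.2.1 p q * conj (w.2.1 k q) *
    w.2.1 l M * conj (w.2.1 b M)

/-- The matrices underlying a pair of unitary matrices. -/
def unitaryPair (w : UN N × UN N) : Mat N × Mat N := (w.1, w.2)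

/-- The product of entries of the two symbols, with arbitrary matrices in place of unitary ones. -/
noncomputable def symbolProd (φ ψ : Mat N → Mat N) (i j k l : Fin N)
    (z : (Mat N × Mat N) × Pairs N) : ℂ :=
  φ (z.1.1 * Matrix.diagonal z.2.1 * z.1.1ᴴ) i j * ψ (z.1.2 * Matrix.diagonal z.2.2 * z.1.2ᴴ) k l

/-- The measure `dU dW dd de`. -/
noncomputable abbrev doubleMeasure (N : ℕ) : Measure ((UN N × UN N) × Pairs N) :=
  ((haarUN N).prod (haarUN N)).prod volume

/-- A term of the double integral for an entry of the Berezin transform. -/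
noncomputable def termIntegral (φ ψ : Mat N → Mat N) (c : Fin N → ℂ)
    (a b i j k l m p q L M : Fin N) (h : ℝ) : ℂ :=
  (((Real.pi * h : ℝ) : ℂ) ^ (2 * N))⁻¹ * ∫ z : (UN N × UN N) × Pairs N,
    termCoeff a b i j k l m p q L M z.1 * symbolProd φ ψ i j k l (unitaryPair z.1, z.2) *
      Complex.exp (phase (c a) (c b) m q L M z.2 / h) ∂(doubleMeasure N)

lemma continuous_termCoeff (a b i j k l m p q L M : Fin N) :
    Continuous (termCoeff a b i j k l m p q L M) := by
  have h1 : ∀ s t : Fin N, Continuous fun w : UN N × UN N => w.1.1 s t := fun s t =>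
    (continuous_UN_entry s t).comp continuous_fst
  have h2 : ∀ s t : Fin N, Continuous fun w : UN N × UN N => w.2.1 s t := fun s t =>
    (continuous_UN_entry s t).comp continuous_snd
  have h3 : ∀ {f : UN N × UN N → ℂ}, Continuous f → Continuous fun w => conj (f w) := fun hf =>
    Complex.continuous_conj.comp hf
  exact (((((((h1 _ _).mul (h3 (h1 _ _))).mul (h1 _ _)).mul (h3 (h1 _ _))).mul (h2 _ _)).mul
    (h3 (h2 _ _))).mul (h2 _ _)).mul (h3 (h2 _ _))

lemma continuous_unitaryPair : Continuous (unitaryPair : UN N × UN N → Mat N × Mat N) :=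
  (continuous_subtype_val.comp continuous_fst).prodMk (continuous_subtype_val.comp continuous_snd)

lemma contDiff_mat {E : Type*} [NormedAddCommGroup E] [NormedSpace ℝ E] {f : E → Mat N}
    (hf : ∀ i j, ContDiff ℝ ∞ fun x => f x i j) : ContDiff ℝ ∞ f :=
  contDiff_pi.2 fun i => contDiff_pi.2 fun j => hf i j

lemma contDiff_entry {E : Type*} [NormedAddCommGroup E] [NormedSpace ℝ E] {f : E → Mat N}
    (hf : ContDiff ℝ ∞ f) (i j : Fin N) : ContDiff ℝ ∞ fun x => f x i j :=
  contDiff_pi.1 (contDiff_pi.1 hf i) j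

lemma contDiff_conj_diagonal :
    ContDiff ℝ ∞ fun z : Mat N × (Fin N → ℂ) => z.1 * Matrix.diagonal z.2 * z.1ᴴ := by
  refine contDiff_mat fun i j => ?_
  have h1 : ∀ s t, ContDiff ℝ ∞ fun z : Mat N × (Fin N → ℂ) => z.1 s t := fun s t =>
    contDiff_entry contDiff_fst s t
  have h2 : ∀ s, ContDiff ℝ ∞ fun z : Mat N × (Fin N → ℂ) => z.2 s := fun s =>
    contDiff_pi.1 contDiff_snd s
  have h3 : ∀ s t, ContDiff ℝ ∞ fun z : Mat N × (Fin N → ℂ) => conj (z.1 s t) := fun s t =>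
    Complex.conjCLE.contDiff.comp (h1 s t)
  have h4 : (fun z : Mat N × (Fin N → ℂ) => (z.1 * Matrix.diagonal z.2 * z.1ᴴ) i j) =
      fun z => ∑ m, z.1 i m * z.2 m * conj (z.1 j m) := by
    funext z
    rw [Matrix.mul_apply]
    simp only [Matrix.mul_diagonal, Matrix.conjTranspose_apply, Complex.star_def]
  rw [h4]
  exact ContDiff.sum fun m _ => ((h1 _ _).mul (h2 _)).mul (h3 _ _)

lemma contDiff_symbolProd {φ ψ : Mat N → Mat N} (hφ : ContDiff ℝ ∞ φ) (hψ : ContDiff ℝ ∞ ψ)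
    (i j k l : Fin N) : ContDiff ℝ ∞ (symbolProd φ ψ i j k l) := by
  have h1 : ContDiff ℝ ∞ fun z : (Mat N × Mat N) × Pairs N =>
      ((z.1.1, z.2.1) : Mat N × (Fin N → ℂ)) :=
    (contDiff_fst.comp contDiff_fst).prodMk (contDiff_fst.comp contDiff_snd)
  have h2 : ContDiff ℝ ∞ fun z : (Mat N × Mat N) × Pairs N =>
      ((z.1.2, z.2.2) : Mat N × (Fin N → ℂ)) :=
    (contDiff_snd.comp contDiff_fst).prodMk (contDiff_snd.comp contDiff_snd)
  exact (contDiff_entry (hφ.comp (contDiff_conj_diagonal.comp h1)) i j).mul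
    (contDiff_entry (hψ.comp (contDiff_conj_diagonal.comp h2)) k l)

/-! ### Reordering the variables of integration -/

lemma measurePreserving_prodProdProdComm {α β γ δ : Type*} [MeasurableSpace α]
    [MeasurableSpace β] [MeasurableSpace γ] [MeasurableSpace δ] (μ₁ : Measure α) (μ₂ : Measure β)
    (μ₃ : Measure γ) (μ₄ : Measure δ) [SFinite μ₁] [SFinite μ₂] [SFinite μ₃] [SFinite μ₄] :
    MeasurePreserving (fun z : (α × β) × γ × δ => ((z.1.1, z.2.1), (z.1.2, z.2.2)))
      ((μ₁.prod μ₂).prod (μ₃.prod μ₄)) ((μ₁.prod μ₃).prod (μ₂.prod μ₄)) := by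
  have hm : Measurable fun z : (α × β) × γ × δ => ((z.1.1, z.2.1), (z.1.2, z.2.2)) := by fun_prop
  refine ⟨hm, Measure.ext_of_lintegral _ fun f hf => ?_⟩
  have hf' : Measurable fun z : (α × β) × γ × δ => f ((z.1.1, z.2.1), (z.1.2, z.2.2)) := hf.comp hm
  rw [lintegral_map hf hm, lintegral_prod _ hf'.aemeasurable,
    lintegral_prod _ hf.aemeasurable,
    lintegral_prod _ (Measurable.lintegral_prod_right' hf').aemeasurable,
    lintegral_prod _ (Measurable.lintegral_prod_right' hf).aemeasurable]
  refine lintegral_congr fun x => ?_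
  have h1 : ∀ y, ∫⁻ z : γ × δ, f ((x, z.1), (y, z.2)) ∂(μ₃.prod μ₄) =
      ∫⁻ u, ∫⁻ v, f ((x, u), (y, v)) ∂μ₄ ∂μ₃ := fun y =>
    lintegral_prod _ (hf.comp (by fun_prop)).aemeasurable
  have h2 : ∀ u, ∫⁻ z : β × δ, f ((x, u), z) ∂(μ₂.prod μ₄) =
      ∫⁻ y, ∫⁻ v, f ((x, u), (y, v)) ∂μ₄ ∂μ₂ := fun u =>
    lintegral_prod _ (hf.comp (by fun_prop)).aemeasurable
  have h3 : Measurable fun t : (β × γ) × δ => f ((x, t.1.2), (t.1.1, t.2)) :=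
    hf.comp (by fun_prop)
  simp only [h1, h2]
  exact lintegral_lintegral_swap (Measurable.lintegral_prod_right' h3).aemeasurable

/-- The exchange of the two inner variables. -/
def doubleEquiv (N : ℕ) :
    (UN N × UN N) × Pairs N ≃ᵐ (UN N × (Fin N → ℂ)) × (UN N × (Fin N → ℂ)) where
  toEquiv := Equiv.prodProdProdComm _ _ _ _
  measurable_toFun := by
    show Measurable fun z : (UN N × UN N) × Pairs N => ((z.1.1, z.2.1), (z.1.2, z.2.2))
    fun_prop
  measurable_invFun := by
    show Measurable fun z : (UN N × (Fin N → ℂ)) × (UN N × (Fin N → ℂ)) =>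
      (((z.1.1, z.2.1), (z.1.2, z.2.2)) : (UN N × UN N) × Pairs N)
    fun_prop

lemma measurePreserving_doubleEquiv :
    MeasurePreserving (doubleEquiv N) (doubleMeasure N) ((paramMeasure N).prod (paramMeasure N)) :=
  measurePreserving_prodProdProdComm _ _ _ _

lemma integral_integral_param {f : (UN N × (Fin N → ℂ)) × (UN N × (Fin N → ℂ)) → ℂ}
    (hf : Integrable (fun z => f (doubleEquiv N z)) (doubleMeasure N)) :
    ∫ x, (∫ y, f (x, y) ∂(paramMeasure N)) ∂(paramMeasure N) =
      ∫ z, f (doubleEquiv N z) ∂(doubleMeasure N) := by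
  rw [(measurePreserving_doubleEquiv (N := N)).integral_comp', integral_prod]
  exact ((measurePreserving_doubleEquiv (N := N)).integrable_comp_emb
    (doubleEquiv N).measurableEmbedding).1 hf

/-! ### Asymptotics of the terms -/

section Terms

variable {φ ψ : Mat N → Mat N}

lemma HasGaussianRate.integrable_entry {β : ℝ} (hc : Continuous φ) (hφ : HasGaussianRate β φ)
    (i j : Fin N) : Integrable (fun x : UN N × (Fin N → ℂ) =>
      ‖φ (spectralPoint x.1 x.2) i j‖ * Real.exp (-β * ∑ i, ‖x.2 i‖ ^ 2)) (paramMeasure N) := by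
  have h1 := hφ.comp_measurable measurable_spectralPoint
  refine h1.mono' (Continuous.aestronglyMeasurable ?_) (ae_of_all _ fun x => ?_)
  · refine (((continuous_entry i j).comp (hc.comp continuous_spectralPoint)).norm).mul ?_
    fun_prop
  · rw [Real.norm_of_nonneg (by positivity), mul_comm]
    simp only [Function.comp, nsq_spectralPoint]
    gcongr
    exact Matrix.norm_entry_le_entrywise_sup_norm _

lemma integrable_symbolProd {β : ℝ} (hφc : Continuous φ) (hψc : Continuous ψ)
    (hφ : HasGaussianRate β φ) (hψ : HasGaussianRate β ψ) (i j k l : Fin N) :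
    Integrable (fun z : (UN N × UN N) × Pairs N =>
      ‖symbolProd φ ψ i j k l (unitaryPair z.1, z.2)‖ * Real.exp (-β * pairSq z.2))
      (doubleMeasure N) := by
  have h1 := (measurePreserving_doubleEquiv (N := N)).integrable_comp_of_integrable
    ((hφ.integrable_entry hφc i j).mul_prod (hψ.integrable_entry hψc k l))
  refine h1.congr (ae_of_all _ fun z => ?_)
  have h2 : Real.exp (-β * pairSq z.2) = Real.exp (-β * ∑ i, ‖z.2.1 i‖ ^ 2) *
      Real.exp (-β * ∑ i, ‖z.2.2 i‖ ^ 2) := by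
    rw [← Real.exp_add, pairSq, mul_add]
  simp only [h2, symbolProd, norm_mul]
  exact mul_mul_mul_comm _ _ _ _

variable (hφs : ContDiff ℝ ∞ φ) (hψs : ContDiff ℝ ∞ ψ) {β : ℝ} (hβ : 0 < β)
  (hφ : HasGaussianRate β φ) (hψ : HasGaussianRate β ψ) (c : Fin N → ℂ)
  (a b i j k l m p q L M : Fin N)

include hφs hψs hβ hφ hψ

lemma integrable_termIntegral {h : ℝ} (hh : 0 < h) (hβh : 8 * β * h ≤ 1) :
    Integrable (fun z : (UN N × UN N) × Pairs N =>
      termCoeff a b i j k l m p q L M z.1 * symbolProd φ ψ i j k l (unitaryPair z.1, z.2) *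
      Complex.exp (phase (c a) (c b) m q L M z.2 / h)) (doubleMeasure N) := by
  obtain ⟨y, hy⟩ := exists_re_phase_le (c a) (c b) m q L M
  obtain ⟨C, hC0, hC⟩ := exists_norm_coeff_le (continuous_termCoeff a b i j k l m p q L M)
  have hf : Continuous fun z : (UN N × UN N) × Pairs N =>
      symbolProd φ ψ i j k l (unitaryPair z.1, z.2) :=
    (contDiff_symbolProd hφs hψs i j k l).continuous.comp
      ((continuous_unitaryPair.comp continuous_fst).prodMk continuous_snd)
  have := (integrable_term (χ := fun _ => 1) (continuous_termCoeff a b i j k l m p q L M) hf hβ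
    (integrable_symbolProd hφs.continuous hψs.continuous hφ hψ i j k l)
    (continuous_phase (c a) (c b) m q L M) continuous_const (fun _ => by simp)
    (fun x _ => hy x) hh (by linarith) hC0 hC).1
  simpa using this

lemma isRapidlyDecaying_termIntegral
    (hne : (L ≠ m ∧ c a ≠ 0) ∨ (M ≠ q ∧ c b ≠ 0) ∨ c a ≠ c b) :
    IsRapidlyDecaying (termIntegral φ ψ c a b i j k l m p q L M) := by
  obtain ⟨y, δ, hδ, hy⟩ := exists_re_phase_le_neg (m := m) (q := q) (L := L) (M := M) hne
  have hf : Continuous fun z : (UN N × UN N) × Pairs N =>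
      symbolProd φ ψ i j k l (unitaryPair z.1, z.2) :=
    (contDiff_symbolProd hφs hψs i j k l).continuous.comp
      ((continuous_unitaryPair.comp continuous_fst).prodMk continuous_snd)
  have := isRapidlyDecaying_term (χ := fun _ => 1) (continuous_termCoeff a b i j k l m p q L M) hf
    hβ (integrable_symbolProd hφs.continuous hψs.continuous hφ hψ i j k l)
    (continuous_phase (c a) (c b) m q L M) continuous_const (fun _ => by simp) hδ
    (by norm_num) (fun x _ => hy x)
  simp only [one_mul] at this
  exact this

lemma hasAsymptoticExpansion_termIntegral {y : Pairs N}
    (hy : ∀ x, phase (c a) (c b) m q L M (y + x) = quadExp m q x) :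
    HasAsymptoticExpansion (termIntegral φ ψ c a b i j k l m p q L M)
      (fun r => (r.factorial : ℂ)⁻¹ * ∫ U : UN N, (∫ W : UN N,
        termCoeff a b i j k l m p q L M (U, W) * opM m q r φ ψ i j k l U W y
          ∂(haarUN N)) ∂(haarUN N)) := by
  have hF := contDiff_symbolProd hφs hψs i j k l
  have h1 := hasAsymptoticExpansion_term (ν := (haarUN N).prod (haarUN N))
    (continuous_termCoeff a b i j k l m p q L M) continuous_unitaryPair hF hβ
    (integrable_symbolProd hφs.continuous hψs.continuous hφ hψ i j k l) m q
    (continuous_phase (c a) (c b) m q L M) hy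
  have h2 : ∀ r, ∫ w : UN N × UN N, termCoeff a b i j k l m p q L M w *
      (mixedOp m q)^[r] (fun x => symbolProd φ ψ i j k l (unitaryPair w, x)) y
        ∂((haarUN N).prod (haarUN N)) = ∫ U : UN N, (∫ W : UN N,
        termCoeff a b i j k l m p q L M (U, W) * opM m q r φ ψ i j k l U W y
          ∂(haarUN N)) ∂(haarUN N) := by
    intro r
    refine integral_prod _ (integrable_of_continuous_compact
      ((continuous_termCoeff a b i j k l m p q L M).mul ?_))
    simp only [iterate_mixedOp_partial m q r hF]
    exact (continuous_iterate_paramOp m q r hF).comp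
      (continuous_unitaryPair.prodMk continuous_const)
  simp only [h2] at h1
  exact h1

end Terms

end

section

variable {N : ℕ}

/-! ### The Berezin transform as a sum of terms -/

/-- Origin of the nine indices: `i, j` and `k, l` are entries of the symbols, `m, p, q` come from
the middle kernel, and `L`, `M` from the two outer ones, where the diagonal point leaves a single
sum each. -/
lemma sandwich_entry {h : ℝ} (hh : 0 < h) (φ ψ : Mat N → Mat N) (c : Fin N → ℂ) (U W : UN N)
    (d e : Fin N → ℂ) (a b : Fin N) :
    sandwich h φ ψ (Matrix.diagonal c) (spectralPoint U d) (spectralPoint W e) a b =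
      ∑ i, ∑ j, ∑ k, ∑ l, ∑ m, ∑ p, ∑ q, ∑ L, ∑ M,
        termCoeff a b i j k l m p q L M (U, W) *
          (φ (spectralPoint U d) i j * ψ (spectralPoint W e) k l) *
          (Complex.exp (c a * conj (d L) / h) * Complex.exp (d m * conj (e q) / h) *
            Complex.exp (e M * conj (c b) / h)) := by
  simp only [sandwich, Matrix.mul_apply, Finset.mul_sum]
  refine Finset.sum_congr rfl fun i _ => Finset.sum_congr rfl fun j _ =>
    Finset.sum_congr rfl fun k _ => Finset.sum_congr rfl fun l _ => ?_
  rw [kernel_diagonal_left hh, kernel_spectralPoint hh, kernel_diagonal_right hh]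
  set f : Fin N → ℂ := fun L => U.1 a L * conj (U.1 i L) * Complex.exp (c a * conj (d L) / h)
  set g : Fin N → ℂ := fun M => W.1 l M * conj (W.1 b M) * Complex.exp (e M * conj (c b) / h)
  set B := φ (spectralPoint U d) i j
  set D := ψ (spectralPoint W e) k l
  have hP : ((∑ L, f L) * ∑ M, g M) * (B * D) = ∑ L, ∑ M, f L * g M * (B * D) := by
    rw [Finset.sum_mul_sum]
    simp only [Finset.sum_mul]
  calc _ = (∑ m, ∑ p, ∑ q, U.1 j m * conj (U.1 p m) * W.1 p q * conj (W.1 k q) *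
        Complex.exp (d m * conj (e q) / h)) * (((∑ L, f L) * ∑ M, g M) * (B * D)) := by ring
    _ = _ := by
      rw [hP]
      simp only [Finset.sum_mul]
      simp only [Finset.mul_sum]
      refine Finset.sum_congr rfl fun m _ => Finset.sum_congr rfl fun p _ =>
        Finset.sum_congr rfl fun q _ => Finset.sum_congr rfl fun L _ =>
        Finset.sum_congr rfl fun M _ => ?_
      simp only [f, g, termCoeff]
      ring

/-- The indices `(i, j, k, l, m, p, q, L, M)` of the terms. -/
abbrev TermIndex (N : ℕ) : Type :=
  Fin N × Fin N × Fin N × Fin N × Fin N × Fin N × Fin N × Fin N × Fin N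

lemma sum_termIndex (f : Fin N → Fin N → Fin N → Fin N → Fin N → Fin N → Fin N → Fin N → Fin N → ℂ) :
    ∑ s : TermIndex N, f s.1 s.2.1 s.2.2.1 s.2.2.2.1 s.2.2.2.2.1
        s.2.2.2.2.2.1 s.2.2.2.2.2.2.1 s.2.2.2.2.2.2.2.1 s.2.2.2.2.2.2.2.2 =
      ∑ i, ∑ j, ∑ k, ∑ l, ∑ m, ∑ p, ∑ q, ∑ L, ∑ M, f i j k l m p q L M := by
  simp only [Fintype.sum_prod_type]

lemma sandwich_entry_eq_sum {h : ℝ} (hh : 0 < h) (φ ψ : Mat N → Mat N) (c : Fin N → ℂ)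
    (U W : UN N) (d e : Fin N → ℂ) (a b : Fin N) :
    sandwich h φ ψ (Matrix.diagonal c) (spectralPoint U d) (spectralPoint W e) a b =
      ∑ s : TermIndex N, termCoeff a b s.1 s.2.1 s.2.2.1 s.2.2.2.1 s.2.2.2.2.1
          s.2.2.2.2.2.1 s.2.2.2.2.2.2.1 s.2.2.2.2.2.2.2.1 s.2.2.2.2.2.2.2.2 (U, W) *
          (φ (spectralPoint U d) s.1 s.2.1 * ψ (spectralPoint W e) s.2.2.1 s.2.2.2.1) *
          (Complex.exp (c a * conj (d s.2.2.2.2.2.2.2.1) / h) *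
            Complex.exp (d s.2.2.2.2.1 * conj (e s.2.2.2.2.2.2.1) / h) *
            Complex.exp (e s.2.2.2.2.2.2.2.2 * conj (c b) / h)) := by
  rw [sandwich_entry hh]
  simp only [Fintype.sum_prod_type]

/-- The normalization `K_h(X, X)^{-1/2}` on both sides, the two weights and the three kernel
exponentials assemble into one phase. -/
lemma weight_mul_weight_mul_exp (h : ℝ) (U W : UN N) (x : Pairs N) (z w : ℂ)
    (m q L M : Fin N) :
    ((Real.exp (-((‖z‖ ^ 2 + ‖w‖ ^ 2) / 2 / h)) : ℝ) : ℂ) *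
      ((weight h (spectralPoint U x.1) : ℂ) * ((weight h (spectralPoint W x.2) : ℂ) *
      (Complex.exp (z * conj (x.1 L) / h) * Complex.exp (x.1 m * conj (x.2 q) / h) *
            Complex.exp (x.2 M * conj w / h)))) =
      (((Real.pi * h : ℝ) : ℂ) ^ (2 * N))⁻¹ * Complex.exp (phase z w m q L M x / h) := by
  have h1 : ∀ d : Fin N → ℂ, ∑ i, d i * conj (d i) = ((∑ i, ‖d i‖ ^ 2 : ℝ) : ℂ) := by
    intro d
    push_cast
    exact Finset.sum_congr rfl fun i _ => Complex.mul_conj' _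
  have h2 : Complex.exp (phase z w m q L M x / h) =
      Complex.exp ((-((‖z‖ ^ 2 + ‖w‖ ^ 2) / 2 / h) : ℝ) : ℂ) *
        Complex.exp ((-(∑ i, ‖x.1 i‖ ^ 2) / h : ℝ) : ℂ) *
        Complex.exp ((-(∑ i, ‖x.2 i‖ ^ 2) / h : ℝ) : ℂ) *
        (Complex.exp (z * conj (x.1 L) / h) * Complex.exp (x.1 m * conj (x.2 q) / h) *
            Complex.exp (x.2 M * conj w / h)) := by
    simp only [← Complex.exp_add]
    congr 1
    rw [phase, quadExp, h1, h1]
    push_cast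
    ring
  rw [h2, weight, weight, nsq_spectralPoint, nsq_spectralPoint]
  push_cast
  rw [two_mul, pow_add, mul_inv]
  ring

section Expansion

variable {φ ψ : Mat N → Mat N} (hφs : ContDiff ℝ ∞ φ) (hψs : ContDiff ℝ ∞ ψ) {β : ℝ} (hβ : 0 < β)
  (hφ : HasGaussianRate β φ) (hψ : HasGaussianRate β ψ) (c : Fin N → ℂ) (a b : Fin N)

include hφs hψs hβ hφ hψ

lemma berezin_eq_sum {h : ℝ} (hh : 0 < h) (hβh : 16 * β * h ≤ 1) :
    berezin h (toeplitz h φ ∘ toeplitz h ψ) (Matrix.diagonal c) a b =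
      ∑ s : TermIndex N, termIntegral φ ψ c a b s.1 s.2.1 s.2.2.1 s.2.2.2.1 s.2.2.2.2.1
        s.2.2.2.2.2.1 s.2.2.2.2.2.2.1 s.2.2.2.2.2.2.2.1 s.2.2.2.2.2.2.2.2 h := by
  have h8 : 8 * β * h ≤ 1 := by
    have : 0 < β * h := by positivity
    linarith
  rw [berezin_diagonal hh, Function.comp_apply,
    innerL2_toeplitz_toeplitz hφs.continuous hψs.continuous hh hβh hφ hψ, ← integral_const_mul]
  simp only [← integral_const_mul]
  set G : (UN N × (Fin N → ℂ)) × (UN N × (Fin N → ℂ)) → ℂ := fun z =>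
    ((Real.exp (-((‖c a‖ ^ 2 + ‖c b‖ ^ 2) / 2 / h)) : ℝ) : ℂ) *
      ((weight h (spectralPoint z.1.1 z.1.2) : ℂ) * ((weight h (spectralPoint z.2.1 z.2.2) : ℂ) *
        sandwich h φ ψ (Matrix.diagonal c) (spectralPoint z.1.1 z.1.2)
          (spectralPoint z.2.1 z.2.2) a b)) with hG
  have hGe : ∀ z : (UN N × UN N) × Pairs N, G (doubleEquiv N z) = ∑ s : TermIndex N,
      (((Real.pi * h : ℝ) : ℂ) ^ (2 * N))⁻¹ *
        (termCoeff a b s.1 s.2.1 s.2.2.1 s.2.2.2.1 s.2.2.2.2.1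
          s.2.2.2.2.2.1 s.2.2.2.2.2.2.1 s.2.2.2.2.2.2.2.1 s.2.2.2.2.2.2.2.2 z.1 *
        symbolProd φ ψ s.1 s.2.1 s.2.2.1 s.2.2.2.1 (unitaryPair z.1, z.2) *
        Complex.exp (phase (c a) (c b) s.2.2.2.2.1 s.2.2.2.2.2.2.1 s.2.2.2.2.2.2.2.1
          s.2.2.2.2.2.2.2.2 z.2 / h)) := by
    intro z
    have h1 : G (doubleEquiv N z) = ((Real.exp (-((‖c a‖ ^ 2 + ‖c b‖ ^ 2) / 2 / h)) : ℝ) : ℂ) *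
      ((weight h (spectralPoint z.1.1 z.2.1) : ℂ) * ((weight h (spectralPoint z.1.2 z.2.2) : ℂ) *
        sandwich h φ ψ (Matrix.diagonal c) (spectralPoint z.1.1 z.2.1)
          (spectralPoint z.1.2 z.2.2) a b)) := rfl
    rw [h1, sandwich_entry_eq_sum hh, Finset.mul_sum, Finset.mul_sum, Finset.mul_sum]
    refine Finset.sum_congr rfl fun s _ => ?_
    obtain ⟨i, j, k, l, m, p, q, L, M⟩ := s
    simp only
    have h2 := weight_mul_weight_mul_exp h z.1.1 z.1.2 z.2 (c a) (c b) m q L M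
    have h3 : symbolProd φ ψ i j k l (unitaryPair z.1, z.2) =
      φ (spectralPoint z.1.1 z.2.1) i j * ψ (spectralPoint z.1.2 z.2.2) k l := rfl
    rw [h3]
    linear_combination (termCoeff a b i j k l m p q L M z.1 *
      (φ (spectralPoint z.1.1 z.2.1) i j * ψ (spectralPoint z.1.2 z.2.2) k l)) * h2
  have hi := fun s : TermIndex N => (integrable_termIntegral hφs hψs hβ hφ hψ c a b s.1 s.2.1
    s.2.2.1 s.2.2.2.1 s.2.2.2.2.1 s.2.2.2.2.2.1 s.2.2.2.2.2.2.1 s.2.2.2.2.2.2.2.1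
    s.2.2.2.2.2.2.2.2 hh h8).const_mul ((((Real.pi * h : ℝ) : ℂ) ^ (2 * N))⁻¹)
  have hGi : Integrable (fun z => G (doubleEquiv N z)) (doubleMeasure N) := by
    simp only [hGe]
    exact integrable_finsetSum _ fun s _ => hi s
  refine (integral_integral_param hGi).trans ?_
  simp only [hGe]
  rw [integral_finsetSum _ fun s _ => hi s]
  simp only [integral_const_mul, termIntegral]

omit hφs hψs hβ hφ hψ

/-! ### Finite sums of expansions and the coefficients as sums over terms -/

lemma IsRapidlyDecaying.hasAsymptoticExpansion {F : ℝ → ℂ} (hF : IsRapidlyDecaying F) :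
    HasAsymptoticExpansion F fun _ => 0 := fun R => by simpa using hF R

lemma HasAsymptoticExpansion.isRapidlyDecaying {F : ℝ → ℂ}
    (hF : HasAsymptoticExpansion F fun _ => 0) : IsRapidlyDecaying F := fun R => by
  simpa using hF R

lemma HasAsymptoticExpansion.sum {ι : Type*} {s : Finset ι} {F : ι → ℝ → ℂ} {α : ι → ℕ → ℂ}
    (hF : ∀ i ∈ s, HasAsymptoticExpansion (F i) (α i)) :
    HasAsymptoticExpansion (fun h => ∑ i ∈ s, F i h) fun r => ∑ i ∈ s, α i r := by
  intro R
  refine (IsBigO.fun_sum fun i hi => hF i hi R).congr_left fun h => ?_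
  rw [Finset.sum_sub_distrib, Finset.sum_comm]
  simp only [Finset.mul_sum]

/-- The limiting coefficients of a term. -/
noncomputable def termLimit (φ ψ : Mat N → Mat N) (a b i j k l m p q L M : Fin N) (y : Pairs N)
    (r : ℕ) : ℂ :=
  (r.factorial : ℂ)⁻¹ * ∫ U : UN N, (∫ W : UN N,
    termCoeff a b i j k l m p q L M (U, W) * opM m q r φ ψ i j k l U W y ∂(haarUN N)) ∂(haarUN N)

lemma coeffZero_eq_sum (φ ψ : Mat N → Mat N) (a b : Fin N) (r : ℕ) :
    coeffZero φ ψ a b r = ∑ s : TermIndex N, termLimit φ ψ a b s.1 s.2.1 s.2.2.1 s.2.2.2.1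
      s.2.2.2.2.1 s.2.2.2.2.2.1 s.2.2.2.2.2.2.1 s.2.2.2.2.2.2.2.1 s.2.2.2.2.2.2.2.2 0 r := by
  refine Eq.trans ?_ (sum_termIndex fun i j k l m p q L M =>
    termLimit φ ψ a b i j k l m p q L M 0 r).symm
  simp only [coeffZero, Finset.mul_sum]
  rfl

/-- The absent sums over `L` and `M` are restored with Kronecker deltas, so that the coefficients
match the integrals term by term. -/
lemma coeffNonzero_eq_sum (φ ψ : Mat N → Mat N) (z : ℂ) (a b : Fin N) (r : ℕ) :
    coeffNonzero φ ψ z a b r = ∑ s : TermIndex N,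
      if s.2.2.2.2.2.2.2.1 = s.2.2.2.2.1 ∧ s.2.2.2.2.2.2.2.2 = s.2.2.2.2.2.2.1 then
      termLimit φ ψ a b s.1 s.2.1 s.2.2.1 s.2.2.2.1
      s.2.2.2.2.1 s.2.2.2.2.2.1 s.2.2.2.2.2.2.1 s.2.2.2.2.2.2.2.1 s.2.2.2.2.2.2.2.2
      (Pi.single s.2.2.2.2.1 z, Pi.single s.2.2.2.2.2.2.1 z) r else 0 := by
  have h : ∀ (m q : Fin N) (f : Fin N → Fin N → ℂ),
      ∑ L, ∑ M, (if L = m ∧ M = q then f L M else 0) = f m q := by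
    intro m q f
    rw [Finset.sum_eq_single m (fun L _ hL => by simp [hL]) (by simp),
      Finset.sum_eq_single q (fun M _ hM => by simp [hM]) (by simp)]
    simp
  refine Eq.trans ?_ (sum_termIndex fun i j k l m p q L M => if L = m ∧ M = q then
    termLimit φ ψ a b i j k l m p q L M (Pi.single m z, Pi.single q z) r else 0).symm
  simp only [coeffNonzero, Finset.mul_sum]
  refine Finset.sum_congr rfl fun i _ => Finset.sum_congr rfl fun j _ =>
    Finset.sum_congr rfl fun k _ => Finset.sum_congr rfl fun l _ =>
    Finset.sum_congr rfl fun m _ => Finset.sum_congr rfl fun p _ =>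
    Finset.sum_congr rfl fun q _ => ?_
  rw [h m q fun L M => termLimit φ ψ a b i j k l m p q L M (Pi.single m z, Pi.single q z) r]
  rfl

include hφs hψs hβ hφ hψ

lemma hasAsymptoticExpansion_berezin {α : TermIndex N → ℕ → ℂ}
    (hα : ∀ s : TermIndex N, HasAsymptoticExpansion
      (termIntegral φ ψ c a b s.1 s.2.1 s.2.2.1 s.2.2.2.1 s.2.2.2.2.1
        s.2.2.2.2.2.1 s.2.2.2.2.2.2.1 s.2.2.2.2.2.2.2.1 s.2.2.2.2.2.2.2.2) (α s)) :
    HasAsymptoticExpansion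
      (fun h => berezin h (toeplitz h φ ∘ toeplitz h ψ) (Matrix.diagonal c) a b)
      (fun r => ∑ s, α s r) := by
  refine (HasAsymptoticExpansion.sum fun s _ => hα s).congr' ?_
  have hpos : 0 < 1 / (16 * β) := by positivity
  filter_upwards [Ioo_mem_nhdsGT hpos] with h hh
  refine (berezin_eq_sum hφs hψs hβ hφ hψ c a b hh.1 ?_).symm
  have := hh.2.le
  rw [le_div_iff₀ (by positivity)] at this
  linarith

theorem isRapidlyDecaying_berezin (hne : c a ≠ c b) : IsRapidlyDecaying fun h =>
    berezin h (toeplitz h φ ∘ toeplitz h ψ) (Matrix.diagonal c) a b := by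
  have h1 := hasAsymptoticExpansion_berezin hφs hψs hβ hφ hψ c a b (α := fun _ _ => 0)
    fun s => (isRapidlyDecaying_termIntegral hφs hψs hβ hφ hψ c a b _ _ _ _ _ _ _ _ _
      (Or.inr (Or.inr hne))).hasAsymptoticExpansion
  simp only [Finset.sum_const_zero] at h1
  exact h1.isRapidlyDecaying

theorem hasAsymptoticExpansion_berezin_nonzero (hab : c a = c b) (h0 : c a ≠ 0) :
    HasAsymptoticExpansion
      (fun h => berezin h (toeplitz h φ ∘ toeplitz h ψ) (Matrix.diagonal c) a b)
      (coeffNonzero φ ψ (c a) a b) := by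
  have h1 : coeffNonzero φ ψ (c a) a b = fun r => _ :=
    funext fun r => coeffNonzero_eq_sum φ ψ (c a) a b r
  rw [h1]
  refine hasAsymptoticExpansion_berezin hφs hψs hβ hφ hψ c a b fun s => ?_
  obtain ⟨i, j, k, l, m, p, q, L, M⟩ := s
  simp only
  by_cases hLM : L = m ∧ M = q
  · obtain ⟨rfl, rfl⟩ := hLM
    simp only [and_self, if_true]
    refine hasAsymptoticExpansion_termIntegral hφs hψs hβ hφ hψ c a b i j k l L p M L M
      fun x => ?_
    rw [← hab]
    exact phase_single_add (c a) L M x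
  · simp only [hLM, if_false]
    refine (isRapidlyDecaying_termIntegral hφs hψs hβ hφ hψ c a b i j k l m p q L M
      ?_).hasAsymptoticExpansion
    have h0' : c b ≠ 0 := hab ▸ h0
    -- Both eigenvalues are nonzero, so a failure of `L = m` or of `M = q` already makes the term
    -- negligible.
    tauto

theorem hasAsymptoticExpansion_berezin_zero (ha : c a = 0) (hb : c b = 0) :
    HasAsymptoticExpansion
      (fun h => berezin h (toeplitz h φ ∘ toeplitz h ψ) (Matrix.diagonal c) a b)
      (coeffZero φ ψ a b) := by
  have h1 : coeffZero φ ψ a b = fun r => _ := funext fun r => coeffZero_eq_sum φ ψ a b r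
  rw [h1]
  refine hasAsymptoticExpansion_berezin hφs hψs hβ hφ hψ c a b fun s =>
    hasAsymptoticExpansion_termIntegral hφs hψs hβ hφ hψ c a b _ _ _ _ _ _ _ _ _ fun x => ?_
  rw [ha, hb, phase_zero, zero_add]

end Expansion

end

section

variable {N : ℕ}

/-! ### Extension of smooth symbols to all matrices -/

lemma isClosed_normalMatrices : IsClosed (normalMatrices N) := by
  have h1 : Continuous fun Z : Mat N => Zᴴ * Z :=
    continuous_id.matrix_conjTranspose.matrix_mul continuous_id
  have h2 : Continuous fun Z : Mat N => Z * Zᴴ :=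
    continuous_id.matrix_mul continuous_id.matrix_conjTranspose
  exact isClosed_eq h1 h2

/-- Local extensions are glued by a partition of unity. The constraint "equal to `φ x` on `s`,
arbitrary elsewhere" is convex at each point, and closedness of `s` makes it trivially solvable near
points off `s`. -/
lemma exists_contDiff_extension {E F : Type*} [NormedAddCommGroup E] [NormedSpace ℝ E]
    [FiniteDimensional ℝ E] [NormedAddCommGroup F] [NormedSpace ℝ F] {s : Set E}
    (hs : IsClosed s) {φ : E → F} (hφ : ∀ x ∈ s, ∃ V : Set E, IsOpen V ∧ x ∈ V ∧
      ∃ g : E → F, ContDiffOn ℝ ∞ g V ∧ Set.EqOn φ g (V ∩ s)) :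
    ∃ f : E → F, ContDiff ℝ ∞ f ∧ Set.EqOn φ f s := by
  classical
  obtain ⟨f, hf⟩ := exists_contMDiffMap_forall_mem_convex_of_local (n := ⊤)
    (modelWithCornersSelf ℝ E) (t := fun x => if x ∈ s then {φ x} else Set.univ)
    (fun x => by
      by_cases hx : x ∈ s
      · simp only [hx, if_true]
        exact convex_singleton _
      · simp only [hx, if_false]
        exact convex_univ)
    (fun x => by
      by_cases hx : x ∈ s
      · obtain ⟨V, hV, hxV, g, hg, hφg⟩ := hφ x hx
        refine ⟨V, hV.mem_nhds hxV, g, hg.contMDiffOn, fun y hy => ?_⟩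
        by_cases hyN : y ∈ s
        · simp only [hyN, if_true]
          exact (hφg ⟨hy, hyN⟩).symm
        · simp [hyN]
      · refine ⟨sᶜ, hs.isOpen_compl.mem_nhds hx, fun _ => 0, contMDiffOn_const, fun y hy => ?_⟩
        have hy' : y ∉ s := hy
        simp [hy'])
  refine ⟨f, f.contMDiff.contDiff, fun x hx => ?_⟩
  have h := hf x
  simp only [hx, if_true] at h
  exact h.symm

lemma SmoothOnNormal.exists_extension {φ : Mat N → Mat N} (hφ : SmoothOnNormal φ) :
    ∃ f : Mat N → Mat N, ContDiff ℝ ∞ f ∧ Set.EqOn φ f (normalMatrices N) :=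
  exists_contDiff_extension isClosed_normalMatrices hφ

/-! ### Independence of the values off the normal matrices -/

section Congr

variable {φ φ' : Mat N → Mat N} (hφ : Set.EqOn φ φ' (normalMatrices N))

include hφ

lemma GaussianIntegrable.congr (h : GaussianIntegrable φ) : GaussianIntegrable φ' := by
  obtain ⟨h₀, hh, hint⟩ := h
  refine ⟨h₀, hh, fun i j => (hint i j).congr ?_⟩
  filter_upwards [ae_mem_normalMatrices h₀] with Y hY
  rw [hφ hY]

lemma toeplitz_congr (h : ℝ) : toeplitz h φ = toeplitz h φ' := by
  funext f X
  refine integral_congr_ae ?_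
  filter_upwards [ae_mem_normalMatrices h] with Y hY
  rw [hφ hY]

lemma toeplitzDefined_congr {h : ℝ} {f : Mat N → Fin N → ℂ} (H : ToeplitzDefined h φ' f) :
    ToeplitzDefined h φ f := by
  refine ⟨H.1, fun X hX => (H.2.1 X hX).congr ?_, toeplitz_congr hφ h ▸ H.2.2⟩
  filter_upwards [ae_mem_normalMatrices h] with Y hY
  rw [hφ hY]

/-- `U diag(d) U*` is normal for every `d`, so the functions being differentiated coincide
identically and not merely at one point. -/
lemma opM_congr {ψ ψ' : Mat N → Mat N} (hψ : Set.EqOn ψ ψ' (normalMatrices N)) (m q : Fin N)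
    (r : ℕ) (i j k l : Fin N) (U W : UN N) :
    opM m q r φ ψ i j k l U W = opM m q r φ' ψ' i j k l U W := by
  simp only [opM, hφ (spectralPoint_mem U _), hψ (spectralPoint_mem W _)]

end Congr

end

end BerezinToeplitz

open BerezinToeplitz

theorem mainTheorem8 (N : ℕ) (φ ψ : Mat N → Mat N)
    (hφ : SmoothOnNormal φ) (hψ : SmoothOnNormal ψ)
    (hφ_int : GaussianIntegrable φ) (hψ_int : GaussianIntegrable ψ)
    (c : Fin N → ℂ) :
    (∀ᶠ h : ℝ in 𝓝[>] 0, ∀ χ : Fin N → ℂ,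
      ToeplitzDefined h ψ (kernelFun h (Matrix.diagonal c) χ) ∧
      ToeplitzDefined h φ (toeplitz h ψ (kernelFun h (Matrix.diagonal c) χ))) ∧
    ∀ a b : Fin N,
      (c a ≠ c b →
        IsRapidlyDecaying fun h =>
          berezin h (toeplitz h φ ∘ toeplitz h ψ) (Matrix.diagonal c) a b) ∧
      (c a = c b → c a ≠ 0 →
        HasAsymptoticExpansion
          (fun h => berezin h (toeplitz h φ ∘ toeplitz h ψ) (Matrix.diagonal c) a b)
          (coeffNonzero φ ψ (c a) a b)) ∧
      (c a = 0 → c b = 0 →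
        HasAsymptoticExpansion
          (fun h => berezin h (toeplitz h φ ∘ toeplitz h ψ) (Matrix.diagonal c) a b)
          (coeffZero φ ψ a b)) := by
  obtain ⟨f, hf, hφf⟩ := hφ.exists_extension
  obtain ⟨g, hg, hψg⟩ := hψ.exists_extension
  obtain ⟨β₁, hβ₁, hf1⟩ := exists_hasGaussianRate hf.continuous (hφ_int.congr hφf)
  obtain ⟨β₂, hβ₂, hg2⟩ := exists_hasGaussianRate hg.continuous (hψ_int.congr hψg)
  have hβ : 0 < max β₁ β₂ := lt_max_of_lt_left hβ₁
  have hfβ := hf1.mono (le_max_left β₁ β₂) hf.continuous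
  have hgβ := hg2.mono (le_max_right β₁ β₂) hg.continuous
  have hc1 : coeffNonzero φ ψ = coeffNonzero f g := by
    funext z a b r
    simp only [coeffNonzero, opM_congr hφf hψg]
  have hc2 : coeffZero φ ψ = coeffZero f g := by
    funext a b r
    simp only [coeffZero, opM_congr hφf hψg]
  simp only [hc1, hc2, toeplitz_congr hφf, toeplitz_congr hψg]
  refine ⟨?_, fun a b => ⟨isRapidlyDecaying_berezin hf hg hβ hfβ hgβ c a b,
    hasAsymptoticExpansion_berezin_nonzero hf hg hβ hfβ hgβ c a b,
    hasAsymptoticExpansion_berezin_zero hf hg hβ hfβ hgβ c a b⟩⟩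
  -- The threshold at which the growth budgets of both Toeplitz operators close.
  have hpos : 0 < 1 / (16 * max β₁ β₂) := by positivity
  filter_upwards [Ioo_mem_nhdsGT hpos] with h hh χ
  have hβh : 16 * max β₁ β₂ * h ≤ 1 := by
    have := hh.2.le
    rw [le_div_iff₀ (by positivity)] at this
    linarith
  obtain ⟨h1, h2⟩ := toeplitzDefined_kernelFun hf.continuous hg.continuous hh.1 hβh hfβ hgβ
    (Matrix.diagonal c) χ
  exact ⟨toeplitzDefined_congr hψg h1, toeplitzDefined_congr hφf h2⟩
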